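/- **Setting.** Let $M$ be a smooth manifold (finite-dimensional, Hausdorff, second countable, without boundary), $\mathcal X(M)$ its smooth real vector fields and $\mathcal X_c(M)$ those of compact support. For $X\in\mathcal X_c(M)$ let $\exp(X)\cdot x$ be the time-one flow of $X$ from $x$. A family $S\subseteq\mathcal D$ *generates* $\mathcal D\subseteq\mathcal X_c(M)$ on $U\subseteq M$ if every $Y\in\mathcal D$ agrees on $U$ with a finite sum $\sum f_jX_j$, $f_j\in C^\infty(M,\mathbb R)$, $X_j\in S$. A *generalised distribution* is a $C^\infty(M,\mathbb R)$-submodule of $\mathcal X_c(M)$ that has, near every point, a finite generating family. A *filtered foliation of depth $N$* is a filtration by generalised distributions $0=\mathcal F^0\subseteq\mathcal F^1\subseteq\dots\subseteq\mathcal F^N=\mathcal X_c(M)$ with $[\mathcal F^i,\mathcal F^j]\subseteq\mathcal F^{i+j}$, where $\mathcal F^n=\mathcal X_c(M)$ for $n\ge N$. With $I_p=\{f\in C^\infty(M,\mathbb R):f(p)=0\}$ and $\mathcal F^k_p=\mathcal F^k/I_p\mathcal F^k$, put $$\mathfrak{gr}(\mathcal F)_p=\bigoplus_{k=1}^N \mathcal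 F^k_p/\mathcal F^{k-1}_p=\bigoplus_{k=1}^N\frac{\mathcal F^k}{\mathcal F^{k-1}+I_p\mathcal F^k}.$$ Write $\mathbb R_+=[0,\infty)$, $\mathbb R_+^\times=(0,\infty)$. A *graded basis* is $(V,\natural,\mathbb U,U)$, where $V=\bigoplus_{i=1}^NV^i$ is a finite-dimensional graded real vector space with dilations $\alpha_\lambda(\sum v_i)=\sum\lambda^iv_i$, $\natural:V\to\mathcal X_c(M)$ is linear, $U\subseteq M$ is open, and $\mathbb U\subseteq V\times U\times\mathbb R_+$ is a neighbourhood of $\{0\}\times U\times\{0\}$ invariant under $\alpha_\lambda(X,x,t)=(\alpha_\lambda X,x,\lambda^{-1}t)$, $\lambda>0$, such that for $1\le k\le N$: $\natural(V^k)\subseteq\mathcal F^k$; $\natural(\bigoplus_{i\le k}V^i)$ generates $\mathcal F^k$ on $U$; and the map $$\mathrm{ev}(X,x,t)=(\exp(\natural(\alpha_tX))\cdot x,\,x,\,t)\in M\times M\times\mathbb R_+$$ is a submersion at every point of $\mathbb U$ with $t>0$. It is *minimal at $p\in U$* if $\dim V^k=\dim(\mathcal F^k_p/\mathcal F^{k-1}_p)$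 for all $k$. For $x\in U$ let $\natural_x:V\to\mathfrak{gr}(\mathcal F)_x$ be the linear map sending $X\in V^k$ to the class of $\natural(X)$ in $\mathcal F^k_x/\mathcal F^{k-1}_x$, and set $\mathrm{ev}_{x,0}(X,x,0)=\natural_x(X)$. A *graded Lie basis* is a graded basis $(\mathfrak g,\natural,\mathbb U,U)$ together with a Lie bracket on $\mathfrak g$ with $[\mathfrak g^i,\mathfrak g^j]\subseteq\mathfrak g^{i+j}$ (zero if $i+j>N$) and $\natural([X,Y])=[\natural(X),\natural(Y)]$ for $X\in\mathfrak g^i$, $Y\in\mathfrak g^j$, $i+j\le N$. Let $\mathrm{BCH}(X,Y)=\log(e^Ye^X)=X+Y-\tfrac12[X,Y]+\tfrac1{12}[X,[X,Y]]+\tfrac1{12}[Y,[Y,X]]+\cdots$ be the Baker–Campbell–Hausdorff product (in the sign convention of right-invariant vector fields); on $\mathfrak g$ it is a finite sum. Neighbourhoods that serve as domains of maps are taken relatively open. **Theorem 1.** Let $(\mathfrak g,\natural,\mathbb U,U)$ be a graded Lie basis. There is a smooth map $\phi:\mathrm{dom}(\phi)\subseteq\mathfrak g\times\mathfrak g\times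 U\times\mathbb R_+\to\mathbb U$, defined on a neighbourhood of $\{0\}\times\{0\}\times U\times\{0\}$ invariant under the $\mathbb R_+^\times$-action $\alpha_\lambda(Y,X,x,t)=(\alpha_\lambda Y,\alpha_\lambda X,x,\lambda^{-1}t)$, such that: (a) $\phi$ is an $\mathbb R_+^\times$-equivariant submersion; (b) for all $(Y,X,x,t)\in\mathrm{dom}(\phi)$, $\mathrm{ev}(\phi(Y,X,x,t))=\big(\exp(\natural(\alpha_tY))\cdot(\exp(\natural(\alpha_tX))\cdot x),\,x,\,t\big)$; (c) for all $Y,X\in\mathfrak g$ and $x\in U$, $(Y,X,x,0)\in\mathrm{dom}(\phi)$ and $\phi(Y,X,x,0)=(\mathrm{BCH}(Y,X),x,0)$; (d) if $(0,X,x,t)\in\mathrm{dom}(\phi)$ then $\phi(0,X,x,t)=(X,x,t)$; if $(Y,0,x,t)\in\mathrm{dom}(\phi)$ then $\phi(Y,0,x,t)=(Y,x,t)$. **Theorem 2.** Let $(V,\natural,\mathbb U,U)$ and $(V',\natural',\mathbb U',U)$ be graded bases with the same $U$, let $p\in U$, and suppose the second is minimal at $p$. There is a smooth map $\phi:\mathrm{dom}(\phi)\subseteq\mathbb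 U\to\mathbb U'$, defined on an $\mathbb R_+^\times$-invariant neighbourhood of $\{0\}\times\{p\}\times\{0\}$, such that: (a) $\phi$ is an $\mathbb R_+^\times$-equivariant submersion; (b) $\mathrm{ev}\circ\phi=\mathrm{ev}$ on $\mathrm{dom}(\phi)$; (c) for every $x\in U$ with $(0,x,0)\in\mathrm{dom}(\phi)$, $\phi$ is defined on $V\times\{x\}\times\{0\}$, maps it into $V'\times\{x\}\times\{0\}$, and $\mathrm{ev}_{x,0}\circ\phi=\mathrm{ev}_{x,0}$ there, i.e. $\phi(X,x,0)=(X',x,0)$ with $\natural'_x(X')=\natural_x(X)$. -/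

import Mathlib

open scoped Manifold ContDiff Topology

noncomputable section

namespace FilteredFol

section VectorFields

variable (E : Type*) [NormedAddCommGroup E] [NormedSpace ℝ E]
  (M : Type*) [TopologicalSpace M] [ChartedSpace E M] [IsManifold 𝓘(ℝ, E) ∞ M]

/-- `𝒳(M)`: smooth real vector fields on `M`. -/
abbrev VF : Type _ :=
  ContMDiffSection 𝓘(ℝ, E) E ∞ (TangentSpace 𝓘(ℝ, E) : M → Type _)

/-- `C^∞(M, ℝ)`. -/
abbrev SmoothFun : Type _ := ContMDiffMap 𝓘(ℝ, E) 𝓘(ℝ, ℝ) M ℝ ∞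

variable {E M}

/-- The product `f X` of a smooth function and a smooth vector field. -/
def fsmul (f : SmoothFun E M) (X : VF E M) : VF E M :=
  ⟨fun x => f x • X x, f.contMDiff.smul_section X.contMDiff⟩

/-- `X` belongs to `𝒳_c(M)`, i.e. it vanishes outside a compact set. -/
def CompactlySupported (X : VF E M) : Prop :=
  ∃ K : Set M, IsCompact K ∧ ∀ x ∉ K, X x = 0

open Classical in
/-- `exp(X) · x`: the time-one flow of `X` starting at `x`, i.e. `γ 1` for the integral curve `γ` of
`X` with `γ 0 = x`. (On a Hausdorff manifold this curve is unique; it exists whenever `X` has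
compact support, and the value is `x` if it does not exist.) -/
def flowOne (X : VF E M) (x : M) : M :=
  if h : ∃ γ : ℝ → M, γ 0 = x ∧ IsMIntegralCurve (I := 𝓘(ℝ, E)) γ (fun y => X y)
  then h.choose 1 else x

/-- The set of vector fields `S` generates `D` on `U`: every element of `D` is equal on `U` to a
finite combination of elements of `S` with coefficients in `C^∞(M)`. -/
def GeneratesOn (S : Set (VF E M)) (D : Submodule ℝ (VF E M)) (U : Set M) : Prop :=
  ∀ Y ∈ D, ∃ (m : ℕ) (X : Fin m → VF E M) (f : Fin m → SmoothFun E M),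
    (∀ j, X j ∈ S) ∧ ∀ x ∈ U, Y x = ∑ j, f j x • X j x

/-- A generalised distribution: a locally finitely generated `C^∞(M)`-submodule of `𝒳_c(M)`. -/
structure IsGeneralisedDistribution (D : Submodule ℝ (VF E M)) : Prop where
  fsmul_mem : ∀ (f : SmoothFun E M), ∀ X ∈ D, fsmul f X ∈ D
  compactlySupported : ∀ X ∈ D, CompactlySupported X
  locally_fg : ∀ p : M, ∃ U : Set M, IsOpen U ∧ p ∈ U ∧
    ∃ S : Set (VF E M), S.Finite ∧ S ⊆ D ∧ GeneratesOn S D U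

variable (E M) in
/-- A filtered foliation of depth `N` on `M`. -/
structure FilteredFoliation (N : ℕ) where
  /-- the modules `𝓕^0 ⊆ 𝓕^1 ⊆ …` -/
  mod : ℕ → Submodule ℝ (VF E M)
  distribution : ∀ i, IsGeneralisedDistribution (mod i)
  mono : Monotone mod
  zero : mod 0 = ⊥
  top : ∀ n, N ≤ n → ∀ X : VF E M, X ∈ mod n ↔ CompactlySupported X
  bracket_mem : ∀ i j, ∀ X ∈ mod i, ∀ Y ∈ mod j, ∃ Z ∈ mod (i + j),
    ∀ x, Z x = VectorField.mlieBracket 𝓘(ℝ, E) (fun y => X y) (fun y => Y y) x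

variable {N : ℕ}

/-- `𝓕^i + I_p 𝓕^{i+1}`, where `I_p` is the ideal of smooth functions vanishing at `p`. -/
def lowerOrder (F : FilteredFoliation E M N) (i : Fin N) (p : M) : Submodule ℝ (VF E M) :=
  F.mod i ⊔ Submodule.span ℝ
    {Z | ∃ f : SmoothFun E M, f p = 0 ∧ ∃ X ∈ F.mod (i + 1), Z = fsmul f X}

/-- `𝓕^{i+1}_p / 𝓕^i_p = 𝓕^{i+1} / (𝓕^i + I_p 𝓕^{i+1})`, the part of weight `i + 1` of the
osculating Lie algebra at `p`. -/
abbrev grPiece (F : FilteredFoliation E M N) (i : Fin N) (p : M) : Type _ :=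
  F.mod (i + 1) ⧸ (lowerOrder F i p).comap (F.mod (i + 1)).subtype

/-- The vector space `𝔤𝔯(𝓕)_p = ⊕_{k=1}^N 𝓕^k_p / 𝓕^{k-1}_p` (weight `k` is indexed
by `k - 1 : Fin N`). -/
abbrev Gr (F : FilteredFoliation E M N) (p : M) : Type _ := ∀ i : Fin N, grPiece F i p

end VectorFields

section Graded

variable {N : ℕ} {V : Fin N → Type*} [∀ i, NormedAddCommGroup (V i)] [∀ i, NormedSpace ℝ (V i)]

/-- The underlying space of the graded vector space `⊕_{k=1}^N V^k`. The summand of weight `k` is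
indexed by `k - 1 : Fin N`. -/
abbrev Tot (V : Fin N → Type*) : Type _ := ∀ i : Fin N, V i

/-- The weight in `{1, …, N}` of the summand indexed by `i : Fin N`. -/
def wt (i : Fin N) : ℕ := i + 1

/-- The graded dilation `α_c`, multiplying the summand of weight `k` by `c ^ k`. -/
def dil (c : ℝ) (X : Tot V) : Tot V := fun i => c ^ wt i • X i

/-- The action `α_c (X, x, t) = (α_c X, x, c⁻¹ t)` on `V × M × ℝ`. -/
def act {M : Type*} (c : ℝ) (q : Tot V × M × ℝ) : Tot V × M × ℝ :=
  (dil c q.1, q.2.1, c⁻¹ * q.2.2)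

/-- The action `α_c (Y, X, x, t) = (α_c Y, α_c X, x, c⁻¹ t)` on `V × V × M × ℝ`. -/
def act₂ {M : Type*} (c : ℝ) (q : Tot V × Tot V × M × ℝ) : Tot V × Tot V × M × ℝ :=
  (dil c q.1, dil c q.2.1, q.2.2.1, c⁻¹ * q.2.2.2)

/-- The space `V × U × ℝ₊`, as a subset of `V × M × ℝ`; here `ℝ₊ = [0, ∞)`. -/
def halfSpace (V : Fin N → Type*) {M : Type*} (U : Set M) : Set (Tot V × M × ℝ) :=
  {q | q.2.1 ∈ U ∧ 0 ≤ q.2.2}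

/-- The space `V × V × U × ℝ₊`, as a subset of `V × V × M × ℝ`. -/
def halfSpace₂ (V : Fin N → Type*) {M : Type*} (U : Set M) : Set (Tot V × Tot V × M × ℝ) :=
  {q | q.2.2.1 ∈ U ∧ 0 ≤ q.2.2.2}

/-- `B` is a Lie bracket on `⊕ V^k` with `[V^i, V^j] ⊆ V^{i+j}` (so `[V^i, V^j] = 0` if
`i + j > N`). -/
structure IsGradedLieBracket (B : Tot V →ₗ[ℝ] Tot V →ₗ[ℝ] Tot V) : Prop where
  alt : ∀ X, B X X = 0
  jacobi : ∀ X Y Z, B X (B Y Z) + B Y (B Z X) + B Z (B X Y) = 0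
  graded : ∀ (i j k : Fin N) (a : V i) (b : V j), wt k ≠ wt i + wt j →
    B (Pi.single i a) (Pi.single j b) k = 0

/-- The right-nested bracket `[a₁, [a₂, … [a_{m-1}, a_m] … ]]` of a list; it is `a₁` if `m = 1`. -/
def nestedBracket {L : Type*} [AddCommGroup L] [Module ℝ L] (B : L →ₗ[ℝ] L →ₗ[ℝ] L) : List L → L
  | [] => 0
  | [a] => a
  | a :: b :: l => B a (nestedBracket B (b :: l))

/-- The Baker–Campbell–Hausdorff product
`BCH(X, Y) = X + Y - ½ [X, Y] + …` for the bracket `B`, i.e. `log (e^Y e^X)` in the usual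
convention, written with Dynkin's formula
`∑_{n ≥ 1} (-1)^{n-1}/n ∑_{r_i + s_i ≥ 1} [Y^{r_1} X^{s_1} ⋯ Y^{r_n} X^{s_n}] /
(∑ (r_i + s_i) ∏ r_i! s_i!)`.
Only `n, r_i, s_i ≤ N` are kept: if brackets of more than `N` elements vanish, as they do for a
graded Lie bracket in weights `1, …, N`, this is the whole series. -/
def bch {L : Type*} [AddCommGroup L] [Module ℝ L] (N : ℕ) (B : L →ₗ[ℝ] L →ₗ[ℝ] L) (X Y : L) : L :=
  ∑ n ∈ Finset.Icc 1 N, ((-1 : ℝ) ^ (n - 1) / n) •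
    ∑ rs ∈ (Finset.univ : Finset (Fin n → Fin (N + 1) × Fin (N + 1))).filter
        (fun rs => ∀ i, 1 ≤ ((rs i).1 : ℕ) + ((rs i).2 : ℕ)),
      ((1 : ℝ) / ((∑ i, (((rs i).1 : ℕ) + ((rs i).2 : ℕ)) : ℕ) *
        (∏ i, ((rs i).1 : ℕ).factorial * ((rs i).2 : ℕ).factorial : ℕ))) •
      nestedBracket B (List.ofFn fun i =>
        List.replicate (rs i).1 Y ++ List.replicate (rs i).2 X).flatten

end Graded

section Submersion

variable {E₁ H₁ M₁ E₂ H₂ M₂ : Type*}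
  [NormedAddCommGroup E₁] [NormedSpace ℝ E₁] [TopologicalSpace H₁]
  [TopologicalSpace M₁] [ChartedSpace H₁ M₁]
  [NormedAddCommGroup E₂] [NormedSpace ℝ E₂] [TopologicalSpace H₂]
  [TopologicalSpace M₂] [ChartedSpace H₂ M₂]

/-- `f` is smooth on `s` and its differential is surjective at every point of `s`. This is used for
sets `s` which are relatively open in a product of `[0, ∞)` with a boundaryless manifold. -/
def IsSubmersionOn (I₁ : ModelWithCorners ℝ E₁ H₁) (I₂ : ModelWithCorners ℝ E₂ H₂)
    (f : M₁ → M₂) (s : Set M₁) : Prop :=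
  ContMDiffOn I₁ I₂ ∞ f s ∧ ∀ q ∈ s, Function.Surjective (mfderivWithin I₁ I₂ f s q)

end Submersion

section Bases

variable {E : Type*} [NormedAddCommGroup E] [NormedSpace ℝ E]
  {M : Type*} [TopologicalSpace M] [ChartedSpace E M] [IsManifold 𝓘(ℝ, E) ∞ M]
  {N : ℕ} {V : Fin N → Type*} [∀ i, NormedAddCommGroup (V i)] [∀ i, NormedSpace ℝ (V i)]

/-- The model for `V × M × ℝ`. -/
abbrev modelBU (E : Type*) [NormedAddCommGroup E] [NormedSpace ℝ E]
    (V : Fin N → Type*) [∀ i, NormedAddCommGroup (V i)] [∀ i, NormedSpace ℝ (V i)] :=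
  𝓘(ℝ, Tot V).prod (𝓘(ℝ, E).prod 𝓘(ℝ, ℝ))

/-- The evaluation map `(X, x, t) ↦ (exp(♮(α_t X)) · x, x, t)`. -/
def ev (nat : Tot V →ₗ[ℝ] VF E M) (q : Tot V × M × ℝ) : M × M × ℝ :=
  (flowOne (nat (dil q.2.2 q.1)) q.2.1, q.2.1, q.2.2)

/-- A graded basis `(V, ♮, 𝕌, U)` for the filtered foliation `F`; the sets `U` and `𝕌` are the
fields `base` and `dom`. -/
structure GradedBasis (F : FilteredFoliation E M N)
    (V : Fin N → Type*) [∀ i, NormedAddCommGroup (V i)] [∀ i, NormedSpace ℝ (V i)] where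
  nat : Tot V →ₗ[ℝ] VF E M
  base : Set M
  isOpen_base : IsOpen base
  dom : Set (Tot V × M × ℝ)
  dom_subset : dom ⊆ halfSpace V base
  dom_mem_nhds : ∀ x ∈ base, dom ∈ 𝓝[halfSpace V base] ((0, x, 0) : Tot V × M × ℝ)
  act_mem : ∀ c : ℝ, 0 < c → ∀ q ∈ dom, act c q ∈ dom
  nat_mem : ∀ (i : Fin N) (a : V i), nat (Pi.single i a) ∈ F.mod (i + 1)
  generates : ∀ k ∈ Finset.Icc 1 N,
    GeneratesOn {Z | ∃ X : Tot V, (∀ i, k < wt i → X i = 0) ∧ Z = nat X} (F.mod k) base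
  submersion : ∀ q ∈ dom, 0 < q.2.2 →
    ContMDiffAt (modelBU E V) (𝓘(ℝ, E).prod (𝓘(ℝ, E).prod 𝓘(ℝ, ℝ))) ∞ (ev nat) q ∧
    Function.Surjective
      (mfderiv (modelBU E V) (𝓘(ℝ, E).prod (𝓘(ℝ, E).prod 𝓘(ℝ, ℝ))) (ev nat) q)

namespace GradedBasis

variable {F : FilteredFoliation E M N}

/-- `♮_p : V → 𝔤𝔯(𝓕)_p`, sending `X ∈ V^k` to the class of `♮(X)` in `𝓕^k_p / 𝓕^{k-1}_p`. This is
also the evaluation map `ev_{p,0} : V × {p} × {0} → 𝔤𝔯(𝓕)_p`. -/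
def natAt (b : GradedBasis F V) (p : M) : Tot V →ₗ[ℝ] Gr F p :=
  LinearMap.pi fun i =>
    (((lowerOrder F i p).comap (F.mod (i + 1)).subtype).mkQ ∘ₗ
      (b.nat ∘ₗ LinearMap.single ℝ V i).codRestrict (F.mod (i + 1)) (b.nat_mem i)) ∘ₗ
      LinearMap.proj i

/-- The graded basis is minimal at `p`. -/
def IsMinimalAt (b : GradedBasis F V) (p : M) : Prop :=
  p ∈ b.base ∧ ∀ k : Fin N, Module.finrank ℝ (V k) = Module.finrank ℝ (grPiece F k p)

end GradedBasis

/-- A graded Lie basis: a graded basis with a graded Lie bracket on `V` such that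
`♮([X, Y]) = [♮(X), ♮(Y)]` for `X ∈ V^i`, `Y ∈ V^j`, `i + j ≤ N`. -/
structure GradedLieBasis (F : FilteredFoliation E M N)
    (V : Fin N → Type*) [∀ i, NormedAddCommGroup (V i)] [∀ i, NormedSpace ℝ (V i)]
    extends GradedBasis F V where
  bracket : Tot V →ₗ[ℝ] Tot V →ₗ[ℝ] Tot V
  isGradedLieBracket : IsGradedLieBracket bracket
  nat_bracket : ∀ (i j : Fin N) (a : V i) (b : V j), wt i + wt j ≤ N → ∀ x : M,
    nat (bracket (Pi.single i a) (Pi.single j b)) x =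
      VectorField.mlieBracket 𝓘(ℝ, E) (fun y => nat (Pi.single i a) y)
        (fun y => nat (Pi.single j b) y) x

end Bases

end FilteredFol

end

/-! Both theorems are cases of one lifting problem. Let `♮ X` be fields linear in `X : V`, and let
`♮_W Y = ♮ (S Y)` be further fields with smooth coefficients `S`. The task is to find `Z(Y, X, x,
t)`, smooth down to `t = 0`, with `exp(♮_W(α_t Y)) exp(♮(α_t X)) x = exp(♮(α_t Z)) x`. Theorem 1 is
the case `S = id`. Theorem 2 is the case `X = 0`, with `V` the minimal basis and `W` the other one.

Generation gives smooth structure functions `A` with `[♮ X, ♮ C] = ♮ (A(X, C))`. Hence the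
differential of `X ↦ exp(♮ X) x` in a direction `B` is the value of `♮ (T B)` at the end point,
where `T` solves a linear equation along the orbit that involves only `A` (`fderiv_flow_eq`). Since
`T = 1` at `X = 0`, `T` is invertible nearby, and `T⁻¹ S Y` is a vector field on `V` that lifts `♮_W
Y` through the evaluation map. Its flow is `Z` (`IsFieldSystem.exists_isLocalLift`). The fields are
never divided by, so it does no harm that `♮(α_t X)` vanishes at `t = 0`. All that matters is that
the rescaled data `α_t⁻¹ A(α_t ·, α_t ·)` and `α_t⁻¹ S α_t` are polynomial in `t`, which holds
because `A` and `S` respect the filtration (`dil_rescale`, `dil_rescale₂`). So `t` becomes one more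
coordinate, and it may even be negative (`IsLiftData.exists_local`).

At `t = 0` only the graded parts of `A` and `S` remain. For a graded Lie basis the lifting equation
becomes that of multiplication in a nilpotent group. Its solution is compared with Dynkin's series
by differentiating both along `(sY, sX)` in a faithful matrix model (`IsFaithfulRep.lift_eq_bch`).
In the comparison of two bases, the limit is the graded part of `S`. It intertwines the maps to the
osculating space, and at `p` minimality makes it onto (`IsMinimalAt.surjective_rescale_zero`).
Surjectivity at the origin spreads to a neighbourhood and gives a submersion.

Globally, the lifted field is defined through flows on the manifold rather than through charts, and
its integral curves are unique. Local solutions therefore agree on overlaps and are equivariant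
under dilations. They glue over an open invariant set (`exists_isSubmersionOn`), which contains a
whole fibre over `(x, 0)` as soon as it contains the origin of that fibre. -/

open scoped Manifold ContDiff Topology

noncomputable section

namespace FilteredFol

/-! ### Smoothness of composition operators on spaces of curves -/

section Nemytskii

variable {K : Type*} [TopologicalSpace K] [CompactSpace K]

/-- Pointwise application of a family of operators to a curve, as a bilinear map. -/
def pointwiseApply (K : Type*) [TopologicalSpace K] [CompactSpace K]
    (D R : Type*) [NormedAddCommGroup D] [NormedSpace ℝ D]
    [NormedAddCommGroup R] [NormedSpace ℝ R] :
    C(K, D →L[ℝ] R) →L[ℝ] C(K, D) →L[ℝ] C(K, R) :=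
  LinearMap.mkContinuous₂
    (LinearMap.mk₂ ℝ (fun (A : C(K, D →L[ℝ] R)) (h : C(K, D)) =>
      (⟨fun k => A k (h k), by fun_prop⟩ : C(K, R)))
      (by intros; ext; simp) (by intros; ext; simp) (by intros; ext; simp) (by intros; ext; simp))
    1 (by
      intro A h
      refine (ContinuousMap.norm_le _ (by positivity)).2 fun k => ?_
      rw [one_mul]
      refine ((A k).le_opNorm (h k)).trans ?_
      exact mul_le_mul (A.norm_coe_le_norm k) (h.norm_coe_le_norm k) (norm_nonneg (h k))
        (norm_nonneg A))

@[simp] lemma pointwiseApply_apply {D R : Type*} [NormedAddCommGroup D] [NormedSpace ℝ D]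
    [NormedAddCommGroup R] [NormedSpace ℝ R] (A : C(K, D →L[ℝ] R)) (h : C(K, D)) (k : K) :
    pointwiseApply K D R A h k = A k (h k) := rfl

/-- The mean value inequality on the segment from `γ k` to `γ k + h k` bounds the remainder by the
variation of `F'` there. This variation is small uniformly in `k`, since composition with `F'` is
continuous in the supremum norm on the compact space `K`. -/
lemma hasFDerivAt_comp_left {D R : Type*} [NormedAddCommGroup D] [NormedSpace ℝ D]
    [NormedAddCommGroup R] [NormedSpace ℝ R] (F : C(D, R)) (F' : C(D, D →L[ℝ] R))
    (hF : ∀ x, HasFDerivAt F (F' x) x) (γ : C(K, D)) :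
    HasFDerivAt (fun γ : C(K, D) => F.comp γ) (pointwiseApply K D R (F'.comp γ)) γ := by
  rw [hasFDerivAt_iff_isLittleO_nhds_zero, Asymptotics.isLittleO_iff]
  intro ε hε
  have hcont : Continuous fun γ : C(K, D) => F'.comp γ := ContinuousMap.continuous_postcomp F'
  obtain ⟨δ, hδ, hball⟩ :=
    (Metric.continuous_iff (f := fun γ : C(K, D) => F'.comp γ)).1 hcont γ ε hε
  filter_upwards [Metric.ball_mem_nhds (0 : C(K, D)) hδ] with h hh
  have hh' : ‖h‖ < δ := by simpa using hh
  refine (ContinuousMap.norm_le _ (by positivity)).2 fun k => ?_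
  have key : ‖F (γ k + h k) - F (γ k) - F' (γ k) (γ k + h k - γ k)‖
      ≤ ε * ‖γ k + h k - γ k‖ := by
    refine (convex_segment (γ k) (γ k + h k)).norm_image_sub_le_of_norm_hasFDerivWithin_le'
      (f := F) (f' := F') (fun x _ => (hF x).hasFDerivWithinAt) ?_
      (left_mem_segment ℝ _ _) (right_mem_segment ℝ _ _)
    intro x hx
    rw [segment_eq_image'] at hx
    obtain ⟨θ, ⟨h0, h1⟩, rfl⟩ := hx
    have hd : dist (γ + θ • h) γ < δ := by
      rw [dist_eq_norm, add_sub_cancel_left, norm_smul, Real.norm_of_nonneg h0]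
      exact (mul_le_of_le_one_left (norm_nonneg _) h1).trans_lt hh'
    have := (ContinuousMap.dist_apply_le_dist k).trans (hball _ hd).le
    simpa [dist_eq_norm] using this
  have : ‖h k‖ ≤ ‖h‖ := h.norm_coe_le_norm k
  simp only [add_sub_cancel_left] at key
  exact key.trans (by gcongr)

-- Induction on the order: the derivative is composition with `F'`, followed by a continuous linear
-- map. The target changes from `R` to `D →L[ℝ] R` at each stage, so it is quantified inside the
-- induction and kept in the universe of `D`.
universe u in
lemma contDiff_comp_left_nat {D : Type u} [NormedAddCommGroup D] [NormedSpace ℝ D] (n : ℕ) :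
    ∀ {R : Type u} [NormedAddCommGroup R] [NormedSpace ℝ R] (F : C(D, R)), ContDiff ℝ n F →
      ContDiff ℝ n fun γ : C(K, D) => F.comp γ := by
  induction n with
  | zero =>
    intro R _ _ F hF
    exact contDiff_zero.2 (ContinuousMap.continuous_postcomp F)
  | succ n ih =>
    intro R _ _ F hF
    have h1 := (contDiff_succ_iff_fderiv (n := (n : WithTop ℕ∞)) (f := F)).1 hF
    let F' : C(D, D →L[ℝ] R) := ⟨fderiv ℝ F, h1.2.2.continuous⟩
    have : ContDiff ℝ ((n : WithTop ℕ∞) + 1) fun γ : C(K, D) => F.comp γ := by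
      have hd := fun γ : C(K, D) => hasFDerivAt_comp_left F F' (fun x => (h1.1 x).hasFDerivAt) γ
      rw [contDiff_succ_iff_fderiv]
      refine ⟨fun γ => (hd γ).differentiableAt, by simp, ?_⟩
      rw [show fderiv ℝ (fun γ : C(K, D) => F.comp γ) =
        fun γ => pointwiseApply K D R (F'.comp γ) from funext fun γ => (hd γ).fderiv]
      exact (pointwiseApply K D R).contDiff.comp (ih F' h1.2.2)
    exact this

lemma contDiff_comp_left {D : Type*} [NormedAddCommGroup D] [NormedSpace ℝ D] (F : C(D, D))
    (hF : ContDiff ℝ ∞ F) : ContDiff ℝ ∞ fun γ : C(K, D) => F.comp γ :=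
  contDiff_infty.2 fun n => contDiff_comp_left_nat n F (contDiff_infty.1 hF n)

end Nemytskii

/-! ### Integration of curves on the unit interval -/

section Primitive

open Set intervalIntegral

/-- The extension of a curve on `[0, 1]` to `ℝ` that is constant outside `[0, 1]`. -/
def extendCurve {D : Type*} [TopologicalSpace D] (γ : C(Icc (0 : ℝ) 1, D)) : ℝ → D :=
  IccExtend zero_le_one γ

lemma extendCurve_of_mem {D : Type*} [TopologicalSpace D] (γ : C(Icc (0 : ℝ) 1, D)) {s : ℝ}
    (hs : s ∈ Icc (0 : ℝ) 1) : extendCurve γ s = γ ⟨s, hs⟩ := IccExtend_of_mem _ _ hs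

lemma continuous_extendCurve {D : Type*} [TopologicalSpace D] (γ : C(Icc (0 : ℝ) 1, D)) :
    Continuous (extendCurve γ) :=
  γ.continuous.Icc_extend'

variable {D : Type*} [NormedAddCommGroup D] [NormedSpace ℝ D]

/-- The primitive of a curve that vanishes at `0`. -/
def primitive (D : Type*) [NormedAddCommGroup D] [NormedSpace ℝ D] :
    C(Icc (0 : ℝ) 1, D) →L[ℝ] C(Icc (0 : ℝ) 1, D) :=
  LinearMap.mkContinuous
    { toFun := fun γ => ⟨fun s => ∫ r in (0 : ℝ)..s, extendCurve γ r,
        (continuous_primitive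
          (fun _ _ => (continuous_extendCurve γ).intervalIntegrable _ _) 0).comp
          continuous_subtype_val⟩
      map_add' := fun γ η => by
        ext s
        exact integral_add ((continuous_extendCurve γ).intervalIntegrable _ _)
          ((continuous_extendCurve η).intervalIntegrable _ _)
      map_smul' := fun c γ => by
        ext s
        exact integral_smul c _ } 1 (by
      intro γ
      refine (ContinuousMap.norm_le _ (by positivity)).2 fun s => ?_
      refine (norm_integral_le_of_norm_le_const (C := ‖γ‖) fun r _ => ?_).trans ?_
      · exact γ.norm_coe_le_norm _
      · rw [sub_zero, abs_of_nonneg s.2.1, one_mul]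
        exact mul_le_of_le_one_right (norm_nonneg γ) s.2.2)

lemma primitive_apply (γ : C(Icc (0 : ℝ) 1, D)) (s : Icc (0 : ℝ) 1) :
    primitive D γ s = ∫ r in (0 : ℝ)..s, extendCurve γ r := rfl

lemma hasDerivWithinAt_primitive [CompleteSpace D] (γ : C(Icc (0 : ℝ) 1, D)) (s : Icc (0 : ℝ) 1) :
    HasDerivWithinAt (extendCurve (primitive D γ)) (γ s) (Icc 0 1) s := by
  have h : HasDerivAt (fun s : ℝ => ∫ r in (0 : ℝ)..s, extendCurve γ r) (extendCurve γ s) s :=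
    integral_hasDerivAt_right ((continuous_extendCurve γ).intervalIntegrable _ _)
      ((continuous_extendCurve γ).stronglyMeasurableAtFilter _ _)
      (continuous_extendCurve γ).continuousAt
  rw [extendCurve_of_mem _ s.2] at h
  refine h.hasDerivWithinAt.congr (fun r hr => ?_) ?_
  · rw [extendCurve_of_mem _ hr, primitive_apply]
  · rw [extendCurve_of_mem _ s.2, primitive_apply]

end Primitive

/-! ### Uniqueness for differential equations on the unit interval -/

section Uniqueness

open Set

variable {V : Type*} [NormedAddCommGroup V] [NormedSpace ℝ V]

lemma HasDerivWithinAt.Ici_of_Icc {f : ℝ → V} {f' : V} {s b : ℝ} (hs : s ∈ Ico 0 b)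
    (h : HasDerivWithinAt f f' (Icc 0 b) s) : HasDerivWithinAt f f' (Ici s) s :=
  h.mono_of_mem_nhdsWithin
    (Filter.mem_of_superset (Icc_mem_nhdsGE hs.2) fun _ hx => ⟨hs.1.trans hx.1, hx.2⟩)

lemma hasDerivWithinAt_fst {W : Type*} [NormedAddCommGroup W] [NormedSpace ℝ W] {f : ℝ → V × W}
    {f' : V × W} {t : Set ℝ} {s : ℝ} (h : HasDerivWithinAt f f' t s) :
    HasDerivWithinAt (fun s => (f s).1) f'.1 t s :=
  (ContinuousLinearMap.fst ℝ V W).hasFDerivAt.comp_hasDerivWithinAt s h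

lemma hasDerivWithinAt_snd {W : Type*} [NormedAddCommGroup W] [NormedSpace ℝ W] {f : ℝ → V × W}
    {f' : V × W} {t : Set ℝ} {s : ℝ} (h : HasDerivWithinAt f f' t s) :
    HasDerivWithinAt (fun s => (f s).2) f'.2 t s :=
  (ContinuousLinearMap.snd ℝ V W).hasFDerivAt.comp_hasDerivWithinAt s h

/-- Two solutions of an autonomous differential equation with the same initial value agree. -/
theorem eqOn_of_autonomous_ode {f : V → V} {γ η : ℝ → V}
    (hγ : ∀ s ∈ Icc (0 : ℝ) 1, HasDerivWithinAt γ (f (γ s)) (Icc 0 1) s)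
    (hη : ∀ s ∈ Icc (0 : ℝ) 1, HasDerivWithinAt η (f (η s)) (Icc 0 1) s)
    (hf : ∀ s ∈ Icc (0 : ℝ) 1, ContDiffAt ℝ 1 f (γ s)) (h0 : γ 0 = η 0) :
    EqOn γ η (Icc 0 1) := by
  have hγc : ContinuousOn γ (Icc 0 1) := fun s hs => (hγ s hs).continuousWithinAt
  have hηc : ContinuousOn η (Icc 0 1) := fun s hs => (hη s hs).continuousWithinAt
  have hcl : IsClosed ({s | γ s = η s} ∩ Icc 0 1) := by
    have : {s | γ s = η s} ∩ Icc 0 1 = Icc 0 1 ∩ (fun s => γ s - η s) ⁻¹' {0} := by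
      ext s; simp [sub_eq_zero, and_comm]
    rw [this]
    exact (hγc.sub hηc).preimage_isClosed_of_isClosed isClosed_Icc isClosed_singleton
  -- The set of agreement is closed. By connectedness it remains to prolong agreement a little to
  -- the right of each of its points, where `f` is Lipschitz.
  refine hcl.Icc_subset_of_forall_mem_nhdsWithin h0 ?_
  rintro x ⟨hx, hx01⟩
  have hxI : x ∈ Icc (0 : ℝ) 1 := ⟨hx01.1, hx01.2.le⟩
  obtain ⟨K, t, ht, hK⟩ := (hf x hxI).exists_lipschitzOnWith
  have hsub : Icc x 1 ⊆ Icc 0 1 := fun y hy => ⟨hx01.1.trans hy.1, hy.2⟩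
  have hIci : 𝓝[≥] x = 𝓝[Icc x 1] x := (nhdsWithin_Icc_eq_nhdsGE hx01.2).symm
  have e1 : ∀ᶠ s in 𝓝[≥] x, γ s ∈ t := by
    rw [hIci]; exact ((hγc x hxI).mono hsub).eventually ht
  have e2 : ∀ᶠ s in 𝓝[≥] x, η s ∈ t := by
    rw [hIci]; exact ((hηc x hxI).mono hsub).eventually (by rw [← hx.out]; exact ht)
  have e3 : ∀ᶠ s in 𝓝[≥] x, s ∈ Icc x 1 := Icc_mem_nhdsGE hx01.2
  obtain ⟨u, hu, hut⟩ := mem_nhdsGE_iff_exists_Icc_subset.1 (e1.and (e2.and e3))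
  have hu' : x < u := hu
  have key : EqOn γ η (Icc x u) := by
    refine ODE_solution_unique_of_mem_Icc_right (v := fun _ => f) (s := fun _ => t) (K := K)
      (fun _ _ => hK) (hγc.mono fun y hy => hsub (hut hy).2.2) ?_
      (fun s hs => (hut (Ico_subset_Icc_self hs)).1)
      (hηc.mono fun y hy => hsub (hut hy).2.2) ?_
      (fun s hs => (hut (Ico_subset_Icc_self hs)).2.1) hx
    · intro s hs
      exact HasDerivWithinAt.Ici_of_Icc
        ⟨hx01.1.trans hs.1, hs.2.trans_le (hut (right_mem_Icc.2 hu'.le)).2.2.2⟩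
        (hγ s (hsub (hut (Ico_subset_Icc_self hs)).2.2))
    · intro s hs
      exact HasDerivWithinAt.Ici_of_Icc
        ⟨hx01.1.trans hs.1, hs.2.trans_le (hut (right_mem_Icc.2 hu'.le)).2.2.2⟩
        (hη s (hsub (hut (Ico_subset_Icc_self hs)).2.2))
  exact Filter.mem_of_superset (Ioc_mem_nhdsGT hu') fun s hs => key ⟨hs.1.le, hs.2⟩

/-- Uniqueness for an affine differential equation with bounded coefficients. -/
theorem eqOn_of_linear_ode {K : ℝ → V →L[ℝ] V} {B : ℝ → V} {C : ℝ}
    (hK : ∀ s ∈ Icc (0 : ℝ) 1, ‖K s‖ ≤ C) {γ η : ℝ → V}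
    (hγ : ∀ s ∈ Icc (0 : ℝ) 1, HasDerivWithinAt γ (B s + K s (γ s)) (Icc 0 1) s)
    (hη : ∀ s ∈ Icc (0 : ℝ) 1, HasDerivWithinAt η (B s + K s (η s)) (Icc 0 1) s)
    (h0 : γ 0 = η 0) : EqOn γ η (Icc 0 1) := by
  have hd : ∀ s ∈ Icc (0 : ℝ) 1, HasDerivWithinAt (γ - η) (K s ((γ - η) s)) (Icc 0 1) s := by
    intro s hs
    convert (hγ s hs).sub (hη s hs) using 1
    simp
  intro s hs
  have := eq_zero_of_abs_deriv_le_mul_abs_self_of_eq_zero_right (f := γ - η) (K := C)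
    (fun s hs => (hd s hs).continuousWithinAt)
    (fun s hs => HasDerivWithinAt.Ici_of_Icc hs (hd s (Ico_subset_Icc_self hs)))
    (by simp [h0]) (fun s hs => ((K s).le_opNorm _).trans
      (mul_le_mul_of_nonneg_right (hK s (Ico_subset_Icc_self hs)) (norm_nonneg _))) s hs
  simpa [sub_eq_zero] using this

end Uniqueness

/-! ### Flows depending smoothly on parameters and initial values -/

section Flow

open Set Metric

/-- Multiplication by a bump function. Composition operators act on all curves, so the fields have
to be defined and smooth everywhere. -/
theorem exists_contDiff_eventuallyEq {Q R : Type*} [NormedAddCommGroup Q] [NormedSpace ℝ Q]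
    [FiniteDimensional ℝ Q] [NormedAddCommGroup R] [NormedSpace ℝ R] {F : Q → R} {U : Set Q}
    {q₀ : Q} (hU : IsOpen U) (hq : q₀ ∈ U) (hF : ContDiffOn ℝ ∞ F U) :
    ∃ G : Q → R, ContDiff ℝ ∞ G ∧ G =ᶠ[𝓝 q₀] F := by
  obtain ⟨r, hr, hrU⟩ := nhds_basis_closedBall.mem_iff.1 (hU.mem_nhds hq)
  let f : ContDiffBump q₀ := ⟨r / 2, r, by positivity, by linarith⟩
  refine ⟨fun q => f q • F q, contDiff_iff_contDiffAt.2 fun q => ?_, ?_⟩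
  · by_cases hq : q ∈ tsupport fun q => f q • F q
    swap
    · exact contDiffAt_const.congr_of_eventuallyEq (notMem_tsupport_iff_eventuallyEq.1 hq)
    have hq' : q ∈ closedBall q₀ r := by
      have : tsupport (fun q => f q • F q) ⊆ tsupport f := tsupport_smul_subset_left _ _
      exact f.tsupport_eq ▸ this hq
    exact f.contDiff.contDiffAt.smul (hF.contDiffAt (hU.mem_nhds (hrU hq')))
  · filter_upwards [f.eventuallyEq_one] with q hq
    simp [hq]

/-- The inverse function theorem. The target is shrunk to points where the derivative at the
preimage is invertible, an open condition, so that the inverse is smooth on an open set. -/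
theorem exists_contDiffOn_localInverse {X Y : Type*} [NormedAddCommGroup X] [NormedSpace ℝ X]
    [CompleteSpace X] [NormedAddCommGroup Y] [NormedSpace ℝ Y] {f : X → Y}
    (hf : ContDiff ℝ ∞ f) {a : X} {e : X ≃L[ℝ] Y} (he : HasFDerivAt f (e : X →L[ℝ] Y) a) :
    ∃ g : Y → X, ∃ W : Set Y, IsOpen W ∧ f a ∈ W ∧ ContDiffOn ℝ ∞ g W ∧ g (f a) = a ∧
      ∀ y ∈ W, f (g y) = y := by
  let φ := hf.contDiffAt.toOpenPartialHomeomorph f he (by simp)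
  have hφ : ⇑φ = f := rfl
  have ha : a ∈ φ.source := hf.contDiffAt.mem_toOpenPartialHomeomorph_source he (by simp)
  have hfa : f a ∈ φ.target := hf.contDiffAt.image_mem_toOpenPartialHomeomorph_target he (by simp)
  have hinv : φ.symm (f a) = a := φ.left_inv ha
  let S : Set X := fderiv ℝ f ⁻¹' range ((↑) : (X ≃L[ℝ] Y) → X →L[ℝ] Y)
  have hS : IsOpen S :=
    ContinuousLinearEquiv.isOpen.preimage (hf.continuous_fderiv (by simp))
  refine ⟨φ.symm, φ.target ∩ φ.symm ⁻¹' S, φ.symm.isOpen_inter_preimage hS,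
    ⟨hfa, ?_⟩, ?_, hinv, fun y hy => φ.right_inv hy.1⟩
  · simp only [mem_preimage, hinv, S]
    exact ⟨e, he.fderiv.symm⟩
  · rintro y ⟨hy, e', he'⟩
    refine (φ.contDiffAt_symm (f₀' := e') hy ?_ hf.contDiffAt).contDiffWithinAt
    rw [he']
    exact (hf.differentiable (by simp) _).hasFDerivAt

variable {D : Type*} [NormedAddCommGroup D] [NormedSpace ℝ D] [CompleteSpace D]

/-- Solutions starting at `d` are the curves that `Θ γ = γ - ∫ G ∘ γ` sends to the constant `d`. At
the equilibrium `d₀` the derivative of `Θ` is `1 - J` with `J h s = DG(d₀) ∫₀ˢ h`. By `hsq`, `J² =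
0`, so `1 + J` is its inverse. The inverse function theorem then gives solutions on all of `[0, 1]`,
without shrinking time. -/
theorem exists_smooth_curves {G : D → D} (hG : ContDiff ℝ ∞ G) {d₀ : D} (h0 : G d₀ = 0)
    (hsq : (fderiv ℝ G d₀).comp (fderiv ℝ G d₀) = 0) :
    ∃ Γ : D → C(Icc (0 : ℝ) 1, D), ∃ W : Set D, IsOpen W ∧ d₀ ∈ W ∧ ContDiffOn ℝ ∞ Γ W ∧
      ∀ d ∈ W, extendCurve (Γ d) 0 = d ∧ ∀ s ∈ Icc (0 : ℝ) 1,
        HasDerivWithinAt (extendCurve (Γ d)) (G (extendCurve (Γ d) s)) (Icc 0 1) s := by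
  let I := Icc (0 : ℝ) 1
  let cst : D →L[ℝ] C(I, D) := ContinuousLinearMap.const ℝ I
  let Gc : C(D, D) := ⟨G, hG.continuous⟩
  let G' : C(D, D →L[ℝ] D) := ⟨fderiv ℝ G, hG.continuous_fderiv (by simp)⟩
  let Θ : C(I, D) → C(I, D) := fun γ => γ - primitive D (Gc.comp γ)
  have hΘ : ContDiff ℝ ∞ Θ :=
    contDiff_id.sub ((primitive D).contDiff.comp (contDiff_comp_left Gc hG))
  let J : C(I, D) →L[ℝ] C(I, D) :=
    (primitive D).comp (pointwiseApply I D D (G'.comp (cst d₀)))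
  have hJ : ∀ h s, J h s = fderiv ℝ G d₀ (∫ r in (0 : ℝ)..s, extendCurve h r) := by
    intro h s
    rw [← ContinuousLinearMap.intervalIntegral_comp_comm _
      ((continuous_extendCurve h).intervalIntegrable _ _)]
    rfl
  have hJJ : J.comp J = 0 := by
    ext h s
    have : extendCurve (J h) =
        fun r => fderiv ℝ G d₀ (∫ r in (0 : ℝ)..(projIcc 0 1 zero_le_one r : ℝ),
          extendCurve h r) := funext fun r => hJ h _
    rw [ContinuousLinearMap.comp_apply, hJ, ← ContinuousLinearMap.intervalIntegral_comp_comm _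
      ((continuous_extendCurve _).intervalIntegrable _ _), this]
    simp only [← ContinuousLinearMap.comp_apply, hsq]
    simp
  have hJJ' : ∀ h, J (J h) = 0 := fun h => congrArg (fun A => A h) hJJ
  let e : C(I, D) ≃L[ℝ] C(I, D) := ContinuousLinearEquiv.equivOfInverse
    (ContinuousLinearMap.id ℝ _ - J) (ContinuousLinearMap.id ℝ _ + J)
    (fun h => by simp [hJJ']) (fun h => by simp [hJJ'])
  have he : HasFDerivAt Θ (e : C(I, D) →L[ℝ] C(I, D)) (cst d₀) := by
    refine (hasFDerivAt_id _).sub ?_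
    exact (primitive D).hasFDerivAt.comp _ (hasFDerivAt_comp_left Gc G'
      (fun x => (hG.differentiable (by simp) x).hasFDerivAt) (cst d₀))
  have hΘ0 : Θ (cst d₀) = cst d₀ := by
    have : Gc.comp (cst d₀) = 0 := by ext s; exact h0
    simp [Θ, this]
  obtain ⟨g, W, hW, haW, hg, -, hfg⟩ := exists_contDiffOn_localInverse hΘ he
  refine ⟨fun d => g (cst d), cst ⁻¹' W, hW.preimage cst.continuous, by simpa [hΘ0] using haW,
    hg.comp cst.contDiff.contDiffOn (mapsTo_preimage _ _), fun d hd => ?_⟩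
  have hsol : ∀ s : I, g (cst d) s = d + primitive D (Gc.comp (g (cst d))) s := by
    intro s
    have := congrArg (fun γ : C(I, D) => γ s) (hfg _ hd)
    simp only [Θ, ContinuousMap.sub_apply, sub_eq_iff_eq_add] at this
    exact this
  have hext : ∀ s ∈ I, extendCurve (g (cst d)) s =
      d + extendCurve (primitive D (Gc.comp (g (cst d)))) s := fun s hs => by
    rw [extendCurve_of_mem _ hs, extendCurve_of_mem _ hs, hsol]
  constructor
  · rw [hext 0 (by simp [I]), extendCurve_of_mem _ (by simp), primitive_apply]
    simp
  · intro s hs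
    have := (hasDerivWithinAt_primitive (Gc.comp (g (cst d))) ⟨s, hs⟩).const_add d
    refine HasDerivWithinAt.congr ?_ hext (hext s hs)
    have hval : extendCurve (g (cst d)) s = g (cst d) ⟨s, hs⟩ := extendCurve_of_mem _ hs
    rw [hval]
    exact this

variable {P Q : Type*} [NormedAddCommGroup P] [NormedSpace ℝ P] [FiniteDimensional ℝ P]
  [NormedAddCommGroup Q] [NormedSpace ℝ Q] [FiniteDimensional ℝ Q]

/-- The local flow of the fields `q ↦ F q p`, which depend linearly on a parameter `p`. -/
structure IsLocalFlow (F : Q → P →L[ℝ] Q) (Ψ : P × Q → Q) (q₀ : Q) (U : Set Q) (r : ℝ) :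
    Prop where
  pos : 0 < r
  contDiffOn : ContDiffOn ℝ ∞ Ψ (ball 0 r ×ˢ ball q₀ r)
  zero_left : ∀ q ∈ ball q₀ r, Ψ (0, q) = q
  mem : ∀ p ∈ ball (0 : P) r, ∀ q ∈ ball q₀ r, Ψ (p, q) ∈ U
  hasDerivAt : ∀ q ∈ ball q₀ r, ∀ (p : P) (s : ℝ), s • p ∈ ball (0 : P) r →
    HasDerivAt (fun s : ℝ => Ψ (s • p, q)) (F (Ψ (s • p, q)) p) s

/-- With the parameter as a frozen coordinate the field is `G (p, q) = (0, F q p)`, up to a cutoff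
of `F`. It vanishes at `(0, q₀)`, and its derivative there, `(p, q) ↦ (0, F q₀ p)`, squares to zero,
so `exists_smooth_curves` applies. -/
theorem exists_isLocalFlow {F : Q → P →L[ℝ] Q} {U : Set Q} {q₀ : Q} (hU : IsOpen U)
    (hq : q₀ ∈ U) (hF : ContDiffOn ℝ ∞ F U) :
    ∃ Ψ r, IsLocalFlow F Ψ q₀ U r := by
  have : CompleteSpace (P × Q) := FiniteDimensional.complete ℝ _
  obtain ⟨F', hF', hFF'⟩ := exists_contDiff_eventuallyEq hU hq hF
  let G : P × Q → P × Q := fun d => (0, F' d.2 d.1)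
  have hG : ContDiff ℝ ∞ G := contDiff_const.prodMk ((hF'.comp contDiff_snd).clm_apply contDiff_fst)
  have h0 : G (0, q₀) = 0 := by simp [G]
  have hfd : ∀ h : P × Q, fderiv ℝ G (0, q₀) h = (0, F' q₀ h.1) := by
    intro h
    have h1 : HasFDerivAt (fun d : P × Q => F' d.2)
        ((fderiv ℝ F' q₀).comp (ContinuousLinearMap.snd ℝ P Q)) (0, q₀) :=
      HasFDerivAt.comp (g := F') ((0 : P), q₀) (hF'.differentiable (by simp) q₀).hasFDerivAt
        hasFDerivAt_snd
    have h2 := h1.clm_apply (hasFDerivAt_fst (𝕜 := ℝ) (p := ((0 : P), q₀)))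
    have h3 := (hasFDerivAt_const (0 : P) ((0 : P), q₀)).prodMk h2
    rw [show fderiv ℝ G (0, q₀) = _ from h3.fderiv]
    simp
  obtain ⟨Γ, W, hW, h0W, hΓ, hcur⟩ := exists_smooth_curves hG h0 (by
    ext h <;> simp [hfd])
  have hfst : ∀ d ∈ W, ∀ s ∈ Icc (0 : ℝ) 1, (extendCurve (Γ d) s).1 = d.1 := by
    intro d hd s hs
    have h1 : ∀ s ∈ Icc (0 : ℝ) 1,
        HasDerivWithinAt (fun s => (extendCurve (Γ d) s).1) 0 (Icc 0 1) s := fun s hs =>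
      hasDerivWithinAt_fst ((hcur d hd).2 s hs)
    have := constant_of_has_deriv_right_zero (fun s hs => (h1 s hs).continuousWithinAt)
      (fun s hs => HasDerivWithinAt.Ici_of_Icc hs (h1 s (Ico_subset_Icc_self hs))) s hs
    rw [this, (hcur d hd).1]
  let Ψ : P × Q → Q := fun d => (extendCurve (Γ d) 1).2
  have hval1 : ∀ d, Ψ d = (Γ d ⟨1, by simp⟩).2 := fun d => by
    simp only [Ψ]; rw [extendCurve_of_mem _ (by simp)]
  have hsmooth : ContDiffOn ℝ ∞ Ψ W := by
    have : ContDiff ℝ ∞ fun γ : C(Icc (0 : ℝ) 1, P × Q) => (γ ⟨1, by simp⟩).2 :=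
      contDiff_snd.comp
        (ContinuousMap.evalCLM (M := P × Q) ℝ (⟨1, by simp⟩ : Icc (0 : ℝ) 1)).contDiff
    exact (this.comp_contDiffOn hΓ).congr fun d _ => hval1 d
  -- Linearity in `p`: time `s` with parameter `p` is time one with parameter `s • p`.
  have hscale : ∀ p q, (p, q) ∈ W → ∀ s ∈ Icc (0 : ℝ) 1, (s • p, q) ∈ W →
      Ψ (s • p, q) = (extendCurve (Γ (p, q)) s).2 := by
    intro p q hpq s hs hspq
    have h := eqOn_of_autonomous_ode (f := G) (γ := extendCurve (Γ (s • p, q)))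
      (η := fun r => (s • p, (extendCurve (Γ (p, q)) (s * r)).2)) (hcur _ hspq).2 ?_
      (fun r _ => (hG.of_le (by simp)).contDiffAt) ?_
    · have h1 : extendCurve (Γ (s • p, q)) 1 = (s • p, (extendCurve (Γ (p, q)) (s * 1)).2) :=
        h (by simp)
      rw [mul_one] at h1
      exact (congrArg Prod.snd h1 :)
    · intro r hr
      have hsr : s * r ∈ Icc (0 : ℝ) 1 := ⟨mul_nonneg hs.1 hr.1, mul_le_one₀ hs.2 hr.1 hr.2⟩
      have h1 := hasDerivWithinAt_snd ((hcur _ hpq).2 (s * r) hsr)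
      have h2 : HasDerivWithinAt (fun r : ℝ => s * r) s (Icc 0 1) r := by
        simpa using (hasDerivWithinAt_id r _).const_mul s
      have h3 := HasDerivWithinAt.scomp (t' := Icc (0 : ℝ) 1) r h1 h2
        (fun x hx => ⟨mul_nonneg hs.1 hx.1, mul_le_one₀ hs.2 hx.1 hx.2⟩)
      refine ((hasDerivWithinAt_const r (Icc (0 : ℝ) 1) (s • p)).prodMk h3).congr_deriv ?_
      simp only [G, hfst _ hpq _ hsr, map_smul]
    · simp [(hcur _ hspq).1, (hcur _ hpq).1]
  have hΨ0 : ∀ q, ((0 : P), q) ∈ W → Ψ (0, q) = q := by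
    intro q h
    have := hscale 0 q h 0 (by simp) (by simpa using h)
    simpa [(hcur _ h).1] using this
  have hΨc : ContinuousAt Ψ (0, q₀) := (hsmooth.continuousOn).continuousAt (hW.mem_nhds h0W)
  have hnice : ∀ᶠ q in 𝓝 q₀, q ∈ U ∧ F' q = F q :=
    Filter.Eventually.and (hU.mem_nhds hq) hFF'
  have hev : ∀ᶠ d in 𝓝 ((0 : P), q₀), d ∈ W ∧ Ψ d ∈ U ∧ F' (Ψ d) = F (Ψ d) :=
    Filter.Eventually.and (hW.mem_nhds h0W) (hΨc.eventually (by rwa [hΨ0 q₀ h0W]))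
  obtain ⟨r, hr, hrW⟩ := Metric.eventually_nhds_iff_ball.1 hev
  have hB : ball (0 : P) r ×ˢ ball q₀ r = ball ((0 : P), q₀) r := ball_prod_same _ _ _
  have hrW' : ∀ p ∈ ball (0 : P) r, ∀ q ∈ ball q₀ r,
      (p, q) ∈ W ∧ Ψ (p, q) ∈ U ∧ F' (Ψ (p, q)) = F (Ψ (p, q)) := fun p hp q hq =>
    hrW _ (hB ▸ mk_mem_prod hp hq)
  -- the derivative at points of the unit interval, from the right
  have hder : ∀ q ∈ ball q₀ r, ∀ p ∈ ball (0 : P) r, ∀ s ∈ Icc (0 : ℝ) 1,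
      HasDerivAt (fun s : ℝ => Ψ (s • p, q)) (F (Ψ (s • p, q)) p) s := by
    intro q hq p hp s hs
    have hsp : ∀ s ∈ Icc (0 : ℝ) 1, s • p ∈ ball (0 : P) r := fun s hs =>
      (balanced_ball_zero (𝕜 := ℝ)).smul_mem (by rw [Real.norm_of_nonneg hs.1]; exact hs.2) hp
    have hd : DifferentiableAt ℝ (fun s : ℝ => Ψ (s • p, q)) s := by
      have h1 : DifferentiableAt ℝ Ψ (s • p, q) :=
        (hsmooth.contDiffAt (hW.mem_nhds (hrW' _ (hsp s hs) q hq).1)).differentiableAt (by simp)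
      exact DifferentiableAt.comp (f := fun s : ℝ => (s • p, q)) s h1 (by fun_prop)
    have h2 : HasDerivWithinAt (fun s : ℝ => Ψ (s • p, q)) (F (Ψ (s • p, q)) p) (Icc 0 1) s := by
      have hW1 := (hrW' p hp q hq).1
      have h3 := hasDerivWithinAt_snd ((hcur _ hW1).2 s hs)
      have hE : ∀ s ∈ Icc (0 : ℝ) 1, Ψ (s • p, q) = (extendCurve (Γ (p, q)) s).2 := fun s hs =>
        hscale p q hW1 s hs (hrW' _ (hsp s hs) q hq).1
      refine HasDerivWithinAt.congr ?_ hE (hE s hs)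
      convert h3 using 1
      simp only [G, hfst _ hW1 s hs, ← hE s hs, (hrW' _ (hsp s hs) q hq).2.2]
    have := (uniqueDiffOn_Icc zero_lt_one s hs).eq_deriv _ hd.hasDerivAt.hasDerivWithinAt h2
    rw [← this]
    exact hd.hasDerivAt
  refine ⟨Ψ, r, hr, hsmooth.mono fun d hd => (hrW' _ hd.1 _ hd.2).1,
    fun q hq => hΨ0 q (hrW' 0 (mem_ball_self hr) q hq).1, fun p hp q hq => (hrW' p hp q hq).2.1,
    fun q hq p s hs => ?_⟩
  -- In `hder` the parameter itself lies in the ball, whereas here only `s • p` does. Use `s • p` at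
  -- time 1, or, if `s = 0`, a small multiple `ε • p` at time 0, and change variables.
  rcases eq_or_ne s 0 with rfl | hs0
  · obtain ⟨ε, hε, hεp⟩ : ∃ ε : ℝ, 0 < ε ∧ ε • p ∈ ball (0 : P) r := by
      have h1 : Filter.Tendsto (fun ε : ℝ => ε • p) (𝓝[>] 0) (𝓝 0) := by
        have : ContinuousAt (fun ε : ℝ => ε • p) 0 := by fun_prop
        simpa [ContinuousAt] using this.mono_left nhdsWithin_le_nhds
      exact (((h1.eventually (ball_mem_nhds 0 hr)).and self_mem_nhdsWithin).exists).imp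
        fun ε h => ⟨h.2, h.1⟩
    have h1 := hder q hq _ hεp 0 (by simp)
    have h2 : HasDerivAt (fun s : ℝ => s * ε⁻¹) ε⁻¹ 0 := by
      simpa using (hasDerivAt_id (0 : ℝ)).mul_const ε⁻¹
    have h3 := HasDerivAt.scomp_of_eq (0 : ℝ) h1 h2 (by simp)
    convert h3 using 1
    · ext s; simp [smul_smul, hε.ne']
    · simp [smul_smul, hε.ne']
  · have h1 := hder q hq _ hs 1 (by simp)
    have h2 : HasDerivAt (fun x : ℝ => x * s⁻¹) s⁻¹ s := by
      simpa using (hasDerivAt_id s).mul_const s⁻¹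
    have h3 := HasDerivAt.scomp_of_eq s h1 h2 (by simp [hs0])
    convert h3 using 1
    · ext x; simp [smul_smul, hs0]
    · simp [smul_smul, hs0]

end Flow

/-! ### Differentials of flows and lifts of vector fields -/

section LocalLift

open Set Metric

variable {V E W : Type*} [NormedAddCommGroup V] [NormedSpace ℝ V]
  [NormedAddCommGroup E] [NormedSpace ℝ E] [NormedAddCommGroup W] [NormedSpace ℝ W]

lemma smul_mem_ball_zero {X : V} {r s : ℝ} (hX : X ∈ ball (0 : V) r) (hs : s ∈ Icc (0 : ℝ) 1) :
    s • X ∈ ball (0 : V) r :=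
  (balanced_ball_zero (𝕜 := ℝ)).smul_mem (by rw [Real.norm_of_nonneg hs.1]; exact hs.2) hX

/-- The derivative of the flow `X ↦ exp(v X) e` with respect to `X`. Here `[v X, v C] = v (a X C)`
and `c` solves the transport equation for `a` along the orbit. -/
theorem fderiv_flow_eq {v : E → V →L[ℝ] E} {a : E → V →L[ℝ] V →L[ℝ] V} {U : Set E}
    (hU : IsOpen U) (hv : ContDiffOn ℝ ∞ v U)
    (hbr : ∀ e ∈ U, ∀ X C, fderiv ℝ v e (v e X) C - fderiv ℝ v e (v e C) X = v e (a e X C))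
    {φ : V → E} {r : ℝ} (hφ : ContDiffOn ℝ ∞ φ (ball 0 r)) (hφU : ∀ X ∈ ball (0 : V) r, φ X ∈ U)
    (hode : ∀ (X : V) (s : ℝ), s • X ∈ ball (0 : V) r →
      HasDerivAt (fun s : ℝ => φ (s • X)) (v (φ (s • X)) X) s)
    {X : V} (hX : X ∈ ball (0 : V) r) {c : ℝ → V →L[ℝ] V} (hc0 : c 0 = 0)
    (hc : ∀ s ∈ Icc (0 : ℝ) 1,
      HasDerivWithinAt c (1 - (a (φ (s • X)) X).comp (c s)) (Icc 0 1) s) (B : V) :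
    fderiv ℝ φ X B = v (φ X) (c 1 B) := by
  have hφat : ∀ X ∈ ball (0 : V) r, ContDiffAt ℝ ∞ φ X := fun X hX =>
    hφ.contDiffAt (isOpen_ball.mem_nhds hX)
  have hvat : ∀ X ∈ ball (0 : V) r, ContDiffAt ℝ ∞ v (φ X) := fun X hX =>
    hv.contDiffAt (hU.mem_nhds (hφU X hX))
  have hφd : ∀ X ∈ ball (0 : V) r, HasFDerivAt φ (fderiv ℝ φ X) X := fun X hX =>
    ((hφat X hX).differentiableAt (by simp)).hasFDerivAt
  have hvd : ∀ X ∈ ball (0 : V) r, HasFDerivAt v (fderiv ℝ v (φ X)) (φ X) := fun X hX =>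
    ((hvat X hX).differentiableAt (by simp)).hasFDerivAt
  have hφdd : ∀ X ∈ ball (0 : V) r, HasFDerivAt (fderiv ℝ φ) (fderiv ℝ (fderiv ℝ φ) X) X :=
    fun X hX => (((hφat X hX).fderiv_right (m := 1) (by norm_cast)).differentiableAt
      (by simp)).hasFDerivAt
  -- The derivative of `s ↦ φ (s • X)` at `s = 1`, computed in two ways.
  have heuler : ∀ X ∈ ball (0 : V) r, fderiv ℝ φ X X = v (φ X) X := by
    intro X hX
    have h1 := hode X 1 (by simpa using hX)
    have h2 : HasDerivAt (fun s : ℝ => s • X) X 1 := by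
      simpa using (hasDerivAt_id (1 : ℝ)).smul_const X
    have h3 := HasFDerivAt.comp_hasDerivAt_of_eq (f := fun s : ℝ => s • X) (1 : ℝ) (hφd X hX) h2
      (by simp)
    simpa using h3.unique h1
  -- The derivative of `heuler` in the direction `B`. Symmetry of the second derivative will turn it
  -- into a differential equation along the ray through `X`.
  have hdiff : ∀ X ∈ ball (0 : V) r, fderiv ℝ (fderiv ℝ φ) X B X + fderiv ℝ φ X B =
      fderiv ℝ v (φ X) (fderiv ℝ φ X B) X + v (φ X) B := by
    intro X hX
    have h1 := (hφdd X hX).clm_apply (hasFDerivAt_id X)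
    have h2 := (HasFDerivAt.comp X (hvd X hX) (hφd X hX)).clm_apply (hasFDerivAt_id X)
    have h3 : (fun X => fderiv ℝ φ X X) =ᶠ[𝓝 X] fun X => v (φ X) X := by
      filter_upwards [isOpen_ball.mem_nhds hX] with Y hY using heuler Y hY
    have h4 := (h1.congr_of_eventuallyEq h3.symm).unique h2
    have := congrArg (fun A => A B) h4
    simpa [add_comm] using this
  have hsymm : ∀ X ∈ ball (0 : V) r, ∀ Y, fderiv ℝ (fderiv ℝ φ) X B Y =
      fderiv ℝ (fderiv ℝ φ) X Y B := fun X hX Y =>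
    ((hφat X hX).isSymmSndFDerivAt (by
      rw [minSmoothness_of_isRCLikeNormedField]; norm_cast)).eq B Y
  let K : ℝ → E →L[ℝ] E := fun s => (fderiv ℝ v (φ (s • X))).flip X
  have hsX := fun s (hs : s ∈ Icc (0 : ℝ) 1) => smul_mem_ball_zero hX hs
  have hKc : ContinuousOn K (Icc 0 1) := by
    intro s hs
    have h1 : ContinuousAt (fderiv ℝ v) (φ (s • X)) :=
      ((hvat _ (hsX s hs)).fderiv_right (m := 0) (by simp)).continuousAt
    have h2 : ContinuousAt (fun s : ℝ => φ (s • X)) s := (hode X s (hsX s hs)).continuousAt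
    have h3 : ContinuousAt (fun s : ℝ => fderiv ℝ v (φ (s • X))) s :=
      ContinuousAt.comp (f := fun s : ℝ => φ (s • X)) h1 h2
    have h4 : Continuous fun A : E →L[ℝ] V →L[ℝ] E => A.flip X :=
      (ContinuousLinearMap.apply ℝ (E →L[ℝ] E) X).continuous.comp
        (ContinuousLinearMap.flipₗᵢ ℝ E V E).continuous
    exact (h4.continuousAt.comp h3).continuousWithinAt
  obtain ⟨C, hC⟩ := isCompact_Icc.exists_bound_of_continuousOn hKc
  -- Both curves start at 0 and solve `y' = v(φ(sX)) B + K(s) y`. For `s Dφ(sX) B` this is `hdiff`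
  -- with symmetry; for `v(φ(sX)) (c(s) B)` it is the bracket relation together with the equation
  -- for `c`.
  have hsol := eqOn_of_linear_ode (K := K) (B := fun s => v (φ (s • X)) B) hC
    (γ := fun s => s • fderiv ℝ φ (s • X) B) (η := fun s => v (φ (s • X)) (c s B)) ?_ ?_
    (by simp [hc0])
  · simpa using hsol (x := 1) (by simp)
  · intro s hs
    have h1 : HasDerivAt (fun s : ℝ => s • X) X s := by
      simpa using (hasDerivAt_id s).smul_const X
    have h2 := HasFDerivAt.comp_hasDerivAt (f := fun s : ℝ => s • X) s (hφdd _ (hsX s hs)) h1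
    have h3 := (hasDerivAt_id s).smul (h2.clm_apply (hasDerivAt_const s B))
    refine h3.hasDerivWithinAt.congr_deriv ?_
    have h4 := hdiff _ (hsX s hs)
    rw [hsymm _ (hsX s hs)] at h4
    simp only [map_smul, smul_apply] at h4
    simp only [K, ContinuousLinearMap.flip_apply, id, map_smul,
      Function.comp_apply, map_zero, add_zero, one_smul]
    rw [add_comm, add_comm (v _ B), ← h4]
    abel
  · intro s hs
    have h1 := HasFDerivAt.comp_hasDerivAt (f := fun s : ℝ => φ (s • X)) s (hvd _ (hsX s hs))
      (hode X s (hsX s hs))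
    have h2 := h1.hasDerivWithinAt (s := Icc 0 1)
    have h3 := (hc s hs).clm_apply (hasDerivWithinAt_const s (Icc (0 : ℝ) 1) B)
    refine (h2.clm_apply h3).congr_deriv ?_
    have h4 := hbr _ (hφU _ (hsX s hs)) X (c s B)
    simp only [K, ContinuousLinearMap.flip_apply, Function.comp_apply, map_zero, add_zero,
      sub_apply, one_apply_eq_self,
      ContinuousLinearMap.comp_apply, map_sub]
    rw [← h4]
    abel

/-- `τ` is the value at `1` of the solution of `c' = 1 - k c`, `c 0 = 0`. -/
def IsTransport (k : ℝ → V →L[ℝ] V) (τ : V →L[ℝ] V) : Prop :=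
  (∃ C, ∀ s ∈ Icc (0 : ℝ) 1, ‖k s‖ ≤ C) ∧ ∃ c : ℝ → V →L[ℝ] V, c 0 = 0 ∧ c 1 = τ ∧
    ∀ s ∈ Icc (0 : ℝ) 1, HasDerivWithinAt c (1 - (k s).comp (c s)) (Icc 0 1) s

namespace IsTransport

variable {k k' : ℝ → V →L[ℝ] V} {τ τ' : V →L[ℝ] V}

lemma congr (h : IsTransport k τ) (hk : EqOn k k' (Icc 0 1)) : IsTransport k' τ := by
  obtain ⟨⟨C, hC⟩, c, h0, h1, hc⟩ := h
  exact ⟨⟨C, fun s hs => hk hs ▸ hC s hs⟩, c, h0, h1, fun s hs => hk hs ▸ hc s hs⟩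

/-- The equation acts on each vector separately, so `τ B` can be read off from any solution for the
vector `B` alone. -/
lemma apply_unique {c : ℝ → V} {B : V} (h : IsTransport k τ) (h0 : c 0 = 0)
    (hc : ∀ s ∈ Icc (0 : ℝ) 1, HasDerivWithinAt c (B - k s (c s)) (Icc 0 1) s) :
    τ B = c 1 := by
  obtain ⟨⟨C, hC⟩, c', h0', rfl, hc'⟩ := h
  refine eqOn_of_linear_ode (K := fun s => -k s) (B := fun _ => B) (C := C)
    (fun s hs => by simpa using hC s hs) (γ := fun s => c' s B) (η := c) ?_ ?_ (by simp [h0, h0'])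
    (right_mem_Icc.2 zero_le_one)
  · intro s hs
    refine ((hc' s hs).clm_apply (hasDerivWithinAt_const s _ B)).congr_deriv ?_
    simp [sub_eq_add_neg]
  · intro s hs
    refine (hc s hs).congr_deriv ?_
    simp [sub_eq_add_neg]

lemma unique (h : IsTransport k τ) (h' : IsTransport k τ') : τ = τ' := by
  ext B
  obtain ⟨-, c, h0, rfl, hc⟩ := h'
  refine h.apply_unique (c := fun s => c s B) (by simp [h0]) fun s hs => ?_
  refine ((hc s hs).clm_apply (hasDerivWithinAt_const s _ B)).congr_deriv ?_
  simp

/-- The solution is the line `s • B`. Since the structure functions are alternating, this applies in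
particular to the direction of the orbit itself. -/
lemma apply_self (h : IsTransport k τ) {B : V} (hB : ∀ s ∈ Icc (0 : ℝ) 1, k s B = 0) :
    τ B = B := by
  refine (h.apply_unique (c := fun s => s • B) (by simp) fun s hs => ?_).trans (by simp)
  refine ((hasDerivWithinAt_id s _).smul_const B).congr_deriv ?_
  simp [hB s hs]

/-- The whole equation can be conjugated. With `δ` a dilation this becomes the equivariance of the
transport. -/
lemma conj (h : IsTransport k τ) (δ : V ≃L[ℝ] V) :
    IsTransport (fun s => (δ : V →L[ℝ] V).comp ((k s).comp (δ.symm : V →L[ℝ] V)))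
      ((δ : V →L[ℝ] V).comp (τ.comp (δ.symm : V →L[ℝ] V))) := by
  obtain ⟨⟨C, hC⟩, c, h0, rfl, hc⟩ := h
  refine ⟨⟨‖(δ : V →L[ℝ] V)‖ * (C * ‖(δ.symm : V →L[ℝ] V)‖), fun s hs => ?_⟩,
    fun s => (δ : V →L[ℝ] V).comp ((c s).comp (δ.symm : V →L[ℝ] V)), by simp [h0], rfl, ?_⟩
  · refine (ContinuousLinearMap.opNorm_comp_le _ _).trans ?_
    gcongr
    refine (ContinuousLinearMap.opNorm_comp_le _ _).trans ?_
    gcongr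
    exact hC s hs
  · intro s hs
    have h1 := (hasDerivWithinAt_const s (Icc (0 : ℝ) 1) (δ : V →L[ℝ] V)).clm_comp
      ((hc s hs).clm_comp (hasDerivWithinAt_const s (Icc (0 : ℝ) 1) (δ.symm : V →L[ℝ] V)))
    refine h1.congr_deriv ?_
    ext B
    simp

end IsTransport

/-- Fields `e ↦ v e X` on `U` depending linearly on `X : V`, closed under brackets with structure
functions `a`, and fields `e ↦ v e (S e Y)` depending linearly on `Y : W`. -/
structure IsFieldSystem (v : E → V →L[ℝ] E) (a : E → V →L[ℝ] V →L[ℝ] V) (S : E → W →L[ℝ] V)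
    (U : Set E) : Prop where
  isOpen : IsOpen U
  smooth_v : ContDiffOn ℝ ∞ v U
  smooth_a : ContDiffOn ℝ ∞ a U
  smooth_S : ContDiffOn ℝ ∞ S U
  bracket : ∀ e ∈ U, ∀ X C, fderiv ℝ v e (v e X) C - fderiv ℝ v e (v e C) X = v e (a e X C)
  alt : ∀ e ∈ U, ∀ X, a e X X = 0

/-- `Z (Y, X, e)` solves `exp(v Z) e = exp(v (S Y)) (exp(v X) e)`, where `Φ` is the flow of `v` and
`T` is the left trivialised derivative of `X ↦ Φ (X, e)`. -/
structure IsLocalLift (v : E → V →L[ℝ] E) (a : E → V →L[ℝ] V →L[ℝ] V) (S : E → W →L[ℝ] V)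
    (U : Set E) (e₀ : E) (Φ : V × E → E) (T : V × E → V →L[ℝ] V) (Z : W × V × E → V)
    (r r' : ℝ) : Prop where
  flow : IsLocalFlow v Φ e₀ U r
  smooth_T : ContDiffOn ℝ ∞ T (ball 0 r ×ˢ ball e₀ r)
  isUnit_T : ∀ X ∈ ball (0 : V) r, ∀ e ∈ ball e₀ r, IsUnit (T (X, e))
  transport : ∀ X ∈ ball (0 : V) r, ∀ e ∈ ball e₀ r,
    IsTransport (fun s => a (Φ (s • X, e)) X) (T (X, e))
  fderiv_flow : ∀ X ∈ ball (0 : V) r, ∀ e ∈ ball e₀ r, ∀ B,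
    fderiv ℝ (fun X => Φ (X, e)) X B = v (Φ (X, e)) (T (X, e) B)
  pos : 0 < r'
  le : r' ≤ r
  smooth_Z : ContDiffOn ℝ ∞ Z (ball 0 r' ×ˢ ball 0 r' ×ˢ ball e₀ r')
  mem : ∀ Y ∈ ball (0 : W) r', ∀ X ∈ ball (0 : V) r', ∀ e ∈ ball e₀ r', Z (Y, X, e) ∈ ball 0 r
  zero_left : ∀ X ∈ ball (0 : V) r', ∀ e ∈ ball e₀ r', Z (0, X, e) = X
  hasDerivAt : ∀ X ∈ ball (0 : V) r', ∀ e ∈ ball e₀ r', ∀ (Y : W) (s : ℝ),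
    s • Y ∈ ball (0 : W) r' → HasDerivAt (fun s : ℝ => Z (s • Y, X, e))
      (Ring.inverse (T (Z (s • Y, X, e), e)) (S (Φ (Z (s • Y, X, e), e)) Y)) s

namespace IsLocalLift

variable {v : E → V →L[ℝ] E} {a : E → V →L[ℝ] V →L[ℝ] V} {S : E → W →L[ℝ] V} {U : Set E}
  {e₀ : E} {Φ : V × E → E} {T : V × E → V →L[ℝ] V} {Z : W × V × E → V} {r r' : ℝ}

lemma mul_inverse (h : IsLocalLift v a S U e₀ Φ T Z r r') {X : V} (hX : X ∈ ball (0 : V) r)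
    {e : E} (he : e ∈ ball e₀ r) (B : V) : T (X, e) (Ring.inverse (T (X, e)) B) = B := by
  rw [← mul_apply_eq_comp, Ring.mul_inverse_cancel _ (h.isUnit_T X hX e he)]
  rfl

lemma inverse_mul (h : IsLocalLift v a S U e₀ Φ T Z r r') {X : V} (hX : X ∈ ball (0 : V) r)
    {e : E} (he : e ∈ ball e₀ r) (B : V) : Ring.inverse (T (X, e)) (T (X, e) B) = B := by
  rw [← mul_apply_eq_comp, Ring.inverse_mul_cancel _ (h.isUnit_T X hX e he)]
  rfl

/-- The composition of flows is a flow along a curve of lifts. -/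
lemma hasDerivAt_flow (h : IsLocalLift v a S U e₀ Φ T Z r r') {X : V} (hX : X ∈ ball (0 : V) r')
    {e : E} (he : e ∈ ball e₀ r') {Y : W} {s : ℝ} (hs : s • Y ∈ ball (0 : W) r') :
    HasDerivAt (fun s : ℝ => Φ (Z (s • Y, X, e), e))
      (v (Φ (Z (s • Y, X, e), e)) (S (Φ (Z (s • Y, X, e), e)) Y)) s := by
  have hm := h.mem _ hs X hX e he
  have he' := ball_subset_ball h.le he
  have h1 : DifferentiableAt ℝ (fun X => Φ (X, e)) (Z (s • Y, X, e)) := by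
    have : DifferentiableAt ℝ Φ (Z (s • Y, X, e), e) := (h.flow.contDiffOn.contDiffAt
      ((isOpen_ball.prod isOpen_ball).mem_nhds ⟨hm, he'⟩)).differentiableAt (by simp)
    exact DifferentiableAt.comp (f := fun X : V => (X, e)) _ this (by fun_prop)
  have h2 := HasFDerivAt.comp_hasDerivAt (f := fun s : ℝ => Z (s • Y, X, e)) s h1.hasFDerivAt
    (h.hasDerivAt X hX e he Y s hs)
  refine h2.congr_deriv ?_
  rw [h.fderiv_flow _ hm e he', h.mul_inverse hm he']

lemma contDiffAt_inverse_apply [CompleteSpace V] (h : IsLocalLift v a S U e₀ Φ T Z r r')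
    (hS : IsFieldSystem v a S U) {X : V} (hX : X ∈ ball (0 : V) r) {e : E} (he : e ∈ ball e₀ r)
    (Y : W) :
    ContDiffAt ℝ 1 (fun X => Ring.inverse (T (X, e)) (S (Φ (X, e)) Y)) X := by
  have hnhds : ball (0 : V) r ×ˢ ball e₀ r ∈ 𝓝 (X, e) :=
    (isOpen_ball.prod isOpen_ball).mem_nhds ⟨hX, he⟩
  have hι : ContDiffAt ℝ ∞ (fun X : V => (X, e)) X := by fun_prop
  have h1 : ContDiffAt ℝ ∞ (fun X => T (X, e)) X :=
    (h.smooth_T.contDiffAt hnhds).comp (f := fun X : V => (X, e)) X hι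
  have h2 : ContDiffAt ℝ ∞ (fun X => Φ (X, e)) X :=
    (h.flow.contDiffOn.contDiffAt hnhds).comp (f := fun X : V => (X, e)) X hι
  have h3 : ContDiffAt ℝ ∞ (fun X => S (Φ (X, e))) X :=
    (hS.smooth_S.contDiffAt (hS.isOpen.mem_nhds (h.flow.mem X hX e he))).comp
      (f := fun X => Φ (X, e)) X h2
  obtain ⟨u, hu⟩ := h.isUnit_T X hX e he
  have h4 : ContDiffAt ℝ ∞ Ring.inverse (T (X, e)) := hu ▸ contDiffAt_ringInverse ℝ u
  have h5 : ContDiffAt ℝ ∞ (fun X => Ring.inverse (T (X, e))) X :=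
    h4.comp (f := fun X => T (X, e)) X h1
  exact (h5.clm_apply (h3.clm_apply contDiffAt_const)).of_le (by simp)

/-- If the lift of the field is constant along the flow, the lifted curve is a straight line. -/
lemma eq_of_const [CompleteSpace V] (h : IsLocalLift v a S U e₀ Φ T Z r r')
    (hS : IsFieldSystem v a S U)
    {e : E} (he : e ∈ ball e₀ r') {Y : W} (hY : Y ∈ ball (0 : W) r') {B : V}
    (hB : B ∈ ball (0 : V) r) (hconst : ∀ s ∈ Icc (0 : ℝ) 1, S (Φ (s • B, e)) Y = B) :
    Z (Y, 0, e) = B := by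
  have he' := ball_subset_ball h.le he
  have h0 : (0 : V) ∈ ball (0 : V) r' := mem_ball_self h.pos
  have hTB : ∀ s ∈ Icc (0 : ℝ) 1, T (s • B, e) B = B := by
    intro s hs
    refine (h.transport _ (smul_mem_ball_zero hB hs) e he').apply_self fun x hx => ?_
    have hx' : x • s • B ∈ ball (0 : V) r :=
      smul_mem_ball_zero (smul_mem_ball_zero hB hs) hx
    rw [map_smul, smul_apply, hS.alt _ (h.flow.mem _ hx' e he'), smul_zero]
  have := eqOn_of_autonomous_ode (f := fun X => Ring.inverse (T (X, e)) (S (Φ (X, e)) Y))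
    (γ := fun s => Z (s • Y, 0, e)) (η := fun s : ℝ => s • B)
    (fun s hs => (h.hasDerivAt 0 h0 e he Y s (smul_mem_ball_zero hY hs)).hasDerivWithinAt)
    (fun s hs => ?_) (fun s hs => h.contDiffAt_inverse_apply hS
      (h.mem _ (smul_mem_ball_zero hY hs) 0 h0 e he) he' Y)
    (by simp [h.zero_left 0 h0 e he])
  · simpa using this (x := 1) (by simp)
  · refine ((hasDerivWithinAt_id s _).smul_const B).congr_deriv ?_
    rw [one_smul, hconst s hs]
    have := h.inverse_mul (smul_mem_ball_zero hB hs) he' B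
    rw [hTB s hs] at this
    exact this.symm

end IsLocalLift

variable [FiniteDimensional ℝ V] [FiniteDimensional ℝ E]
  {v : E → V →L[ℝ] E} {a : E → V →L[ℝ] V →L[ℝ] V} {S : E → W →L[ℝ] V} {U : Set E}

/-- `T` is smooth because the orbit and the transport equation together form one flow on `E × End
V`. The flow theorem wants fields linear in the parameter, so the inhomogeneous term `1` receives a
scalar parameter of its own. -/
lemma IsFieldSystem.exists_transport (h : IsFieldSystem v a S U) {e₀ : E} (he₀ : e₀ ∈ U) :
    ∃ Φ T r, IsLocalFlow v Φ e₀ U r ∧ ContDiffOn ℝ ∞ T (ball (0 : V) r ×ˢ ball e₀ r) ∧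
      ∀ X ∈ ball (0 : V) r, ∀ e ∈ ball e₀ r,
        IsTransport (fun s => a (Φ (s • X, e)) X) (T (X, e)) := by
  let F : E × (V →L[ℝ] V) → V × ℝ →L[ℝ] E × (V →L[ℝ] V) := fun q =>
    ((v q.1).comp (.fst ℝ V ℝ)).prod ((ContinuousLinearMap.snd ℝ V ℝ).smulRight 1 -
      ((ContinuousLinearMap.compL ℝ V V V).flip q.2).comp ((a q.1).comp (.fst ℝ V ℝ)))
  have hFapp : ∀ q p, F q p = (v q.1 p.1, p.2 • 1 - (a q.1 p.1).comp q.2) := fun q p => rfl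
  have hF : ContDiffOn ℝ ∞ F (U ×ˢ univ) := by
    have hv : ContDiffOn ℝ ∞ (fun q : E × (V →L[ℝ] V) => v q.1) (U ×ˢ univ) :=
      h.smooth_v.comp contDiffOn_fst fun q hq => hq.1
    have ha : ContDiffOn ℝ ∞ (fun q : E × (V →L[ℝ] V) => a q.1) (U ×ˢ univ) :=
      h.smooth_a.comp contDiffOn_fst fun q hq => hq.1
    refine contDiffOn_clm_apply.2 fun p => ?_
    simp only [hFapp]
    exact (hv.clm_apply contDiffOn_const).prodMk
      (contDiffOn_const.sub ((ha.clm_apply contDiffOn_const).clm_comp contDiffOn_snd))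
  obtain ⟨Ψ, r₂, hΨ⟩ := exists_isLocalFlow (q₀ := (e₀, (0 : V →L[ℝ] V)))
    (h.isOpen.prod isOpen_univ) ⟨he₀, mem_univ _⟩ hF
  obtain ⟨Φ, r₁, hΦ⟩ := exists_isLocalFlow h.isOpen he₀ h.smooth_v
  let r := min r₁ r₂
  have hr : 0 < r := lt_min hΦ.pos hΨ.pos
  -- The scalar parameter has to lie in the ball of radius `r₂`. Starting from `c = 0` with `β • 1`
  -- in place of `1` multiplies the solution by `β`, hence the factor `β⁻¹` below.
  let β := r₂ / 2
  have hβ : 0 < β := half_pos hΨ.pos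
  have hp : ∀ X ∈ ball (0 : V) r, ((X, β) : V × ℝ) ∈ ball (0 : V × ℝ) r₂ := by
    intro X hX
    rw [mem_ball_zero_iff, Prod.norm_def, max_lt_iff]
    refine ⟨mem_ball_zero_iff.1 (ball_subset_ball (min_le_right _ _) hX), ?_⟩
    simp only [Real.norm_of_nonneg hβ.le]
    exact half_lt_self hΨ.pos
  have hq : ∀ e ∈ ball e₀ r, (e, (0 : V →L[ℝ] V)) ∈ ball (e₀, (0 : V →L[ℝ] V)) r₂ := by
    intro e he
    rw [← ball_prod_same]
    exact ⟨ball_subset_ball (min_le_right _ _) he, mem_ball_self hΨ.pos⟩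
  refine ⟨Φ, fun x => β⁻¹ • (Ψ ((x.1, β), (x.2, 0))).2, r,
    ⟨hr, hΦ.contDiffOn.mono (prod_mono (ball_subset_ball (min_le_left _ _))
      (ball_subset_ball (min_le_left _ _))), fun q hq => hΦ.zero_left q
      (ball_subset_ball (min_le_left _ _) hq), fun p hp q hq => hΦ.mem p
      (ball_subset_ball (min_le_left _ _) hp) q (ball_subset_ball (min_le_left _ _) hq),
      fun q hq p s hs => hΦ.hasDerivAt q (ball_subset_ball (min_le_left _ _) hq) p s
      (ball_subset_ball (min_le_left _ _) hs)⟩, ?_, ?_⟩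
  · refine ContDiffOn.const_smul β⁻¹ (contDiff_snd.comp_contDiffOn (hΨ.contDiffOn.comp
      (g := Ψ) (f := fun x : V × E => ((x.1, β), (x.2, (0 : V →L[ℝ] V)))) ?_ ?_))
    · fun_prop
    · exact fun x hx => ⟨hp _ hx.1, hq _ hx.2⟩
  · intro X hX e he
    have hX1 : X ∈ ball (0 : V) r₁ := ball_subset_ball (min_le_left _ _) hX
    have he1 : e ∈ ball e₀ r₁ := ball_subset_ball (min_le_left _ _) he
    have hsX := fun s (hs : s ∈ Icc (0 : ℝ) 1) => smul_mem_ball_zero hX1 hs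
    have hd1 := fun s hs => hΦ.hasDerivAt e he1 X s (hsX s hs)
    have hd2 := fun s (hs : s ∈ Icc (0 : ℝ) 1) =>
      hΨ.hasDerivAt _ (hq e he) _ s (smul_mem_ball_zero (hp X hX) hs)
    have hat := fun s (hs : s ∈ Icc (0 : ℝ) 1) => h.isOpen.mem_nhds (hΦ.mem _ (hsX s hs) e he1)
    have hfst : EqOn (fun s : ℝ => Φ (s • X, e)) (fun s : ℝ => (Ψ (s • (X, β), (e, 0))).1)
        (Icc 0 1) := by
      refine eqOn_of_autonomous_ode (f := fun e => v e X)
        (fun s hs => (hd1 s hs).hasDerivWithinAt)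
        (fun s hs => hasDerivWithinAt_fst (hd2 s hs).hasDerivWithinAt) (fun s hs => ?_) ?_
      · exact ((h.smooth_v.contDiffAt (hat s hs)).clm_apply contDiffAt_const).of_le (by simp)
      · simp only [zero_smul]
        rw [hΦ.zero_left e he1, hΨ.zero_left _ (hq e he)]
    have hc : ContinuousOn (fun s : ℝ => a (Φ (s • X, e)) X) (Icc 0 1) := by
      intro s hs
      have h1 : ContinuousAt (fun s : ℝ => a (Φ (s • X, e))) s :=
        ContinuousAt.comp (g := a) (f := fun s : ℝ => Φ (s • X, e))
          (h.smooth_a.contDiffAt (hat s hs)).continuousAt (hd1 s hs).continuousAt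
      exact (h1.clm_apply continuousAt_const).continuousWithinAt
    refine ⟨isCompact_Icc.exists_bound_of_continuousOn hc,
      fun s => β⁻¹ • (Ψ (s • (X, β), (e, 0))).2, ?_, by simp, fun s hs => ?_⟩
    · simp only [zero_smul]
      rw [hΨ.zero_left _ (hq e he)]
      simp
    · have h1 := (hasDerivWithinAt_snd (hd2 s hs).hasDerivWithinAt (t := Icc 0 1)).const_smul β⁻¹
      refine h1.congr_deriv ?_
      have h2 : Φ (s • X, e) = (Ψ (s • (X, β), (e, 0))).1 := hfst hs
      rw [hFapp, ← h2]
      simp only [smul_sub, smul_smul, inv_mul_cancel₀ hβ.ne', one_smul,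
        ContinuousLinearMap.comp_smul]

theorem IsLocalFlow.mono {P Q : Type*} [NormedAddCommGroup P] [NormedSpace ℝ P]
    [NormedAddCommGroup Q] [NormedSpace ℝ Q] {F : Q → P →L[ℝ] Q} {Ψ : P × Q → Q} {q₀ : Q}
    {U : Set Q} {r s : ℝ} (h : IsLocalFlow F Ψ q₀ U r) (hs : 0 < s) (hsr : s ≤ r) :
    IsLocalFlow F Ψ q₀ U s where
  pos := hs
  contDiffOn := h.contDiffOn.mono (prod_mono (ball_subset_ball hsr) (ball_subset_ball hsr))
  zero_left q hq := h.zero_left q (ball_subset_ball hsr hq)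
  mem p hp q hq := h.mem p (ball_subset_ball hsr hp) q (ball_subset_ball hsr hq)
  hasDerivAt q hq p s hs := h.hasDerivAt q (ball_subset_ball hsr hq) p s (ball_subset_ball hsr hs)

/-- At `X = 0`, `e = e₀` the transport is the identity, so it is invertible nearby. The fields `(T⁻¹
S Y, 0)` on `V × E` are then smooth and linear in `Y`, and `Z` is the `V`-component of their flow.
-/
theorem IsFieldSystem.exists_isLocalLift [FiniteDimensional ℝ W] (h : IsFieldSystem v a S U)
    {e₀ : E} (he₀ : e₀ ∈ U) :
    ∃ Φ T Z r r', IsLocalLift v a S U e₀ Φ T Z r r' := by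
  obtain ⟨Φ, T, r₁, hΦ, hT, htr⟩ := h.exists_transport he₀
  have : CompleteSpace V := FiniteDimensional.complete ℝ V
  have hT0 : T (0, e₀) = 1 := by
    ext B
    exact (htr 0 (mem_ball_self hΦ.pos) e₀ (mem_ball_self hΦ.pos)).apply_self (B := B)
      fun s _ => by simp
  have hTc : ContinuousAt T (0, e₀) := hT.continuousOn.continuousAt
    ((isOpen_ball.prod isOpen_ball).mem_nhds ⟨mem_ball_self hΦ.pos, mem_ball_self hΦ.pos⟩)
  have hunit : ∀ᶠ x in 𝓝 ((0 : V), e₀), IsUnit (T x) :=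
    hTc.eventually (by rw [hT0]; exact Units.nhds 1)
  obtain ⟨r₂, hr₂, hunit⟩ := Metric.eventually_nhds_iff_ball.1 hunit
  rw [← ball_prod_same] at hunit
  let r := min r₁ r₂
  have hr : 0 < r := lt_min hΦ.pos hr₂
  have hrr : r ≤ r₁ := min_le_left _ _
  have hΦ' : IsLocalFlow v Φ e₀ U r := hΦ.mono hr hrr
  have hTs : ContDiffOn ℝ ∞ T (ball 0 r ×ˢ ball e₀ r) :=
    hT.mono (prod_mono (ball_subset_ball hrr) (ball_subset_ball hrr))
  have htr' : ∀ X ∈ ball (0 : V) r, ∀ e ∈ ball e₀ r,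
      IsTransport (fun s => a (Φ (s • X, e)) X) (T (X, e)) := fun X hX e he =>
    htr X (ball_subset_ball hrr hX) e (ball_subset_ball hrr he)
  have hT' : ∀ X ∈ ball (0 : V) r, ∀ e ∈ ball e₀ r, IsUnit (T (X, e)) := fun X hX e he =>
    hunit _ ⟨ball_subset_ball (min_le_right _ _) hX, ball_subset_ball (min_le_right _ _) he⟩
  let F : V × E → W →L[ℝ] V × E := fun q =>
    ((Ring.inverse (T q)).comp (S (Φ q))).prod 0
  have hF : ContDiffOn ℝ ∞ F (ball 0 r ×ˢ ball e₀ r) := by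
    have h1 : ContDiffOn ℝ ∞ (fun q => Ring.inverse (T q)) (ball 0 r ×ˢ ball e₀ r) := by
      intro q hq
      obtain ⟨u, hu⟩ := hT' _ hq.1 _ hq.2
      refine ContDiffAt.comp_contDiffWithinAt (g := Ring.inverse) q ?_ (hTs q hq)
      rw [← hu]
      exact contDiffAt_ringInverse ℝ u
    have h2 : ContDiffOn ℝ ∞ (fun q => S (Φ q)) (ball 0 r ×ˢ ball e₀ r) :=
      h.smooth_S.comp hΦ'.contDiffOn fun q hq => hΦ'.mem _ hq.1 _ hq.2
    exact contDiffOn_clm_apply.2 fun Y =>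
      ((h1.clm_comp h2).clm_apply contDiffOn_const).prodMk contDiffOn_const
  obtain ⟨Ψ, r₃, hΨ⟩ := exists_isLocalFlow (q₀ := ((0 : V), e₀)) (isOpen_ball.prod isOpen_ball)
    ⟨mem_ball_self hr, mem_ball_self hr⟩ hF
  have hr3 : 0 < min r r₃ := lt_min hr hΨ.pos
  have hΨ := hΨ.mono hr3 (min_le_right _ _)
  have hq : ∀ X ∈ ball (0 : V) (min r r₃), ∀ e ∈ ball e₀ (min r r₃),
      (X, e) ∈ ball ((0 : V), e₀) (min r r₃) := fun X hX e he => by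
    rw [← ball_prod_same]; exact ⟨hX, he⟩
  have hsnd : ∀ Y ∈ ball (0 : W) (min r r₃), ∀ X ∈ ball (0 : V) (min r r₃),
      ∀ e ∈ ball e₀ (min r r₃), (Ψ (Y, X, e)).2 = e := by
    intro Y hY X hX e he
    have h1 : ∀ s ∈ Icc (0 : ℝ) 1,
        HasDerivWithinAt (fun s : ℝ => (Ψ (s • Y, X, e)).2) 0 (Icc 0 1) s := fun s hs =>
      hasDerivWithinAt_snd (hΨ.hasDerivAt _ (hq X hX e he) Y s
        (smul_mem_ball_zero hY hs)).hasDerivWithinAt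
    have := constant_of_has_deriv_right_zero (fun s hs => (h1 s hs).continuousWithinAt)
      (fun s hs => HasDerivWithinAt.Ici_of_Icc hs (h1 s (Ico_subset_Icc_self hs))) 1 (by simp)
    simp only [one_smul, zero_smul] at this
    rw [this, hΨ.zero_left _ (hq X hX e he)]
  refine ⟨Φ, T, fun x => (Ψ x).1, r, min r r₃, hΦ', hTs, hT', htr', ?_, hr3, min_le_left _ _, ?_,
    fun Y hY X hX e he => (hΨ.mem Y hY _ (hq X hX e he)).1,
    fun X hX e he => by rw [hΨ.zero_left _ (hq X hX e he)], ?_⟩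
  · intro X hX e he B
    obtain ⟨-, c, h0, h1, hc⟩ := htr' X hX e he
    rw [← h1]
    refine fderiv_flow_eq h.isOpen h.smooth_v h.bracket (φ := fun X => Φ (X, e)) (r := r) ?_
      (fun X hX => hΦ'.mem X hX e he) (fun X s hs => hΦ'.hasDerivAt e he X s hs) hX h0 hc B
    exact hΦ'.contDiffOn.comp (f := fun X : V => (X, e)) (by fun_prop) fun X hX => ⟨hX, he⟩
  · refine contDiff_fst.comp_contDiffOn (hΨ.contDiffOn.mono ?_)
    rintro ⟨Y, X, e⟩ ⟨hY, hX, he⟩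
    exact ⟨hY, hq X hX e he⟩
  · intro X hX e he Y s hs
    have h1 := hΨ.hasDerivAt _ (hq X hX e he) Y s hs
    have h2 := (ContinuousLinearMap.fst ℝ V E).hasFDerivAt.comp_hasDerivAt s h1
    have h3 : Ψ (s • Y, X, e) = ((Ψ (s • Y, X, e)).1, e) :=
      Prod.ext rfl (hsnd _ hs X hX e he)
    refine h2.congr_deriv ?_
    change Ring.inverse (T (Ψ (s • Y, X, e))) (S (Φ (Ψ (s • Y, X, e))) Y) = _
    rw [h3]


end LocalLift

/-! ### Truncated exponential and logarithmic series -/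

section TruncatedSeries

open Polynomial Finset

/-- The exponential series truncated after degree `N`. -/
def truncExp (N : ℕ) : ℝ[X] := ∑ k ∈ range (N + 1), C ((k.factorial : ℝ)⁻¹) * X ^ k

/-- The series `(exp x - 1) / x` truncated before degree `N`. -/
def truncExpDiv (N : ℕ) : ℝ[X] := ∑ k ∈ range N, C (((k + 1).factorial : ℝ)⁻¹) * X ^ k

/-- The series of `log u / (u - 1)` in powers of `u - 1`, truncated before degree `N`. -/
def truncLogDiv {A : Type*} [Ring A] [Algebra ℝ A] (N : ℕ) (u : A) : A :=
  ∑ n ∈ Icc 1 N, ((-1 : ℝ) ^ (n - 1) / n) • (u - 1) ^ (n - 1)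

lemma truncExp_sub_one (N : ℕ) : truncExp N - 1 = X * truncExpDiv N := by
  rw [truncExp, sum_range_succ', truncExpDiv, mul_sum]
  simp only [Nat.factorial_zero, Nat.cast_one, inv_one, map_one, pow_zero, mul_one,
    add_sub_cancel_right]
  exact sum_congr rfl fun k _ => by ring

lemma derivative_truncExp (N : ℕ) :
    derivative (truncExp N) = truncExp N - C ((N.factorial : ℝ)⁻¹) * X ^ N := by
  rw [truncExp, sum_range_succ]
  rw [add_sub_cancel_right, ← sum_range_succ, sum_range_succ', derivative_add, derivative_sum]
  simp only [pow_zero, mul_one, derivative_C, add_zero]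
  refine sum_congr rfl fun k _ => ?_
  rw [derivative_C_mul_X_pow, add_tsub_cancel_right, Nat.factorial_succ]
  congr 2
  have : (k.factorial : ℝ) ≠ 0 := by positivity
  push_cast
  field_simp

lemma X_pow_succ_dvd_of_derivative {p : ℝ[X]} {N : ℕ} (h0 : p.coeff 0 = 0)
    (h : X ^ N ∣ derivative p) : X ^ (N + 1) ∣ p := by
  rw [X_pow_dvd_iff] at h ⊢
  rintro (_ | d) hd
  · exact h0
  · have := h d (by omega)
    rw [coeff_derivative] at this
    exact (mul_eq_zero.1 this).resolve_right (by positivity)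

/-- This is `log (exp x) = x`. The truncated logarithm `l` of `e` has derivative `(∑ (1 - e)^m) e'`.
Here `e' = e` up to a multiple of `X ^ N`, and the geometric sum times `e` is `1 - (1 - e)^N`, with
`X ∣ 1 - e`. So `l' ≡ 1` modulo `X ^ N` and `l ≡ X` modulo `X ^ (N + 1)`. As `l` is `X` times the
product in question, one factor `X` cancels. -/
lemma X_pow_dvd_truncLogDiv_mul (N : ℕ) :
    X ^ N ∣ truncLogDiv N (truncExp N) * truncExpDiv N - 1 := by
  set e := truncExp N with he
  let l : ℝ[X] := ∑ n ∈ Icc 1 N, ((-1 : ℝ) ^ (n - 1) / n) • (e - 1) ^ n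
  have hl : l = X * (truncLogDiv N e * truncExpDiv N) := by
    have : X * (truncLogDiv N e * truncExpDiv N) = truncLogDiv N e * (e - 1) := by
      rw [he, truncExp_sub_one]; ring
    rw [this, truncLogDiv, sum_mul]
    refine sum_congr rfl fun n hn => ?_
    rw [smul_mul_assoc, ← pow_succ, Nat.sub_add_cancel (mem_Icc.1 hn).1]
  have hXe : X ∣ 1 - e := ⟨-truncExpDiv N, by rw [mul_neg, ← truncExp_sub_one]; ring⟩
  have hd : derivative l = (∑ m ∈ range N, (1 - e) ^ m) * derivative e := by
    have h1 : derivative l = ∑ n ∈ Icc 1 N, (1 - e) ^ (n - 1) * derivative e := by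
      rw [derivative_sum]
      refine sum_congr rfl fun n hn => ?_
      have hn' : (n : ℝ) ≠ 0 := by
        have := (mem_Icc.1 hn).1
        positivity
      rw [derivative_smul, derivative_pow, derivative_sub, derivative_one, sub_zero,
        show (1 - e) = -(e - 1) by ring, neg_pow (e - 1), smul_eq_C_mul]
      have h2 : C ((-1 : ℝ) ^ (n - 1) / n) * C (n : ℝ) = (-1) ^ (n - 1) := by
        rw [← C_mul, div_mul_cancel₀ _ hn']
        simp
      rw [← h2]
      ring
    rw [h1, ← sum_mul]
    congr 1
    rw [range_eq_Ico, show Icc 1 N = Ico (0 + 1) (N + 1) from rfl,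
      ← sum_Ico_add' (fun n => (1 - e) ^ (n - 1)) 0 N 1]
    simp
  have hgeom : (∑ m ∈ range N, (1 - e) ^ m) * e = 1 - (1 - e) ^ N := by
    have := geom_sum_mul_neg (1 - e) N
    rwa [sub_sub_cancel] at this
  have hdvd : X ^ (N + 1) ∣ l - X := by
    refine X_pow_succ_dvd_of_derivative ?_ ?_
    · rw [hl]; simp
    · have : derivative (l - X) = -((1 - e) ^ N) -
          (∑ m ∈ range N, (1 - e) ^ m) * C ((N.factorial : ℝ)⁻¹) * X ^ N := by
        rw [derivative_sub, derivative_X, hd, he, derivative_truncExp, ← he, mul_sub, hgeom]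
        ring
      rw [this]
      exact dvd_sub ((pow_dvd_pow_of_dvd hXe N).neg_right) (Dvd.intro_left _ rfl)
  rw [hl, pow_succ', show X * (truncLogDiv N e * truncExpDiv N) - X =
    X * (truncLogDiv N e * truncExpDiv N - 1) by ring] at hdvd
  exact (mul_dvd_mul_iff_left X_ne_zero).1 hdvd

variable {A : Type*} [Ring A] [Algebra ℝ A]

lemma aeval_truncExp (N : ℕ) (a : A) :
    aeval a (truncExp N) = ∑ k ∈ range (N + 1), ((k.factorial : ℝ)⁻¹) • a ^ k := by
  simp [truncExp, Algebra.smul_def]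

lemma aeval_truncExpDiv (N : ℕ) (a : A) :
    aeval a (truncExpDiv N) = ∑ k ∈ range N, (((k + 1).factorial : ℝ)⁻¹) • a ^ k := by
  simp [truncExpDiv, Algebra.smul_def]

lemma truncLogDiv_mul_aeval {N : ℕ} {a : A} (ha : a ^ N = 0) :
    truncLogDiv N (aeval a (truncExp N)) * aeval a (truncExpDiv N) = 1 := by
  obtain ⟨q, hq⟩ := X_pow_dvd_truncLogDiv_mul N
  have := congrArg (aeval a) hq
  rw [map_sub, map_mul, map_mul, map_pow, aeval_X, ha, zero_mul, map_one, sub_eq_zero] at this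
  rw [← this]
  congr 1
  simp [truncLogDiv]

end TruncatedSeries

/-! ### Combinatorics of Dynkin's series -/

section Dynkin

open Finset Polynomial

section Words

variable {L : Type*} {N : ℕ}

/-- The word `X^{r₁} Y^{s₁} ⋯ X^{rₙ} Y^{sₙ}`. -/
def dynkinWord (X Y : L) {n : ℕ} (rs : Fin n → Fin (N + 1) × Fin (N + 1)) : List L :=
  (List.ofFn fun i => List.replicate (rs i).1 X ++ List.replicate (rs i).2 Y).flatten

/-- The length of the word `X^{r₁} Y^{s₁} ⋯ X^{rₙ} Y^{sₙ}`. -/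
def dynkinLength {n : ℕ} (rs : Fin n → Fin (N + 1) × Fin (N + 1)) : ℕ :=
  ∑ i, (((rs i).1 : ℕ) + ((rs i).2 : ℕ))

lemma length_dynkinWord (X Y : L) {n : ℕ} (rs : Fin n → Fin (N + 1) × Fin (N + 1)) :
    (dynkinWord X Y rs).length = dynkinLength rs := by
  simp [dynkinWord, dynkinLength, List.length_flatten, List.sum_ofFn, Function.comp_def]

end Words

variable {L : Type*} [AddCommGroup L] [Module ℝ L] (B : L →ₗ[ℝ] L →ₗ[ℝ] L)

lemma nestedBracket_cons {a : L} {l : List L} (hl : l ≠ []) :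
    nestedBracket B (a :: l) = B a (nestedBracket B l) := by
  obtain ⟨b, l', rfl⟩ := List.exists_cons_of_ne_nil hl
  rfl

lemma nestedBracket_replicate_append (a : L) (r : ℕ) {l : List L} (hl : l ≠ []) :
    nestedBracket B (List.replicate r a ++ l) = ((B a) ^ r) (nestedBracket B l) := by
  induction r with
  | zero => simp
  | succ r ih =>
    rw [List.replicate_succ, List.cons_append, nestedBracket_cons B (by simp [hl]), ih, pow_succ']
    rfl

lemma nestedBracket_map_smul (s : ℝ) (l : List L) :
    nestedBracket B (l.map (s • ·)) = s ^ l.length • nestedBracket B l := by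
  induction l with
  | nil => simp [nestedBracket]
  | cons a l ih =>
    rcases eq_or_ne l [] with rfl | hl
    · simp [nestedBracket]
    · rw [List.map_cons, nestedBracket_cons B (by simpa using hl), ih, nestedBracket_cons B hl]
      simp only [map_smul, LinearMap.smul_apply, smul_smul, List.length_cons]
      rw [pow_succ']
      simp [mul_comm]

variable {N : ℕ}

lemma dynkinWord_smul (s : ℝ) (X Y : L) {n : ℕ} (rs : Fin n → Fin (N + 1) × Fin (N + 1)) :
    dynkinWord (s • X) (s • Y) rs = (dynkinWord X Y rs).map (s • ·) := by
  simp [dynkinWord, List.map_flatten, List.map_ofFn, Function.comp_def]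

/-- The sum over words with `n` blocks in the derivative of Dynkin's series. -/
def dynkinBlockSum (N : ℕ) (X Y : L) (s : ℝ) (n : ℕ) : L :=
  ∑ rs : Fin n → Fin (N + 1) × Fin (N + 1),
    if ∀ i, 1 ≤ ((rs i).1 : ℕ) + ((rs i).2 : ℕ) then
      -- What differentiating `s ^ length / length` leaves. For `n ≥ 1` the nonempty blocks make the
      -- length positive, so the subtraction is not truncated.
      (s ^ (dynkinLength rs - 1) *
        ∏ i, (((rs i).1 : ℕ).factorial * ((rs i).2 : ℕ).factorial : ℝ)⁻¹) •
        nestedBracket B (dynkinWord X Y rs)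
    else 0

lemma sum_fin_prod_exp (X Y : L) (s : ℝ) (u : L) :
    ∑ p : Fin (N + 1) × Fin (N + 1),
      (s ^ ((p.1 : ℕ) + (p.2 : ℕ)) * (((p.1 : ℕ).factorial * (p.2 : ℕ).factorial : ℝ)⁻¹)) •
        ((B X) ^ (p.1 : ℕ)) (((B Y) ^ (p.2 : ℕ)) u) =
      (aeval (s • B X) (truncExp N) * aeval (s • B Y) (truncExp N)) u := by
  simp only [aeval_truncExp]
  rw [Fintype.sum_prod_type, sum_mul_sum]
  simp only [LinearMap.sum_apply, sum_range]
  refine sum_congr rfl fun i _ => sum_congr rfl fun j _ => ?_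
  simp only [_root_.smul_pow, smul_mul_smul_comm, LinearMap.smul_apply, Module.End.mul_apply,
    smul_smul]
  congr 1
  rw [mul_inv, pow_add]
  ring

/-- The first block acts on the rest of the word by powers of `ad X` and `ad Y`. Summing over its
exponents gives `exp (s ad X) exp (s ad Y)`, and excluding the empty block subtracts the identity.
The condition `1 ≤ n` keeps the remaining word nonempty. -/
lemma dynkinBlockSum_succ (X Y : L) (s : ℝ) {n : ℕ} (hn : 1 ≤ n) :
    dynkinBlockSum B N X Y s (n + 1) =
      (aeval (s • B X) (truncExp N) * aeval (s • B Y) (truncExp N) - 1)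
        (dynkinBlockSum B N X Y s n) := by
  have hz : (((0 : Fin (N + 1)) : ℕ)) = 0 := rfl
  rw [LinearMap.sub_apply, Module.End.one_apply, ← sum_fin_prod_exp]
  rw [← Finset.add_sum_erase univ _ (mem_univ ((0 : Fin (N + 1)), (0 : Fin (N + 1))))]
  simp only [hz, add_zero, pow_zero, Nat.factorial_zero, Nat.cast_one, mul_one, inv_one,
    Module.End.one_apply, one_smul, add_sub_cancel_left]
  rw [dynkinBlockSum, ← (Fin.consEquiv fun _ => Fin (N + 1) × Fin (N + 1)).sum_comp,
    Fintype.sum_prod_type]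
  rw [← Finset.add_sum_erase univ _ (mem_univ ((0 : Fin (N + 1)), (0 : Fin (N + 1))))]
  rw [show ∀ a b c : L, a = 0 → b = c → a + b = c by rintro a b c rfl rfl; exact zero_add _]
  · refine sum_eq_zero fun rs _ => if_neg fun h => ?_
    simpa [Fin.consEquiv] using h 0
  · refine sum_congr rfl fun p hp => ?_
    have hp1 : 1 ≤ (p.1 : ℕ) + (p.2 : ℕ) := by
      by_contra h
      refine (mem_erase.1 hp).1 (Prod.ext (Fin.ext ?_) (Fin.ext ?_)) <;> simp <;> omega
    rw [dynkinBlockSum, map_sum, map_sum, smul_sum]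
    refine sum_congr rfl fun rs _ => ?_
    have hiff : (∀ i, 1 ≤ (((Fin.consEquiv fun _ => Fin (N + 1) × Fin (N + 1)) (p, rs) i).1 : ℕ) +
        (((Fin.consEquiv fun _ => Fin (N + 1) × Fin (N + 1)) (p, rs) i).2 : ℕ)) ↔
        ∀ i, 1 ≤ ((rs i).1 : ℕ) + ((rs i).2 : ℕ) := by
      rw [Fin.forall_fin_succ]
      simp [Fin.consEquiv, hp1]
    rw [if_congr hiff rfl rfl]
    split_ifs with h
    swap
    · simp
    have hlen : dynkinLength ((Fin.consEquiv fun _ => Fin (N + 1) × Fin (N + 1)) (p, rs)) =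
        ((p.1 : ℕ) + (p.2 : ℕ)) + dynkinLength rs := by
      simp [dynkinLength, Fin.sum_univ_succ, Fin.consEquiv]
    have hpos : 1 ≤ dynkinLength rs := by
      have := Finset.single_le_sum (f := fun i => ((rs i).1 : ℕ) + ((rs i).2 : ℕ))
        (fun i _ => Nat.zero_le _) (mem_univ (⟨0, hn⟩ : Fin n))
      exact (h ⟨0, hn⟩).trans this
    have hne : dynkinWord X Y rs ≠ [] := by
      intro h0
      have := length_dynkinWord X Y rs
      rw [h0, List.length_nil] at this
      omega
    have hword : dynkinWord X Y ((Fin.consEquiv fun _ => Fin (N + 1) × Fin (N + 1)) (p, rs)) =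
        List.replicate p.1 X ++ (List.replicate p.2 Y ++ dynkinWord X Y rs) := by
      simp [dynkinWord, List.ofFn_succ, Fin.consEquiv]
    rw [hword, nestedBracket_replicate_append B X _ (by simp [hne]),
      nestedBracket_replicate_append B Y _ hne, hlen, map_smul, map_smul, smul_smul]
    congr 1
    rw [Fin.prod_univ_succ, Nat.add_sub_assoc hpos, pow_add]
    simp only [Fin.consEquiv, Equiv.coe_fn_mk, Fin.cons_zero, Fin.cons_succ]
    ring

lemma nestedBracket_replicate_eq_zero (halt : ∀ X, B X X = 0) (a : L) {r : ℕ} (hr : 2 ≤ r) :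
    nestedBracket B (List.replicate r a) = 0 := by
  obtain ⟨k, rfl⟩ := Nat.exists_eq_add_of_le' hr
  rw [show List.replicate (k + 2) a = List.replicate k a ++ [a, a] by
    rw [List.replicate_add]; rfl, nestedBracket_replicate_append B a k (by simp)]
  simp [nestedBracket, halt]

/-- A right-nested bracket whose last two letters agree vanishes, so among the words `X^i Y^j` only
those with `j = 1` and the single letter `X` survive. -/
lemma dynkinBlockSum_one (halt : ∀ X, B X X = 0) (hN : 1 ≤ N) (X Y : L) (s : ℝ) :
    dynkinBlockSum B N X Y s 1 = X + aeval (s • B X) (truncExp N) Y := by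
  let f : ℕ → ℕ → L := fun i j =>
    (if j = 1 then (((i.factorial : ℝ)⁻¹) • (s • B X) ^ i) Y else 0) +
      if i = 1 then (if j = 0 then X else 0) else 0
  have hf : ∑ i ∈ range (N + 1), ∑ j ∈ range (N + 1), f i j =
      X + aeval (s • B X) (truncExp N) Y := by
    simp only [f, sum_add_distrib]
    rw [add_comm, aeval_truncExp, LinearMap.sum_apply]
    congr 1
    · rw [sum_comm]
      simp [show 1 < N + 1 by omega]
    · simp [show 1 < N + 1 by omega]
  rw [← hf, dynkinBlockSum, ← (Equiv.funUnique (Fin 1) (Fin (N + 1) × Fin (N + 1))).symm.sum_comp,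
    Fintype.sum_prod_type, sum_range]
  refine sum_congr rfl fun i _ => ?_
  rw [sum_range]
  refine sum_congr rfl fun j _ => ?_
  simp only [Equiv.funUnique_symm_apply, uniqueElim_const, forall_const, dynkinLength, dynkinWord,
    univ_unique, sum_const, card_singleton, one_smul, prod_const, pow_one, List.ofFn_succ,
    List.ofFn_zero, List.flatten_cons, List.flatten_nil, List.append_nil]
  obtain ⟨i, hi⟩ := i
  obtain ⟨j, hj⟩ := j
  simp only [f]
  rcases j with _ | _ | j
  · rcases i with _ | _ | i
    · simp
    · simp [nestedBracket]
    · rw [if_pos (by omega), List.replicate_zero, List.append_nil,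
        nestedBracket_replicate_eq_zero B halt X (by omega)]
      simp
  · rw [if_pos (by omega), nestedBracket_replicate_append B X i (by simp)]
    simp [nestedBracket, _root_.smul_pow, smul_smul, mul_comm]
  · rw [if_pos (by omega), nestedBracket_replicate_append B X i (by simp),
      nestedBracket_replicate_eq_zero B halt Y (by omega)]
    simp

lemma dynkinBlockSum_eq (halt : ∀ X, B X X = 0) (hN : 1 ≤ N) (X Y : L) (s : ℝ) {n : ℕ}
    (hn : 1 ≤ n) :
    dynkinBlockSum B N X Y s n =
      ((aeval (s • B X) (truncExp N) * aeval (s • B Y) (truncExp N) - 1) ^ (n - 1))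
        (X + aeval (s • B X) (truncExp N) Y) := by
  induction n, hn using Nat.le_induction with
  | base => simp [dynkinBlockSum_one B halt hN]
  | succ n hn ih =>
    rw [dynkinBlockSum_succ B X Y s hn, ih, Nat.add_sub_cancel, ← Module.End.mul_apply,
      ← pow_succ', Nat.sub_add_cancel hn]

/-- Each word is homogeneous in `s` of degree its length. The blocks start with powers of `X`
because `bch` writes its second argument first. -/
lemma bch_smul (X Y : L) (s : ℝ) : bch N B (s • Y) (s • X) =
    ∑ n ∈ Icc 1 N, ((-1 : ℝ) ^ (n - 1) / n) • ∑ rs : Fin n → Fin (N + 1) × Fin (N + 1),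
      if ∀ i, 1 ≤ ((rs i).1 : ℕ) + ((rs i).2 : ℕ) then
        (s ^ dynkinLength rs * ((dynkinLength rs : ℝ)⁻¹ *
          ∏ i, (((rs i).1 : ℕ).factorial * ((rs i).2 : ℕ).factorial : ℝ)⁻¹)) •
          nestedBracket B (dynkinWord X Y rs)
      else 0 := by
  rw [bch]
  refine sum_congr rfl fun n _ => ?_
  rw [sum_filter]
  congr 1
  refine sum_congr rfl fun rs _ => ?_
  split_ifs
  swap
  · rfl
  have h1 : nestedBracket B (dynkinWord (s • X) (s • Y) rs) =
      s ^ dynkinLength rs • nestedBracket B (dynkinWord X Y rs) := by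
    rw [dynkinWord_smul, nestedBracket_map_smul, length_dynkinWord]
  rw [show (List.ofFn fun i => List.replicate (rs i).1 (s • X) ++
    List.replicate (rs i).2 (s • Y)).flatten = dynkinWord (s • X) (s • Y) rs from rfl, h1, smul_smul]
  congr 1
  rw [mul_comm, dynkinLength, one_div, mul_inv, Finset.prod_inv_distrib]
  push_cast
  rfl

end Dynkin

/-! ### A differential equation for Dynkin's series -/

section DynkinDeriv

open Finset Polynomial

variable {L : Type*} [NormedAddCommGroup L] [NormedSpace ℝ L] (B : L →ₗ[ℝ] L →ₗ[ℝ] L) {N : ℕ}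

/-- Differentiation removes the factor `1 / length`. By `dynkinBlockSum_eq` the block sums then add
up to the series of `log E / (E - 1)`, `E = exp (s ad X) exp (s ad Y)`, applied to the one-block
sum. The truncations on both sides match exactly, so nilpotency plays no role. -/
lemma hasDerivAt_bch (halt : ∀ X, B X X = 0) (X Y : L) (s : ℝ) :
    HasDerivAt (fun s : ℝ => bch N B (s • Y) (s • X))
      (truncLogDiv N (aeval (s • B X) (truncExp N) * aeval (s • B Y) (truncExp N))
        (X + aeval (s • B X) (truncExp N) Y)) s := by
  simp only [bch_smul]
  have h : ∀ n ∈ Icc 1 N, HasDerivAt (fun s : ℝ => ∑ rs : Fin n → Fin (N + 1) × Fin (N + 1),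
      if ∀ i, 1 ≤ ((rs i).1 : ℕ) + ((rs i).2 : ℕ) then
        (s ^ dynkinLength rs * ((dynkinLength rs : ℝ)⁻¹ *
          ∏ i, (((rs i).1 : ℕ).factorial * ((rs i).2 : ℕ).factorial : ℝ)⁻¹)) •
          nestedBracket B (dynkinWord X Y rs)
      else 0) (dynkinBlockSum B N X Y s n) s := by
    intro n hn
    have hn1 := (mem_Icc.1 hn).1
    rw [dynkinBlockSum]
    refine HasDerivAt.fun_sum fun rs _ => ?_
    split_ifs with h
    swap
    · exact hasDerivAt_const s 0
    have hpos : (dynkinLength rs : ℝ) ≠ 0 := by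
      have := Finset.single_le_sum (f := fun i => ((rs i).1 : ℕ) + ((rs i).2 : ℕ))
        (fun i _ => Nat.zero_le _) (mem_univ (⟨0, hn1⟩ : Fin n))
      have h2 : 1 ≤ dynkinLength rs := (h ⟨0, hn1⟩).trans this
      positivity
    refine (((hasDerivAt_pow _ s).mul_const _).smul_const _).congr_deriv ?_
    congr 1
    field_simp
  refine (HasDerivAt.fun_sum fun n hn => (h n hn).const_smul _).congr_deriv ?_
  rw [truncLogDiv, LinearMap.sum_apply]
  refine sum_congr rfl fun n hn => ?_
  have := mem_Icc.1 hn
  rw [dynkinBlockSum_eq B halt (this.1.trans this.2) X Y s this.1]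
  rfl

lemma bch_zero_zero : bch N B (0 : L) 0 = 0 := by
  have := bch_smul (N := N) B (0 : L) 0 0
  rw [smul_zero] at this
  rw [this]
  refine sum_eq_zero fun n hn => ?_
  rw [sum_eq_zero, smul_zero]
  intro rs _
  split_ifs with h
  swap
  · rfl
  have hn1 := (mem_Icc.1 hn).1
  have := Finset.single_le_sum (f := fun i => ((rs i).1 : ℕ) + ((rs i).2 : ℕ))
    (fun i _ => Nat.zero_le _) (mem_univ (⟨0, hn1⟩ : Fin n))
  have h2 : 1 ≤ dynkinLength rs := (h ⟨0, hn1⟩).trans this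
  rw [zero_pow (by omega), zero_mul, zero_smul]

end DynkinDeriv

/-! ### The Baker–Campbell–Hausdorff formula for nilpotent brackets -/

section NilpotentBCH

open Polynomial Set Metric

variable {L : Type*} [NormedAddCommGroup L] [NormedSpace ℝ L]

/-- A bilinear map on a finite-dimensional space as a continuous bilinear map. -/
def toCLM₂ {V W R : Type*} [NormedAddCommGroup V] [NormedSpace ℝ V] [FiniteDimensional ℝ V]
    [NormedAddCommGroup W] [NormedSpace ℝ W] [FiniteDimensional ℝ W]
    [NormedAddCommGroup R] [NormedSpace ℝ R]
    (B : V →ₗ[ℝ] W →ₗ[ℝ] R) : V →L[ℝ] W →L[ℝ] R :=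
  LinearMap.toContinuousLinearMap
    ((LinearMap.toContinuousLinearMap : (W →ₗ[ℝ] R) ≃ₗ[ℝ] W →L[ℝ] R).toLinearMap ∘ₗ B)

@[simp] lemma toCLM₂_apply {V W R : Type*} [NormedAddCommGroup V] [NormedSpace ℝ V]
    [FiniteDimensional ℝ V] [NormedAddCommGroup W] [NormedSpace ℝ W] [FiniteDimensional ℝ W]
    [NormedAddCommGroup R] [NormedSpace ℝ R]
    (B : V →ₗ[ℝ] W →ₗ[ℝ] R) (X : V) (Y : W) : toCLM₂ B X Y = B X Y := rfl

/-- A Lie bracket with nilpotent adjoint action and an injective derivation. -/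
structure IsNilpotentBracket (N : ℕ) (B : L →ₗ[ℝ] L →ₗ[ℝ] L) (D : L →ₗ[ℝ] L) : Prop where
  alt : ∀ X, B X X = 0
  jacobi : ∀ X Y Z, B X (B Y Z) + B Y (B Z X) + B Z (B X Y) = 0
  nilpotent : ∀ X, (B X) ^ N = 0
  leibniz : ∀ X Y, D (B X Y) = B (D X) Y + B X (D Y)
  injective : Function.Injective D

/-- The exponential of `s ad X` applied to `u`. -/
def adExp (N : ℕ) (B : L →ₗ[ℝ] L →ₗ[ℝ] L) (X : L) (s : ℝ) (u : L) : L :=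
  aeval (s • B X) (truncExp N) u

variable {N : ℕ} {B : L →ₗ[ℝ] L →ₗ[ℝ] L} {D : L →ₗ[ℝ] L}

lemma adExp_eq (X : L) (s : ℝ) (u : L) : adExp N B X s u =
    ∑ k ∈ Finset.range (N + 1), (s ^ k * ((k.factorial : ℝ)⁻¹)) • ((B X) ^ k) u := by
  rw [adExp, aeval_truncExp, LinearMap.sum_apply]
  refine Finset.sum_congr rfl fun k _ => ?_
  rw [_root_.smul_pow, smul_smul, mul_comm]
  rfl

lemma adExp_zero (X u : L) : adExp N B X 0 u = u := by
  rw [adExp_eq, Finset.sum_range_succ']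
  simp

lemma exp_mul_exp_neg {A : Type*} [NormedRing A] [NormedAlgebra ℝ A] [CompleteSpace A] (x : A) :
    NormedSpace.exp x * NormedSpace.exp (-x) = 1 := by
  have : NormedAlgebra ℚ A := NormedAlgebra.restrictScalars ℚ ℝ A
  rw [← NormedSpace.exp_add_of_commute (Commute.refl x).neg_right, add_neg_cancel,
    NormedSpace.exp_zero]

lemma mul_exp_cancel {A : Type*} [NormedRing A] [NormedAlgebra ℝ A]
    [CompleteSpace A] (x : A) {a b : A} (h : a * NormedSpace.exp x = b * NormedSpace.exp x) :
    a = b := by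
  have := congrArg (· * NormedSpace.exp (-x)) h
  simpa only [mul_assoc, exp_mul_exp_neg, mul_one] using this

lemma exp_mul_cancel {A : Type*} [NormedRing A] [NormedAlgebra ℝ A]
    [CompleteSpace A] (x : A) {a b : A} (h : NormedSpace.exp x * a = NormedSpace.exp x * b) :
    a = b := by
  have := congrArg (NormedSpace.exp (-x) * ·) h
  have h1 := exp_mul_exp_neg (-x)
  rw [neg_neg] at h1
  simpa only [← mul_assoc, h1, one_mul] using this

lemma hasDerivAt_pow_succ_div (k : ℕ) (s : ℝ) :
    HasDerivAt (fun s : ℝ => s ^ (k + 1) * (((k + 1).factorial : ℝ)⁻¹))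
      (s ^ k * ((k.factorial : ℝ)⁻¹)) s := by
  refine ((hasDerivAt_pow (k + 1) s).mul_const _).congr_deriv ?_
  have : (k.factorial : ℝ) ≠ 0 := by positivity
  rw [Nat.factorial_succ, Nat.add_sub_cancel]
  push_cast
  field_simp

namespace IsNilpotentBracket

variable (h : IsNilpotentBracket N B D)
include h

lemma bracket_self_apply (X Y : L) : B X Y = -B Y X := by
  have := h.alt (X + Y)
  simp only [map_add, LinearMap.add_apply, h.alt, zero_add, add_zero] at this
  rw [eq_neg_iff_add_eq_zero, add_comm]
  exact this

lemma adExp_eq' (X : L) (s : ℝ) (u : L) : adExp N B X s u =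
    ∑ k ∈ Finset.range N, (s ^ k * ((k.factorial : ℝ)⁻¹)) • ((B X) ^ k) u := by
  rw [adExp_eq, Finset.sum_range_succ, h.nilpotent]
  simp

lemma hasDerivAt_adExp (X : L) (s : ℝ) (u : L) :
    HasDerivAt (fun s => adExp N B X s u) (B X (adExp N B X s u)) s := by
  rw [h.adExp_eq', map_sum]
  simp only [adExp_eq, Finset.sum_range_succ', pow_zero]
  refine HasDerivAt.add_const _ ?_
  refine (HasDerivAt.fun_sum fun k _ => (hasDerivAt_pow_succ_div k s).smul_const _).congr_deriv ?_
  refine Finset.sum_congr rfl fun k _ => ?_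
  rw [map_smul, pow_succ']
  rfl

end IsNilpotentBracket

variable [FiniteDimensional ℝ L]

/-- The representation on `L × ℝ` obtained by adjoining the derivation `D` to `L`. -/
def extAd (B : L →ₗ[ℝ] L →ₗ[ℝ] L) (D : L →ₗ[ℝ] L) : L →L[ℝ] L × ℝ →L[ℝ] L × ℝ :=
  toCLM₂ (LinearMap.mk₂ ℝ (fun X (p : L × ℝ) => (B X p.1 - p.2 • D X, (0 : ℝ)))
    (by intro X Y p; ext <;> simp; abel)
    (by
      intro c X p
      refine Prod.ext ?_ (smul_zero _).symm
      simp only [Prod.smul_fst, map_smul, LinearMap.smul_apply, smul_sub, smul_comm p.2 c])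
    (by
      intro X p q
      refine Prod.ext ?_ (add_zero _).symm
      simp only [Prod.fst_add, Prod.snd_add, map_add, add_smul]
      abel)
    (by
      intro c X p
      refine Prod.ext ?_ (smul_zero _).symm
      simp only [Prod.smul_fst, Prod.smul_snd, map_smul, smul_sub, smul_eq_mul, mul_smul]))

lemma extAd_apply (B : L →ₗ[ℝ] L →ₗ[ℝ] L) (D : L →ₗ[ℝ] L) (X : L) (p : L × ℝ) :
    extAd B D X p = (B X p.1 - p.2 • D X, 0) := rfl

namespace IsNilpotentBracket

variable (h : IsNilpotentBracket N B D)
include h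

/-- The Jacobi identity on the summand `L`, and the Leibniz rule for `D` on the adjoined line. -/
lemma extAd_bracket (X Y : L) :
    extAd B D X * extAd B D Y - extAd B D Y * extAd B D X = extAd B D (B X Y) := by
  refine ContinuousLinearMap.ext fun p => ?_
  simp only [sub_apply, mul_apply_eq_comp, extAd_apply]
  ext
  · have h1 := h.jacobi X Y p.1
    rw [h.bracket_self_apply p.1 X, h.bracket_self_apply p.1 (B X Y), map_neg] at h1
    have h2 : B X (B Y p.1) - B Y (B X p.1) = B (B X Y) p.1 := by
      rw [← sub_eq_zero, ← h1]; abel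
    simp only [zero_smul, sub_zero, map_sub, map_smul, Prod.fst_sub, h.leibniz, smul_add]
    rw [← h2, h.bracket_self_apply (D X) Y, smul_neg]
    abel
  · simp

/-- The vector `(0, 1)` is sent to `-D X`. Adjoining an injective derivation makes the adjoint
representation faithful even on the centre, so Ado's theorem is not needed. -/
lemma extAd_injective : Function.Injective (extAd B D) := by
  intro X Y hXY
  have := congrArg (fun A => (A ((0 : L), (1 : ℝ))).1) hXY
  simp only [extAd_apply, map_zero, one_smul, zero_sub, neg_inj] at this
  exact h.injective this

lemma adExp_unique {X : L} {y : ℝ → L}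
    (hy : ∀ s ∈ Icc (0 : ℝ) 1, HasDerivWithinAt y (B X (y s)) (Icc 0 1) s) :
    ∀ s ∈ Icc (0 : ℝ) 1, adExp N B X s (y 0) = y s :=
  eqOn_of_linear_ode (K := fun _ => toCLM₂ B X) (B := fun _ => 0) (C := ‖toCLM₂ B X‖)
    (fun _ _ => le_rfl) (γ := fun s => adExp N B X s (y 0))
    (fun s _ => by simpa using (h.hasDerivAt_adExp X s (y 0)).hasDerivWithinAt)
    (fun s hs => by simpa using hy s hs) (adExp_zero _ _)

lemma adExp_self (X : L) {s : ℝ} (hs : s ∈ Icc (0 : ℝ) 1) : adExp N B X s X = X :=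
  h.adExp_unique (y := fun _ => X) (fun s _ => by
    simpa [h.alt] using hasDerivWithinAt_const s (Icc (0 : ℝ) 1) X) s hs

/-- The derivative of `exp (s ad G) (c s b)` is `exp (s ad G) b`, because the two terms containing
`ad G` cancel. Integration gives the series `(exp - 1) / ad G`; in closed form, `τ = (1 - exp (-ad
G)) / ad G`. -/
lemma adExp_transport {G : L} {τ : L →L[ℝ] L} (hτ : IsTransport (fun _ => toCLM₂ B G) τ) (b : L) :
    aeval (B G) (truncExp N) (τ b) = aeval (B G) (truncExpDiv N) b := by
  obtain ⟨-, c, h0, rfl, hc⟩ := hτ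
  have hcomm : ∀ s u, B G (adExp N B G s u) = adExp N B G s (B G u) := by
    intro s u
    simp only [adExp_eq, map_sum, map_smul]
    refine Finset.sum_congr rfl fun k _ => ?_
    rw [← Module.End.mul_apply, ← Module.End.mul_apply, ← pow_succ, ← pow_succ']
  have hsub : ∀ s u v, adExp N B G s (u - v) = adExp N B G s u - adExp N B G s v :=
    fun s u v => map_sub _ _ _
  have h1 := eqOn_of_linear_ode (K := fun _ => 0) (C := 0) (B := fun s => adExp N B G s b)
    (γ := fun s => adExp N B G s (c s b))
    (η := fun s => ∑ k ∈ Finset.range N,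
      (s ^ (k + 1) * (((k + 1).factorial : ℝ)⁻¹)) • ((B G) ^ k) b) (by simp)
    (fun s hs => ?_) (fun s hs => ?_) (by simp [h0, adExp])
  · have h2 := h1 (x := 1) (by simp)
    simp only [adExp, one_smul, one_pow, one_mul] at h2
    rw [h2, aeval_truncExpDiv, LinearMap.sum_apply]
    rfl
  · let A : ℝ → L →L[ℝ] L := fun s => ∑ k ∈ Finset.range (N + 1),
      (s ^ k * ((k.factorial : ℝ)⁻¹)) • (toCLM₂ B G) ^ k
    have hpow : ∀ (k : ℕ) (u : L), ((toCLM₂ B G) ^ k) u = ((B G) ^ k) u := by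
      intro k
      induction k with
      | zero => intro u; rfl
      | succ k ih =>
        intro u
        rw [pow_succ', pow_succ', mul_apply_eq_comp, ih]
        rfl
    have hA : ∀ s u, A s u = adExp N B G s u := by
      intro s u
      simp [A, adExp_eq, sum_apply, hpow]
    have hdA : HasDerivAt A ((toCLM₂ B G).comp (A s)) s := by
      have hd : DifferentiableAt ℝ A s := by
        simp only [A]
        fun_prop
      refine hd.hasDerivAt.congr_deriv ?_
      ext u
      have h3 := hd.hasDerivAt.clm_apply (hasDerivAt_const s u)
      simp only [map_zero, add_zero] at h3
      simp only [hA] at h3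
      rw [h3.unique (h.hasDerivAt_adExp G s u), ContinuousLinearMap.comp_apply, hA]
      rfl
    have h4 := (hc s hs).clm_apply (hasDerivWithinAt_const s (Icc (0 : ℝ) 1) b)
    have h5 := hdA.hasDerivWithinAt.clm_apply h4
    simp only [map_zero, add_zero] at h5
    simp only [hA] at h5
    refine h5.congr_deriv ?_
    simp only [sub_apply, one_apply_eq_self, ContinuousLinearMap.comp_apply,
      hA, toCLM₂_apply, zero_apply, hcomm, hsub]
    abel
  · refine (HasDerivAt.fun_sum fun k _ =>
      (hasDerivAt_pow_succ_div k s).smul_const _).hasDerivWithinAt.congr_deriv ?_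
    rw [h.adExp_eq']
    simp

end IsNilpotentBracket

section Representation

variable {A : Type*} [NormedRing A] [NormedAlgebra ℝ A]

/-- A faithful representation of the bracket `B` in an associative algebra. -/
structure IsFaithfulRep (B : L →ₗ[ℝ] L →ₗ[ℝ] L) (ρ : L →L[ℝ] A) : Prop where
  bracket : ∀ X Y, ρ X * ρ Y - ρ Y * ρ X = ρ (B X Y)
  injective : Function.Injective ρ

lemma IsNilpotentBracket.isFaithfulRep (h : IsNilpotentBracket N B D) :
    IsFaithfulRep B (extAd B D) :=
  ⟨h.extAd_bracket, h.extAd_injective⟩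

/-- The fields `g ↦ g (ρ X)`. -/
def repField (ρ : L →L[ℝ] A) (g : A) : L →L[ℝ] A := (ContinuousLinearMap.mul ℝ A g).comp ρ

lemma repField_apply (ρ : L →L[ℝ] A) (g : A) (X : L) : repField ρ g X = g * ρ X := rfl

section Lift

variable {ρ : L →L[ℝ] A} [CompleteSpace A] {Φ : L × A → A} {T : L × A → L →L[ℝ] L}
  {Z : L × L × A → L} {r r' : ℝ} (hl : IsLocalLift (repField ρ) (fun _ => toCLM₂ B)
    (fun _ => ContinuousLinearMap.id ℝ L) univ 1 Φ T Z r r')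
include hl

lemma flow_eq_exp {X : L} (hX : X ∈ ball (0 : L) r) : Φ (X, 1) = NormedSpace.exp (ρ X) := by
  have h1 : (1 : A) ∈ ball 1 r := mem_ball_self hl.flow.pos
  have := eqOn_of_linear_ode (K := fun _ => (ContinuousLinearMap.mul ℝ A).flip (ρ X))
    (B := fun _ => 0) (fun _ _ => le_rfl) (γ := fun s => Φ (s • X, 1))
    (η := fun s => NormedSpace.exp (s • ρ X)) (fun s hs => ?_) (fun s hs => ?_) ?_
    (x := 1) (by simp)
  · simpa using this
  · refine (hl.flow.hasDerivAt 1 h1 X s (smul_mem_ball_zero hX hs)).hasDerivWithinAt.congr_deriv ?_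
    simp [repField_apply]
  · refine (hasDerivAt_exp_smul_const (𝕂 := ℝ) (ρ X) s).hasDerivWithinAt.congr_deriv ?_
    simp
  · simp [hl.flow.zero_left 1 h1]

/-- The flow of `g ↦ g (ρ Y)` multiplies by `exp (s ρ Y)` on the right, which fixes the order of the
factors. -/
lemma exp_lift {X Y : L} (hX : X ∈ ball (0 : L) r') (hY : Y ∈ ball (0 : L) r') :
    NormedSpace.exp (ρ (Z (Y, X, 1))) = NormedSpace.exp (ρ X) * NormedSpace.exp (ρ Y) := by
  have h1 : (1 : A) ∈ ball 1 r' := mem_ball_self hl.pos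
  rw [← flow_eq_exp hl (hl.mem Y hY X hX 1 h1)]
  have := eqOn_of_linear_ode (K := fun _ => (ContinuousLinearMap.mul ℝ A).flip (ρ Y))
    (B := fun _ => 0) (fun _ _ => le_rfl) (γ := fun s => Φ (Z (s • Y, X, 1), 1))
    (η := fun s => NormedSpace.exp (ρ X) * NormedSpace.exp (s • ρ Y))
    (fun s hs => ?_) (fun s hs => ?_) ?_ (x := 1) (by simp)
  · simpa using this
  · refine (hl.hasDerivAt_flow hX h1 (smul_mem_ball_zero hY hs)).hasDerivWithinAt.congr_deriv ?_
    simp [repField_apply]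
  · refine ((hasDerivAt_exp_smul_const (𝕂 := ℝ) (ρ Y) s).const_mul
      (NormedSpace.exp (ρ X))).hasDerivWithinAt.congr_deriv ?_
    simp [mul_assoc]
  · simp [hl.zero_left X hX 1 h1, flow_eq_exp hl (ball_subset_ball hl.le hX)]

end Lift

namespace IsFaithfulRep

variable {ρ : L →L[ℝ] A} (hρ : IsFaithfulRep B ρ)
include hρ

lemma isFieldSystem (h : IsNilpotentBracket N B D) : IsFieldSystem (repField ρ)
    (fun _ => toCLM₂ B) (fun _ => ContinuousLinearMap.id ℝ L) univ where
  isOpen := isOpen_univ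
  smooth_v := by
    refine ContDiff.contDiffOn ?_
    unfold repField
    fun_prop
  smooth_a := contDiffOn_const
  smooth_S := contDiffOn_const
  bracket := by
    intro g _ X C
    let K : A →L[ℝ] L →L[ℝ] A :=
      ((ContinuousLinearMap.compL ℝ L A A).flip ρ).comp (ContinuousLinearMap.mul ℝ A)
    have hK : fderiv ℝ (repField ρ) g = K := K.fderiv
    rw [hK]
    change g * ρ X * ρ C - g * ρ C * ρ X = g * ρ (B X C)
    rw [← hρ.bracket, mul_sub, mul_assoc, mul_assoc]
  alt := fun _ _ X => h.alt X

variable [CompleteSpace A]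

/-- `Ad (exp Y) = exp (ad Y)`: both sides solve `y' = ρ Y · y`. -/
lemma exp_mul (h : IsNilpotentBracket N B D) (Y u : L) {s : ℝ} (hs : s ∈ Icc (0 : ℝ) 1) :
    NormedSpace.exp (s • ρ Y) * ρ u = ρ (adExp N B Y s u) * NormedSpace.exp (s • ρ Y) := by
  refine eqOn_of_linear_ode (K := fun _ => ContinuousLinearMap.mul ℝ A (ρ Y)) (B := fun _ => 0)
    (fun _ _ => le_rfl) (γ := fun s => NormedSpace.exp (s • ρ Y) * ρ u)
    (η := fun s => ρ (adExp N B Y s u) * NormedSpace.exp (s • ρ Y))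
    (fun s _ => ?_) (fun s _ => ?_) (by simp [adExp_zero]) hs
  · refine ((hasDerivAt_exp_smul_const' (𝕂 := ℝ) (ρ Y) s).mul_const
      (ρ u)).hasDerivWithinAt.congr_deriv ?_
    simp [mul_assoc]
  · refine ((ρ.hasFDerivAt.comp_hasDerivAt s (h.hasDerivAt_adExp Y s u)).mul
      (hasDerivAt_exp_smul_const' (𝕂 := ℝ) (ρ Y) s)).hasDerivWithinAt.congr_deriv ?_
    rw [← hρ.bracket]
    simp only [Function.comp_apply, ContinuousLinearMap.mul_apply', zero_add]
    rw [sub_mul, mul_assoc (ρ _) (ρ Y), sub_add_cancel, mul_assoc]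

lemma adExp_neg_cancel (h : IsNilpotentBracket N B D) (Y u : L) {s : ℝ}
    (hs : s ∈ Icc (0 : ℝ) 1) : adExp N B Y s (adExp N B (-Y) s u) = u := by
  have h1 := hρ.exp_mul h (-Y) u hs
  have h2 := hρ.exp_mul h Y (adExp N B (-Y) s u) hs
  have h3 : NormedSpace.exp (s • ρ Y) * (NormedSpace.exp (s • ρ (-Y)) * ρ u) =
      ρ (adExp N B Y s (adExp N B (-Y) s u)) *
        (NormedSpace.exp (s • ρ Y) * NormedSpace.exp (s • ρ (-Y))) := by
    rw [h1, ← mul_assoc, h2, mul_assoc]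
  rw [map_neg, smul_neg, ← mul_assoc, exp_mul_exp_neg, one_mul, mul_one] at h3
  exact (hρ.injective h3).symm

variable [FiniteDimensional ℝ A] {Φ : L × A → A} {T : L × A → L →L[ℝ] L} {Z : L × L × A → L}
  {r r' : ℝ} (hl : IsLocalLift (repField ρ) (fun _ => toCLM₂ B)
    (fun _ => ContinuousLinearMap.id ℝ L) univ 1 Φ T Z r r')
include hl

/-- `Ad` is multiplicative, so `exp_lift` gives the identity after applying `ρ`, and faithfulness
brings it back to `L`. -/
lemma aeval_lift (h : IsNilpotentBracket N B D) {X Y : L} (hX : X ∈ ball (0 : L) r')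
    (hY : Y ∈ ball (0 : L) r') {s : ℝ} (hs : s ∈ Icc (0 : ℝ) 1) :
    aeval (B (Z (s • Y, s • X, 1))) (truncExp N) =
      aeval (s • B X) (truncExp N) * aeval (s • B Y) (truncExp N) := by
  ext u
  have h1 := exp_lift hl (smul_mem_ball_zero hX hs) (smul_mem_ball_zero hY hs)
  have h2 := hρ.exp_mul h (Z (s • Y, s • X, 1)) u (s := 1) (by simp)
  have h3 : adExp N B (Z (s • Y, s • X, 1)) 1 u = adExp N B X s (adExp N B Y s u) := by
    refine hρ.injective (mul_exp_cancel (ρ (Z (s • Y, s • X, 1))) ?_)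
    rw [one_smul] at h2
    rw [← h2, h1, map_smul, map_smul, mul_assoc, hρ.exp_mul h Y u hs,
      ← mul_assoc (NormedSpace.exp (s • ρ X)), hρ.exp_mul h X _ hs, mul_assoc]
  simpa [adExp] using h3

-- Differentiate `exp ρ(G) = exp (s ρ X) exp (s ρ Y)` for `G = Z (s • Y, s • X, 1)`. The left side
-- gives `exp ρ(G) · ρ(T G')`. On the right, moving `ρ X` past `exp (s ρ Y)` replaces `X` by `exp
-- (-s ad Y) X`. Then the exponentials cancel and `ρ` is injective.
set_option maxHeartbeats 400000 in
lemma hasDerivAt_lift (h : IsNilpotentBracket N B D) {X Y : L} (hX : X ∈ ball (0 : L) r')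
    (hY : Y ∈ ball (0 : L) r') {s : ℝ} (hs : s ∈ Icc (0 : ℝ) 1) :
    ∃ G', HasDerivAt (fun s : ℝ => Z (s • Y, s • X, 1)) G' s ∧
      T (Z (s • Y, s • X, 1), 1) G' = Y + adExp N B (-Y) s X := by
  have h1 : (1 : A) ∈ ball 1 r' := mem_ball_self hl.pos
  have h1' := ball_subset_ball hl.le h1
  have hXs := smul_mem_ball_zero hX hs
  have hYs := smul_mem_ball_zero hY hs
  have hm := hl.mem _ hYs _ hXs 1 h1
  have hZ : DifferentiableAt ℝ (fun s : ℝ => Z (s • Y, s • X, 1)) s := by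
    have hd : DifferentiableAt ℝ Z (s • Y, s • X, 1) := (hl.smooth_Z.contDiffAt
      ((isOpen_ball.prod (isOpen_ball.prod isOpen_ball)).mem_nhds
        ⟨hYs, hXs, h1⟩)).differentiableAt (by simp)
    exact DifferentiableAt.comp (f := fun s : ℝ => (s • Y, s • X, (1 : A))) s hd
      ((differentiableAt_id.smul_const Y).prodMk
        ((differentiableAt_id.smul_const X).prodMk (differentiableAt_const _)))
  obtain ⟨G', hG'⟩ : ∃ G', HasDerivAt (fun s : ℝ => Z (s • Y, s • X, 1)) G' s :=
    ⟨_, hZ.hasDerivAt⟩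
  refine ⟨G', hG', hρ.injective ?_⟩
  have hΦ : DifferentiableAt ℝ (fun X => Φ (X, 1)) (Z (s • Y, s • X, 1)) := by
    have : DifferentiableAt ℝ Φ (Z (s • Y, s • X, 1), 1) := (hl.flow.contDiffOn.contDiffAt
      ((isOpen_ball.prod isOpen_ball).mem_nhds ⟨hm, h1'⟩)).differentiableAt (by simp)
    exact DifferentiableAt.comp (f := fun X : L => (X, (1 : A))) _ this
      (differentiableAt_id.prodMk (differentiableAt_const _))
  have h2 := HasFDerivAt.comp_hasDerivAt (f := fun s : ℝ => Z (s • Y, s • X, 1)) s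
    hΦ.hasFDerivAt hG'
  have h3 : HasDerivAt (fun s : ℝ => NormedSpace.exp (s • ρ X) * NormedSpace.exp (s • ρ Y))
      (NormedSpace.exp (s • ρ X) * ρ X * NormedSpace.exp (s • ρ Y) +
        NormedSpace.exp (s • ρ X) * (NormedSpace.exp (s • ρ Y) * ρ Y)) s :=
    (hasDerivAt_exp_smul_const (𝕂 := ℝ) (ρ X) s).mul
      (hasDerivAt_exp_smul_const (𝕂 := ℝ) (ρ Y) s)
  have h4 : EqOn (fun s : ℝ => Φ (Z (s • Y, s • X, 1), 1))
      (fun s => NormedSpace.exp (s • ρ X) * NormedSpace.exp (s • ρ Y)) (Icc 0 1) := by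
    intro s hs
    have hXs := smul_mem_ball_zero hX hs
    have hYs := smul_mem_ball_zero hY hs
    simp only
    rw [flow_eq_exp hl (hl.mem _ hYs _ hXs 1 h1), exp_lift hl hXs hYs, map_smul, map_smul]
  have h5 := (h2.hasDerivWithinAt (s := Icc 0 1)).congr (f₁ := fun s =>
    NormedSpace.exp (s • ρ X) * NormedSpace.exp (s • ρ Y))
    (fun x hx => (h4 hx).symm) (h4 hs).symm
  -- The identity `h4` is known on `[0, 1]` only, so derivatives within the interval are compared.
  have h6 := (uniqueDiffOn_Icc (zero_lt_one (α := ℝ)) s hs).eq_deriv _ h5 h3.hasDerivWithinAt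
  rw [hl.fderiv_flow _ hm 1 h1', repField_apply, show Φ (Z (s • Y, s • X, 1), 1) = _ from h4 hs]
    at h6
  refine exp_mul_cancel (s • ρ Y) (exp_mul_cancel (s • ρ X) ?_)
  rw [mul_assoc] at h6
  rw [h6, map_add, mul_add, hρ.exp_mul h Y (adExp N B (-Y) s X) hs,
    hρ.adExp_neg_cancel h Y X hs, mul_add, add_comm,
    mul_assoc]

/-- Apply `E = exp (ad G)` to the equation of `hasDerivAt_lift`. On the left, `adExp_transport`
produces `(exp - 1) / ad G` applied to `G'`, which `log E / (E - 1)` inverts. On the right, `E = exp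
(s ad X) exp (s ad Y)` gives `X + exp (s ad X) Y`. So `G` has the same derivative as Dynkin's
series, and both vanish at `s = 0`. -/
lemma lift_eq_bch (h : IsNilpotentBracket N B D) {X Y : L} (hX : X ∈ ball (0 : L) r')
    (hY : Y ∈ ball (0 : L) r') : Z (Y, X, 1) = bch N B Y X := by
  have h1 : (1 : A) ∈ ball 1 r' := mem_ball_self hl.pos
  have hd : ∀ s ∈ Icc (0 : ℝ) 1, HasDerivAt (fun s : ℝ => Z (s • Y, s • X, 1))
      (truncLogDiv N (aeval (s • B X) (truncExp N) * aeval (s • B Y) (truncExp N))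
        (X + aeval (s • B X) (truncExp N) Y)) s := by
    intro s hs
    obtain ⟨G', hG', hT⟩ := hρ.hasDerivAt_lift hl h hX hY hs
    refine hG'.congr_deriv ?_
    have hm := hl.mem _ (smul_mem_ball_zero hY hs) _ (smul_mem_ball_zero hX hs) 1 h1
    have h2 := h.adExp_transport ((hl.transport _ hm 1 (ball_subset_ball hl.le h1)).congr
      fun _ _ => rfl) G'
    have h3 := congrArg (fun A => A G') (truncLogDiv_mul_aeval (N := N)
      (h.nilpotent (Z (s • Y, s • X, 1))))
    simp only [Module.End.mul_apply, Module.End.one_apply] at h3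
    rw [← h2, hρ.aeval_lift hl h hX hY hs] at h3
    rw [← h3, hT]
    congr 1
    have h4 : aeval (s • B Y) (truncExp N) (adExp N B (-Y) s X) = X :=
      hρ.adExp_neg_cancel h Y X hs
    have h5 : aeval (s • B Y) (truncExp N) Y = Y := h.adExp_self Y hs
    have h6 : aeval (s • B X) (truncExp N) X = X := h.adExp_self X hs
    rw [Module.End.mul_apply, map_add, map_add, add_comm, h4, h5, h6]
  have := eqOn_of_linear_ode (K := fun _ => 0) (C := 0)
    (B := fun s => truncLogDiv N (aeval (s • B X) (truncExp N) * aeval (s • B Y) (truncExp N))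
        (X + aeval (s • B X) (truncExp N) Y))
    (γ := fun s : ℝ => Z (s • Y, s • X, 1)) (η := fun s : ℝ => bch N B (s • Y) (s • X)) (by simp)
    (fun s hs => by simpa using (hd s hs).hasDerivWithinAt)
    (fun s hs => by simpa using (hasDerivAt_bch B h.alt X Y s).hasDerivWithinAt)
    (by simp [bch_zero_zero, hl.zero_left 0 (mem_ball_self hl.pos) 1 (mem_ball_self hl.pos)])
    (x := 1) (by simp)
  simpa using this

end IsFaithfulRep

end Representation

/-- The Baker–Campbell–Hausdorff product is the solution of a differential equation in `L`. -/
theorem IsNilpotentBracket.exists_eq_bch (h : IsNilpotentBracket N B D) : ∃ ρ > 0,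
    ∀ (z : ℝ → L) (X Y : L), X ∈ ball (0 : L) ρ → Y ∈ ball (0 : L) ρ →
    z 0 = X → (∀ s ∈ Icc (0 : ℝ) 1, z s ∈ ball (0 : L) ρ ∧
      ∃ τ, IsTransport (fun _ => toCLM₂ B (z s)) τ ∧
        HasDerivWithinAt z (Ring.inverse τ Y) (Icc 0 1) s) → z 1 = bch N B Y X := by
  have hL : CompleteSpace L := FiniteDimensional.complete ℝ _
  have hL' : CompleteSpace (L × ℝ) := FiniteDimensional.complete ℝ _
  have hρ := h.isFaithfulRep
  obtain ⟨Φ, T, Z, r, r', hl⟩ := (hρ.isFieldSystem h).exists_isLocalLift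
    (mem_univ (1 : L × ℝ →L[ℝ] L × ℝ))
  have h1 : (1 : L × ℝ →L[ℝ] L × ℝ) ∈ ball 1 r' := mem_ball_self hl.pos
  have h1' := ball_subset_ball hl.le h1
  refine ⟨r', hl.pos, fun z X Y hX hY h0 hz => ?_⟩
  rw [← hρ.lift_eq_bch hl h hX hY]
  -- With constant structure functions the transport does not depend on the base point, so `z` and
  -- the lift in the matrix model solve the same autonomous equation.
  have := eqOn_of_autonomous_ode (f := fun X => Ring.inverse (T (X, 1)) Y)
    (γ := z) (η := fun s : ℝ => Z (s • Y, X, 1)) (fun s hs => ?_)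
    (fun s hs => (hl.hasDerivAt X hX 1 h1 Y s (smul_mem_ball_zero hY hs)).hasDerivWithinAt)
    (fun s hs => ?_) (by simp [h0, hl.zero_left X hX 1 h1]) (x := 1) (by simp)
  · simpa using this
  · obtain ⟨hzs, τ, hτ, hd⟩ := hz s hs
    rwa [hτ.unique (hl.transport _ (ball_subset_ball hl.le hzs) 1 h1')] at hd
  · exact hl.contDiffAt_inverse_apply (hρ.isFieldSystem h)
      (ball_subset_ball hl.le (hz s hs).1) h1' Y

end NilpotentBCH

/-! ### Dilations, filtered maps and their graded limits -/

section GradedSpaces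

open Set

variable {N : ℕ} {V W : Fin N → Type*} [∀ i, NormedAddCommGroup (V i)] [∀ i, NormedSpace ℝ (V i)]
  [∀ i, NormedAddCommGroup (W i)] [∀ i, NormedSpace ℝ (W i)]

/-- The dilation as a continuous linear map. -/
def dilL (c : ℝ) : Tot V →L[ℝ] Tot V :=
  ContinuousLinearMap.pi fun i => c ^ wt i • ContinuousLinearMap.proj i

@[simp] lemma dilL_apply (c : ℝ) (X : Tot V) : dilL c X = dil c X := rfl

lemma dil_apply (c : ℝ) (X : Tot V) (i : Fin N) : dil c X i = c ^ wt i • X i := rfl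

lemma dil_dil (c d : ℝ) (X : Tot V) : dil c (dil d X) = dil (c * d) X := by
  ext i; simp [dil_apply, mul_pow, mul_smul]

@[simp] lemma dil_one (X : Tot V) : dil 1 X = X := by ext i; simp [dil_apply]

@[simp] lemma dil_zero_right (c : ℝ) : dil c (0 : Tot V) = 0 := map_zero (dilL c)

@[simp] lemma dil_zero_left (X : Tot V) : dil 0 X = 0 := by
  ext i; simp [dil_apply, wt]

lemma dil_inv_dil {c : ℝ} (hc : c ≠ 0) (X : Tot V) : dil c⁻¹ (dil c X) = X := by
  rw [dil_dil, inv_mul_cancel₀ hc, dil_one]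

lemma dil_dil_inv {c : ℝ} (hc : c ≠ 0) (X : Tot V) : dil c (dil c⁻¹ X) = X := by
  rw [dil_dil, mul_inv_cancel₀ hc, dil_one]

/-- The dilation as a linear equivalence. -/
def dilEquiv (c : ℝ) (hc : c ≠ 0) : Tot V ≃L[ℝ] Tot V :=
  ContinuousLinearEquiv.equivOfInverse (dilL c) (dilL c⁻¹) (dil_inv_dil hc) (dil_dil_inv hc)

@[simp] lemma dilEquiv_apply {c : ℝ} (hc : c ≠ 0) (X : Tot V) : dilEquiv c hc X = dil c X := rfl

@[simp] lemma dilEquiv_symm_apply {c : ℝ} (hc : c ≠ 0) (X : Tot V) :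
    (dilEquiv c hc).symm X = dil c⁻¹ X := rfl

lemma contDiff_dilL : ContDiff ℝ ∞ (dilL : ℝ → Tot V →L[ℝ] Tot V) := by
  have : (dilL : ℝ → Tot V →L[ℝ] Tot V) = fun c => ∑ i, c ^ wt i •
      (ContinuousLinearMap.single ℝ V i).comp (ContinuousLinearMap.proj i) := by
    funext c
    ext X i
    simp only [dilL_apply, dil_apply, sum_apply, smul_apply, ContinuousLinearMap.comp_apply,
      ContinuousLinearMap.proj_apply, Finset.sum_apply, Pi.smul_apply]
    rw [Finset.sum_eq_single i]
    · simp
    · intro j _ hj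
      simp [Pi.single_eq_of_ne' hj]
    · simp
  rw [this]
  fun_prop

lemma wt_pos (i : Fin N) : 0 < wt i := Nat.succ_pos _

lemma wt_le (i : Fin N) : wt i ≤ N := i.2

lemma wt_injective : Function.Injective (wt : Fin N → ℕ) := fun i j h => by
  simpa [wt, Fin.ext_iff] using h

/-- The projector onto a homogeneous summand. -/
def homProj (i : Fin N) : Tot V →L[ℝ] Tot V :=
  (ContinuousLinearMap.single ℝ V i).comp (ContinuousLinearMap.proj i)

lemma homProj_apply (i : Fin N) (X : Tot V) : homProj i X = Pi.single i (X i) := rfl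

lemma sum_homProj (X : Tot V) : ∑ i, homProj i X = X := by
  simp only [homProj_apply, Finset.univ_sum_single]

lemma homProj_dil (i : Fin N) (c : ℝ) (X : Tot V) :
    homProj i (dil c X) = c ^ wt i • homProj i X := by
  rw [homProj_apply, homProj_apply, dil_apply, Pi.single_smul]

lemma homProj_self_apply (i : Fin N) (X : Tot V) : homProj i X i = X i := by
  simp [homProj_apply]

/-- `S` maps weight `i` to weights at most `i`. -/
def IsFilteredMap (S : Tot W →L[ℝ] Tot V) : Prop :=
  ∀ (i k : Fin N) (Y : Tot W), wt i < wt k → S (homProj i Y) k = 0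

/-- `A` maps weights `i`, `j` to weights at most `i + j`. -/
def IsFilteredBilin (A : Tot V →L[ℝ] Tot V →L[ℝ] Tot V) : Prop :=
  ∀ (i j k : Fin N) (X C : Tot V), wt i + wt j < wt k → A (homProj i X) (homProj j C) k = 0

/-- The conjugate of a filtered map by the dilation `α_t`, extended to `t = 0`. -/
def rescale (t : ℝ) (S : Tot W →L[ℝ] Tot V) : Tot W →L[ℝ] Tot V :=
  -- For `wt i < wt k` the truncated exponent is 0 instead of negative. A filtered map has no such
  -- component.
  ∑ i, ∑ k, t ^ (wt i - wt k) • (homProj k).comp (S.comp (homProj i))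

/-- The conjugate of a filtered bilinear map by the dilation `α_t`, extended to `t = 0`. -/
def rescale₂ (t : ℝ) (A : Tot V →L[ℝ] Tot V →L[ℝ] Tot V) : Tot V →L[ℝ] Tot V →L[ℝ] Tot V :=
  ∑ i, ∑ j, ∑ k, t ^ (wt i + wt j - wt k) •
    (ContinuousLinearMap.compL ℝ _ _ _ (homProj k)).comp (A.bilinearComp (homProj i) (homProj j))

lemma sum_homProj_smul_apply (f : Fin N → ℝ) (X : Tot V) (k : Fin N) :
    (∑ k', f k' • homProj k' X) k = f k • X k := by
  rw [Finset.sum_apply, Finset.sum_eq_single k]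
  · rw [Pi.smul_apply, homProj_self_apply]
  · intro j _ hj
    simp [homProj_apply, Pi.single_eq_of_ne' hj]
  · simp

lemma rescale_apply (t : ℝ) (S : Tot W →L[ℝ] Tot V) (Y : Tot W) (k : Fin N) :
    rescale t S Y k = ∑ i, t ^ (wt i - wt k) • S (homProj i Y) k := by
  simp only [rescale, sum_apply, smul_apply, ContinuousLinearMap.comp_apply]
  rw [Finset.sum_apply]
  refine Finset.sum_congr rfl fun i _ => ?_
  exact sum_homProj_smul_apply (fun k => t ^ (wt i - wt k)) _ k

lemma rescale₂_apply (t : ℝ) (A : Tot V →L[ℝ] Tot V →L[ℝ] Tot V) (X C : Tot V) (k : Fin N) :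
    rescale₂ t A X C k =
      ∑ i, ∑ j, t ^ (wt i + wt j - wt k) • A (homProj i X) (homProj j C) k := by
  simp only [rescale₂, sum_apply, smul_apply, ContinuousLinearMap.comp_apply,
    ContinuousLinearMap.compL_apply, ContinuousLinearMap.bilinearComp_apply]
  rw [Finset.sum_apply]
  refine Finset.sum_congr rfl fun i _ => ?_
  rw [Finset.sum_apply]
  refine Finset.sum_congr rfl fun j _ => ?_
  exact sum_homProj_smul_apply (fun k => t ^ (wt i + wt j - wt k)) _ k

lemma map_eq_sum_homProj (S : Tot W →L[ℝ] Tot V) (Y : Tot W) (k : Fin N) :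
    S Y k = ∑ i, S (homProj i Y) k := by
  conv_lhs => rw [← sum_homProj Y, map_sum, Finset.sum_apply]

lemma map₂_eq_sum_homProj (A : Tot V →L[ℝ] Tot V →L[ℝ] Tot V) (X C : Tot V) (k : Fin N) :
    A X C k = ∑ i, ∑ j, A (homProj i X) (homProj j C) k := by
  conv_lhs => rw [← sum_homProj X, map_sum, sum_apply, Finset.sum_apply]
  exact Finset.sum_congr rfl fun i _ => map_eq_sum_homProj _ _ _

/-- This form of the conjugation identity also makes sense at `t = 0`, where the dilation is not
invertible. -/
lemma dil_rescale {S : Tot W →L[ℝ] Tot V} (hS : IsFilteredMap S) (t : ℝ) (Y : Tot W) :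
    dil t (rescale t S Y) = S (dil t Y) := by
  ext k
  rw [dil_apply, rescale_apply, map_eq_sum_homProj, Finset.smul_sum]
  refine Finset.sum_congr rfl fun i _ => ?_
  rw [homProj_dil, map_smul, Pi.smul_apply, smul_smul, ← pow_add]
  rcases lt_or_ge (wt i) (wt k) with h | h
  · rw [hS _ _ _ h, smul_zero, smul_zero]
  · rw [Nat.add_sub_cancel' h]

lemma rescale_dil {S : Tot W →L[ℝ] Tot V} (hS : IsFilteredMap S) (t : ℝ) {c : ℝ} (hc : c ≠ 0)
    (Y : Tot W) : rescale (c⁻¹ * t) S (dil c Y) = dil c (rescale t S Y) := by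
  ext k
  rw [dil_apply, rescale_apply, rescale_apply, Finset.smul_sum]
  refine Finset.sum_congr rfl fun i _ => ?_
  rw [homProj_dil, map_smul, Pi.smul_apply, smul_smul, smul_smul]
  rcases lt_or_ge (wt i) (wt k) with h | h
  · rw [hS _ _ _ h, smul_zero, smul_zero]
  · congr 1
    obtain ⟨n, hn⟩ := Nat.exists_eq_add_of_le h
    rw [hn, Nat.add_sub_cancel_left, mul_pow, pow_add, inv_pow]
    field_simp

lemma dil_rescale₂ {A : Tot V →L[ℝ] Tot V →L[ℝ] Tot V} (hA : IsFilteredBilin A) (t : ℝ)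
    (X C : Tot V) : dil t (rescale₂ t A X C) = A (dil t X) (dil t C) := by
  ext k
  rw [dil_apply, rescale₂_apply, map₂_eq_sum_homProj, Finset.smul_sum]
  refine Finset.sum_congr rfl fun i _ => ?_
  rw [Finset.smul_sum]
  refine Finset.sum_congr rfl fun j _ => ?_
  rw [homProj_dil, homProj_dil, map_smul, map_smul, smul_apply, Pi.smul_apply, Pi.smul_apply,
    smul_smul, smul_smul, ← pow_add, ← pow_add]
  rcases lt_or_ge (wt i + wt j) (wt k) with h | h
  · rw [hA _ _ _ _ _ h, smul_zero, smul_zero]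
  · rw [Nat.add_sub_cancel' h, add_comm]

lemma rescale₂_dil {A : Tot V →L[ℝ] Tot V →L[ℝ] Tot V} (hA : IsFilteredBilin A) (t : ℝ) {c : ℝ}
    (hc : c ≠ 0) (X C : Tot V) :
    rescale₂ (c⁻¹ * t) A (dil c X) (dil c C) = dil c (rescale₂ t A X C) := by
  ext k
  rw [dil_apply, rescale₂_apply, rescale₂_apply, Finset.smul_sum]
  refine Finset.sum_congr rfl fun i _ => ?_
  rw [Finset.smul_sum]
  refine Finset.sum_congr rfl fun j _ => ?_
  rw [homProj_dil, homProj_dil, map_smul, map_smul, smul_apply, Pi.smul_apply, Pi.smul_apply,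
    smul_smul, smul_smul, smul_smul]
  rcases lt_or_ge (wt i + wt j) (wt k) with h | h
  · rw [hA _ _ _ _ _ h, smul_zero, smul_zero]
  · congr 1
    obtain ⟨n, hn⟩ := Nat.exists_eq_add_of_le h
    rw [mul_assoc, ← pow_add, add_comm (wt j), hn, Nat.add_sub_cancel_left, mul_pow, pow_add,
      inv_pow]
    field_simp

/-- Antisymmetry of `A` makes the double sum equal to its own negative. -/
lemma rescale₂_self {A : Tot V →L[ℝ] Tot V →L[ℝ] Tot V} (hA : ∀ X, A X X = 0) (t : ℝ)
    (X : Tot V) : rescale₂ t A X X = 0 := by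
  have hA' : ∀ X Y, A X Y = -A Y X := by
    intro X Y
    have := hA (X + Y)
    simp only [map_add, add_apply, hA, zero_add, add_zero] at this
    rw [eq_neg_iff_add_eq_zero, add_comm]
    exact this
  ext k
  rw [rescale₂_apply, Pi.zero_apply]
  suffices h : ∀ s : V k, s = -s → s = 0 by
    refine h _ ?_
    conv_lhs => rw [Finset.sum_comm]
    rw [← Finset.sum_neg_distrib]
    refine Finset.sum_congr rfl fun i _ => ?_
    rw [← Finset.sum_neg_distrib]
    refine Finset.sum_congr rfl fun j _ => ?_
    rw [hA', Pi.neg_apply, smul_neg, add_comm]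
  intro s hs
  have h2 : (2 : ℝ) • s = 0 := by rw [two_smul]; nth_rewrite 1 [hs]; exact neg_add_cancel s
  exact (smul_eq_zero_iff_right two_ne_zero).1 h2

/-- Since `0 ^ 0 = 1`, exactly the weight-preserving components survive: the limit is the associated
graded map. -/
lemma rescale_zero {S : Tot W →L[ℝ] Tot V} (hS : IsFilteredMap S) (Y : Tot W) (k : Fin N) :
    rescale 0 S Y k = S (homProj k Y) k := by
  rw [rescale_apply, Finset.sum_eq_single k]
  · simp
  · intro i _ hi
    rcases lt_or_gt_of_ne (wt_injective.ne hi) with h | h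
    · rw [hS _ _ _ h, smul_zero]
    · rw [zero_pow (Nat.sub_pos_of_lt h).ne', zero_smul]
  · simp

lemma rescale_id (t : ℝ) : rescale t (ContinuousLinearMap.id ℝ (Tot V)) =
    ContinuousLinearMap.id ℝ (Tot V) := by
  ext Y k
  rw [rescale_apply, Finset.sum_eq_single k]
  · simp [homProj_self_apply]
  · intro i _ hi
    simp [homProj_apply, Pi.single_eq_of_ne' hi]
  · simp

section Smooth

lemma contDiff_rescale [∀ i, FiniteDimensional ℝ (W i)] :
    ContDiff ℝ ∞ fun p : ℝ × (Tot W →L[ℝ] Tot V) => rescale p.1 p.2 := by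
  refine contDiff_clm_apply_iff.2 fun Y => contDiff_pi.2 fun k => ?_
  simp only [rescale_apply]
  refine ContDiff.sum fun i _ => (contDiff_fst.pow _).smul ?_
  exact (ContinuousLinearMap.proj (R := ℝ) (φ := V) k).contDiff.comp
    (contDiff_snd.clm_apply contDiff_const)

lemma contDiff_rescale₂ [∀ i, FiniteDimensional ℝ (V i)] : ContDiff ℝ ∞
    fun p : ℝ × (Tot V →L[ℝ] Tot V →L[ℝ] Tot V) => rescale₂ p.1 p.2 := by
  refine contDiff_clm_apply_iff.2 fun X => contDiff_clm_apply_iff.2 fun C =>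
    contDiff_pi.2 fun k => ?_
  simp only [rescale₂_apply]
  refine ContDiff.sum fun i _ => ContDiff.sum fun j _ => (contDiff_fst.pow _).smul ?_
  exact (ContinuousLinearMap.proj (R := ℝ) (φ := V) k).contDiff.comp
    ((contDiff_snd.clm_apply contDiff_const).clm_apply contDiff_const)

end Smooth

namespace IsGradedLieBracket

variable {B : Tot V →ₗ[ℝ] Tot V →ₗ[ℝ] Tot V} (hB : IsGradedLieBracket B)
include hB

lemma map_dil (c : ℝ) (X Y : Tot V) : B (dil c X) (dil c Y) = dil c (B X Y) := by
  have key : ∀ i j, B (homProj i (dil c X)) (homProj j (dil c Y)) =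
      dil c (B (homProj i X) (homProj j Y)) := by
    intro i j
    ext k
    rw [homProj_dil, homProj_dil, map_smul, map_smul, LinearMap.smul_apply, dil_apply]
    rw [Pi.smul_apply, Pi.smul_apply, smul_smul, ← pow_add]
    by_cases h : wt k = wt i + wt j
    · rw [h, add_comm]
    · rw [show B (homProj i X) (homProj j Y) k = 0 from hB.graded i j k _ _ h, smul_zero,
        smul_zero]
  rw [← sum_homProj (dil c X), ← sum_homProj (dil c Y)]
  conv_rhs => rw [← sum_homProj X, ← sum_homProj Y]
  simp only [map_sum, LinearMap.sum_apply, key]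
  simp only [← dilL_apply, map_sum]

/-- Weights are at least 1, so `ad X` raises the lowest weight. This is the source of nilpotency. -/
lemma apply_eq_zero_of_lt {m : ℕ} {X Y : Tot V} (hY : ∀ k, wt k ≤ m → Y k = 0) :
    ∀ k, wt k ≤ m + 1 → B X Y k = 0 := by
  intro k hk
  have : B X Y k = ∑ i, ∑ j, B (homProj i X) (homProj j Y) k := by
    conv_lhs => rw [← sum_homProj X, ← sum_homProj Y]
    simp only [map_sum, LinearMap.sum_apply, Finset.sum_apply]
    exact Finset.sum_comm
  rw [this]
  refine Finset.sum_eq_zero fun i _ => Finset.sum_eq_zero fun j _ => ?_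
  by_cases h : wt k = wt i + wt j
  · have := wt_pos i
    rw [homProj_apply j, hY j (by omega)]
    simp
  · exact hB.graded i j k _ _ h

/-- The derivation multiplying weight `k` by `k`. -/
lemma isNilpotentBracket : IsNilpotentBracket N B
    (LinearMap.pi fun i => (wt i : ℝ) • LinearMap.proj i) where
  alt := hB.alt
  jacobi := hB.jacobi
  nilpotent := by
    intro X
    have h : ∀ m : ℕ, ∀ Y, ∀ k, wt k ≤ m → ((B X) ^ m) Y k = 0 := by
      intro m
      induction m with
      | zero => intro Y k hk; exact absurd hk (wt_pos k).not_ge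
      | succ m ih =>
        intro Y
        rw [pow_succ']
        exact hB.apply_eq_zero_of_lt (ih Y)
    refine LinearMap.ext fun Y => funext fun k => ?_
    exact h N Y k (wt_le k)
  leibniz := by
    intro X Y
    have key : ∀ i j, ∀ k, (wt k : ℝ) • B (homProj i X) (homProj j Y) k =
        ((wt i : ℝ) + wt j) • B (homProj i X) (homProj j Y) k := by
      intro i j k
      by_cases h : wt k = wt i + wt j
      · rw [h, Nat.cast_add]
      · rw [show B (homProj i X) (homProj j Y) k = 0 from hB.graded i j k _ _ h, smul_zero,
          smul_zero]
    have hD : ∀ (Z : Tot V) i, homProj i ((LinearMap.pi fun i => (wt i : ℝ) •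
        (LinearMap.proj i : Tot V →ₗ[ℝ] V i)) Z) = (wt i : ℝ) • homProj i Z := by
      intro Z i
      rw [homProj_apply, homProj_apply, ← Pi.single_smul]
      rfl
    have hsum : ∀ X Y, B X Y = ∑ i, ∑ j, B (homProj i X) (homProj j Y) := by
      intro X Y
      conv_lhs => rw [← sum_homProj X, ← sum_homProj Y]
      simp only [map_sum, LinearMap.sum_apply]
      exact Finset.sum_comm
    rw [hsum (LinearMap.pi _ X) Y, hsum X (LinearMap.pi _ Y), hsum X Y]
    simp only [hD, map_smul, LinearMap.smul_apply, ← Finset.sum_add_distrib, ← add_smul]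
    ext k
    change (wt k : ℝ) • (∑ i, ∑ j, B (homProj i X) (homProj j Y)) k = _
    simp only [Finset.sum_apply, Finset.smul_sum, key, Pi.smul_apply]
  injective := by
    intro X Y h
    ext k
    have h1 : (wt k : ℝ) • X k = (wt k : ℝ) • Y k := congrFun h k
    exact smul_right_injective _ (Nat.cast_ne_zero.2 (wt_pos k).ne') h1

lemma nestedBracket_map_dil (c : ℝ) (l : List (Tot V)) :
    nestedBracket B (l.map (dil c)) = dil c (nestedBracket B l) := by
  induction l with
  | nil => simp [nestedBracket]
  | cons a l ih =>
    cases l with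
    | nil => simp [nestedBracket]
    | cons b l =>
      simp only [List.map_cons, nestedBracket] at ih ⊢
      rw [ih, hB.map_dil]

lemma bch_dil (n : ℕ) (c : ℝ) (X Y : Tot V) :
    bch n B (dil c Y) (dil c X) = dil c (bch n B Y X) := by
  simp only [bch, ← dilL_apply, map_sum, map_smul]
  refine Finset.sum_congr rfl fun m _ => ?_
  congr 1
  refine Finset.sum_congr rfl fun rs _ => ?_
  congr 1
  rw [dilL_apply, dilL_apply, dilL_apply, ← hB.nestedBracket_map_dil]
  congr 1
  rw [List.map_flatten, List.map_ofFn]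
  congr 2
  funext i
  simp

/-- If `wt i + wt j ≤ N`, the bracket itself appears, with exponent 0 in the only weight where it
can be nonzero. Otherwise `wt k ≤ N < wt i + wt j`, so the exponent is positive and the arbitrary
value of `A` disappears in the limit. -/
lemma rescale₂_zero {A : Tot V →L[ℝ] Tot V →L[ℝ] Tot V}
    (hA : ∀ i j (X C : Tot V), wt i + wt j ≤ N →
      A (homProj i X) (homProj j C) = B (homProj i X) (homProj j C))
    (X C : Tot V) : rescale₂ 0 A X C = B X C := by
  ext k
  have hsum : B X C k = ∑ i, ∑ j, B (homProj i X) (homProj j C) k := by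
    conv_lhs => rw [← sum_homProj X, ← sum_homProj C]
    simp only [map_sum, LinearMap.sum_apply, Finset.sum_apply]
    exact Finset.sum_comm
  rw [rescale₂_apply, hsum]
  refine Finset.sum_congr rfl fun i _ => Finset.sum_congr rfl fun j _ => ?_
  by_cases hN : wt i + wt j ≤ N
  · rw [hA i j X C hN]
    by_cases h : wt k = wt i + wt j
    · simp [h]
    · rw [show B (homProj i X) (homProj j C) k = 0 from hB.graded i j k _ _ h, smul_zero]
  · have hk := wt_le k
    rw [show B (homProj i X) (homProj j C) k = 0 from hB.graded i j k _ _ (by omega),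
      zero_pow (by omega), zero_smul]

end IsGradedLieBracket

end GradedSpaces

/-! ### Homogeneous bases and coordinates -/

section HomogeneousBasis

variable {N : ℕ} (V : Fin N → Type*) [∀ i, NormedAddCommGroup (V i)] [∀ i, NormedSpace ℝ (V i)]
  [∀ i, FiniteDimensional ℝ (V i)]

/-- A basis of homogeneous elements. -/
def homBasis : Module.Basis (Σ i, Fin (Module.finrank ℝ (V i))) ℝ (Tot V) :=
  Pi.basis fun i => Module.finBasis ℝ (V i)

variable {V}

lemma homBasis_apply (p : Σ i, Fin (Module.finrank ℝ (V i))) :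
    homBasis V p = Pi.single p.1 (Module.finBasis ℝ (V p.1) p.2) := by
  rw [homBasis, Pi.basis_apply]

lemma homProj_homBasis (p : Σ i, Fin (Module.finrank ℝ (V i))) :
    homProj p.1 (homBasis V p) = homBasis V p := by
  rw [homProj_apply, homBasis_apply, Pi.single_eq_same]

/-- The coordinates in the homogeneous basis. -/
def homCoord (p : Σ i, Fin (Module.finrank ℝ (V i))) : Tot V →L[ℝ] ℝ :=
  LinearMap.toContinuousLinearMap ((homBasis V).coord p)

lemma homCoord_homProj {p : Σ i, Fin (Module.finrank ℝ (V i))} {i : Fin N} (h : p.1 ≠ i)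
    (X : Tot V) : homCoord p (homProj i X) = 0 := by
  change (homBasis V).repr (homProj i X) p = 0
  rw [homBasis, Pi.basis_repr, homProj_apply, Pi.single_eq_of_ne h]
  simp

lemma sum_homCoord (X : Tot V) : ∑ p, homCoord p X • homBasis V p = X :=
  (homBasis V).sum_repr X

lemma sum_homCoord_map {R : Type*} [AddCommGroup R] [Module ℝ R] (β : Tot V →ₗ[ℝ] R) (X : Tot V) :
    ∑ p, homCoord p X • β (homBasis V p) = β X := by
  conv_rhs => rw [← sum_homCoord X]
  simp only [map_sum, map_smul]

lemma sum_homCoord_map₂ {R : Type*} [AddCommGroup R] [Module ℝ R]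
    (β : Tot V →ₗ[ℝ] Tot V →ₗ[ℝ] R) (X C : Tot V) :
    ∑ p, ∑ q, (homCoord p X * homCoord q C) • β (homBasis V p) (homBasis V q) = β X C := by
  conv_rhs => rw [← sum_homCoord_map β X, LinearMap.sum_apply]
  refine Finset.sum_congr rfl fun p _ => ?_
  rw [LinearMap.smul_apply, ← sum_homCoord_map (β (homBasis V p)) C, Finset.smul_sum]
  simp only [mul_smul]

lemma sum_eq_zero_of_antisymm {ι R : Type*} [Fintype ι] [AddCommGroup R] [Module ℝ R]
    {f : ι → ι → R} (hf : ∀ p q, f p q = -f q p) : ∑ p, ∑ q, f p q = 0 := by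
  have h1 : ∑ p, ∑ q, f p q = -∑ p, ∑ q, f p q := by
    conv_lhs => rw [Finset.sum_comm]
    simp only [← Finset.sum_neg_distrib]
    exact Finset.sum_congr rfl fun p _ => Finset.sum_congr rfl fun q _ => hf q p
  have h2 : (2 : ℝ) • (∑ p, ∑ q, f p q) = 0 := by
    rw [two_smul]
    nth_rewrite 1 [h1]
    exact neg_add_cancel _
  exact (smul_eq_zero_iff_right two_ne_zero).1 h2

end HomogeneousBasis

/-! ### Smooth structure functions and comparison coefficients -/

section StructureFunctions

variable {E : Type*} [NormedAddCommGroup E] [NormedSpace ℝ E]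
  {M : Type*} [TopologicalSpace M] [ChartedSpace E M] [IsManifold 𝓘(ℝ, E) ∞ M]

/-- Evaluation of vector fields at a point. -/
def evalVF (x : M) : VF E M →ₗ[ℝ] E where
  toFun X := X x
  map_add' _ _ := rfl
  map_smul' _ _ := rfl

lemma evalVF_apply (x : M) (X : VF E M) : evalVF x X = X x := rfl

variable {N : ℕ} {V W : Fin N → Type*} [∀ i, NormedAddCommGroup (V i)]
  [∀ i, NormedSpace ℝ (V i)] [∀ i, NormedAddCommGroup (W i)] [∀ i, NormedSpace ℝ (W i)]

lemma VF.mdifferentiableAt (X : VF E M) (x : M) :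
    MDifferentiableAt 𝓘(ℝ, E) 𝓘(ℝ, E).tangent
      (fun y => (⟨y, X y⟩ : TangentBundle 𝓘(ℝ, E) M)) x :=
  X.contMDiff.contMDiffAt.mdifferentiableAt (by simp)

section Bracket

variable [CompleteSpace E]

/-- The brackets of the vector fields `nat X` and `nat C` at a point. -/
def bracketAt (nat : Tot V →ₗ[ℝ] VF E M) (x : M) : Tot V →ₗ[ℝ] Tot V →ₗ[ℝ] E :=
  have : IsManifold 𝓘(ℝ, E) (minSmoothness ℝ 2) M :=
    IsManifold.of_le (n := ∞) (by rw [minSmoothness_of_isRCLikeNormedField]; norm_cast)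
  LinearMap.mk₂ ℝ (fun X C => VectorField.mlieBracket 𝓘(ℝ, E) (fun y => nat X y)
      (fun y => nat C y) x)
    (fun X Y C => by
      have := VectorField.mlieBracket_add_left (W := fun y => nat C y)
        ((nat X).mdifferentiableAt x) ((nat Y).mdifferentiableAt x)
      rw [map_add]
      exact this)
    (fun c X C => by
      have := VectorField.mlieBracket_const_smul_left (c := c) (W := fun y => nat C y)
        ((nat X).mdifferentiableAt x)
      rw [map_smul]
      exact this)
    (fun X Y C => by
      have := VectorField.mlieBracket_add_right (V := fun y => nat X y)
        ((nat Y).mdifferentiableAt x) ((nat C).mdifferentiableAt x)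
      rw [map_add]
      exact this)
    (fun c X C => by
      have := VectorField.mlieBracket_const_smul_right (c := c) (V := fun y => nat X y)
        ((nat C).mdifferentiableAt x)
      rw [map_smul]
      exact this)

lemma bracketAt_apply (nat : Tot V →ₗ[ℝ] VF E M) (x : M) (X C : Tot V) :
    bracketAt nat x X C = VectorField.mlieBracket 𝓘(ℝ, E) (fun y => nat X y)
      (fun y => nat C y) x := rfl

lemma bracketAt_swap (nat : Tot V →ₗ[ℝ] VF E M) (x : M) (X C : Tot V) :
    bracketAt nat x X C = -bracketAt nat x C X :=
  VectorField.mlieBracket_swap_apply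

end Bracket

namespace GradedBasis

variable {F : FilteredFoliation E M N}

/-- By linearity a combination `∑ f_j ♮(A_j)` is `♮(∑ f_j A_j)`, so generation amounts to one smooth
`V`-valued coefficient function. -/
lemma exists_coeff (b : GradedBasis F V) {k : ℕ} (hk : 1 ≤ k) (hN : 0 < N) {Y : VF E M}
    (hY : Y ∈ F.mod k) : ∃ g : M → Tot V, ContMDiff 𝓘(ℝ, E) 𝓘(ℝ, Tot V) ∞ g ∧
      (∀ x i, k < wt i → g x i = 0) ∧ ∀ x ∈ b.base, evalVF x (b.nat (g x)) = Y x := by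
  -- Generation is available up to depth `N` only; from there on the filtration is constant.
  have hY' : Y ∈ F.mod (min k N) := by
    rcases le_total k N with h | h
    · rwa [min_eq_left h]
    · rw [min_eq_right h, F.top N le_rfl]
      exact (F.top k h Y).1 hY
  obtain ⟨m, X, f, hX, hf⟩ := b.generates (min k N)
    (Finset.mem_Icc.2 ⟨le_min hk hN, min_le_right _ _⟩) Y hY'
  choose A hA hXA using hX
  refine ⟨fun x => ∑ j, f j x • A j, ?_, fun x i hi => ?_, fun x hx => ?_⟩
  · exact contMDiff_finsetSum fun j _ => (f j).contMDiff.smul contMDiff_const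
  · change (∑ j, f j x • A j) i = 0
    rw [Finset.sum_apply]
    refine Finset.sum_eq_zero fun j _ => ?_
    rw [Pi.smul_apply, hA j i (lt_of_le_of_lt (min_le_left _ _) hi), smul_zero]
  · rw [hf x hx, map_sum, map_sum]
    refine Finset.sum_congr rfl fun j _ => ?_
    rw [map_smul, map_smul, ← hXA]
    rfl

/-- Vector fields of the filtration are smooth combinations of those of a graded basis. -/
theorem exists_comparison [∀ i, FiniteDimensional ℝ (W i)] (b : GradedBasis F V)
    (natW : Tot W →ₗ[ℝ] VF E M)
    (hW : ∀ i (a : W i), natW (Pi.single i a) ∈ F.mod (i + 1)) :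
    ∃ S : M → Tot W →L[ℝ] Tot V, ContMDiff 𝓘(ℝ, E) 𝓘(ℝ, Tot W →L[ℝ] Tot V) ∞ S ∧
      (∀ x, IsFilteredMap (S x)) ∧
      ∀ x ∈ b.base, ∀ Y, evalVF x (b.nat (S x Y)) = natW Y x := by
  have hg : ∀ p : Σ i, Fin (Module.finrank ℝ (W i)), ∃ g : M → Tot V,
      ContMDiff 𝓘(ℝ, E) 𝓘(ℝ, Tot V) ∞ g ∧ (∀ x i, wt p.1 < wt i → g x i = 0) ∧
        ∀ x ∈ b.base, evalVF x (b.nat (g x)) = natW (homBasis W p) x := by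
    intro p
    refine b.exists_coeff (wt_pos p.1) p.1.pos ?_
    rw [homBasis_apply]
    exact hW _ _
  choose g hgs hgf hgn using hg
  refine ⟨fun x => ∑ p, ContinuousLinearMap.smulRightL ℝ (Tot W) (Tot V) (homCoord p) (g p x),
    ?_, fun x i k Y hik => ?_, fun x hx Y => ?_⟩
  · exact contMDiff_finsetSum fun p _ =>
      (ContinuousLinearMap.smulRightL ℝ (Tot W) (Tot V) (homCoord p)).contMDiff.comp (hgs p)
  · rw [sum_apply, Finset.sum_apply]
    refine Finset.sum_eq_zero fun p _ => ?_
    rw [ContinuousLinearMap.smulRightL_apply_apply, ContinuousLinearMap.smulRight_apply,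
      Pi.smul_apply]
    by_cases hp : p.1 = i
    · rw [hgf p x k (hp ▸ hik), smul_zero]
    · rw [homCoord_homProj hp, zero_smul]
  · rw [sum_apply, map_sum, map_sum, ← evalVF_apply]
    refine Eq.trans ?_ (sum_homCoord_map (evalVF x ∘ₗ natW) Y)
    refine Finset.sum_congr rfl fun p _ => ?_
    rw [ContinuousLinearMap.smulRightL_apply_apply, ContinuousLinearMap.smulRight_apply, map_smul,
      map_smul, hgn p x hx]
    rfl

/-- Brackets of the vector fields of a graded basis are smooth combinations of such fields. The
structure functions may be prescribed in low weights. -/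
theorem exists_structure [CompleteSpace E] [∀ i, FiniteDimensional ℝ (V i)] (b : GradedBasis F V)
    (B : Tot V →ₗ[ℝ] Tot V →ₗ[ℝ] Tot V)
    (m : ℕ) (halt : ∀ X, B X X = 0) (hfil : ∀ (i j k : Fin N) (X C : Tot V),
      wt i + wt j < wt k → B (homProj i X) (homProj j C) k = 0)
    (hm : ∀ (i j : Fin N) (X C : Tot V), wt i + wt j ≤ m → ∀ x,
      evalVF x (b.nat (B (homProj i X) (homProj j C))) =
        bracketAt b.nat x (homProj i X) (homProj j C)) :
    ∃ A : M → Tot V →L[ℝ] Tot V →L[ℝ] Tot V,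
      ContMDiff 𝓘(ℝ, E) 𝓘(ℝ, Tot V →L[ℝ] Tot V →L[ℝ] Tot V) ∞ A ∧
      (∀ x X, A x X X = 0) ∧ (∀ x, IsFilteredBilin (A x)) ∧
      (∀ x ∈ b.base, ∀ X C, evalVF x (b.nat (A x X C)) = bracketAt b.nat x X C) ∧
      ∀ x (i j : Fin N) (X C : Tot V), wt i + wt j ≤ m →
        A x (homProj i X) (homProj j C) = B (homProj i X) (homProj j C) := by
  have hBs : ∀ X Y, B X Y = -B Y X := by
    intro X Y
    have := halt (X + Y)
    simp only [map_add, LinearMap.add_apply, halt, zero_add, add_zero] at this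
    rw [eq_neg_iff_add_eq_zero, add_comm]
    exact this
  have hg : ∀ p q : Σ i, Fin (Module.finrank ℝ (V i)), ∃ g : M → Tot V,
      ContMDiff 𝓘(ℝ, E) 𝓘(ℝ, Tot V) ∞ g ∧ (∀ x i, wt p.1 + wt q.1 < wt i → g x i = 0) ∧
        (∀ x ∈ b.base, evalVF x (b.nat (g x)) =
          bracketAt b.nat x (homBasis V p) (homBasis V q)) ∧
        (wt p.1 + wt q.1 ≤ m → ∀ x, g x = B (homBasis V p) (homBasis V q)) := by
    intro p q
    by_cases h : wt p.1 + wt q.1 ≤ m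
    · refine ⟨fun _ => B (homBasis V p) (homBasis V q), contMDiff_const, fun x i hi => ?_,
        fun x _ => ?_, fun _ _ => rfl⟩
      · rw [← homProj_homBasis p, ← homProj_homBasis q]
        exact hfil _ _ _ _ _ hi
      · have := hm p.1 q.1 (homBasis V p) (homBasis V q) h x
        rwa [homProj_homBasis, homProj_homBasis] at this
    · obtain ⟨Z, hZ, hZb⟩ := F.bracket_mem (wt p.1) (wt q.1) (b.nat (homBasis V p))
        (by rw [homBasis_apply]; exact b.nat_mem _ _) (b.nat (homBasis V q))
        (by rw [homBasis_apply]; exact b.nat_mem _ _)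
      obtain ⟨g, h1, h2, h3⟩ := b.exists_coeff (by have := wt_pos p.1; omega) p.1.pos hZ
      exact ⟨g, h1, h2, fun x hx => (h3 x hx).trans (hZb x), fun h' => absurd h' h⟩
  choose g hgs hgf hgn hgm using hg
  -- The coefficients `g p q` are antisymmetrised. This leaves the fields they represent unchanged,
  -- as brackets are antisymmetric, and makes the structure functions alternating, as
  -- `IsLocalLift.eq_of_const` requires.
  have hAapp : ∀ x (X C : Tot V), (∑ p, ∑ q, ContinuousLinearMap.smulRightL ℝ (Tot V)
      (Tot V →L[ℝ] Tot V) (homCoord p) (ContinuousLinearMap.smulRightL ℝ (Tot V) (Tot V)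
        (homCoord q) ((2⁻¹ : ℝ) • (g p q x - g q p x)))) X C =
      ∑ p, ∑ q, (homCoord p X * homCoord q C) • ((2⁻¹ : ℝ) • (g p q x - g q p x)) := by
    intro x X C
    simp only [sum_apply]
    refine Finset.sum_congr rfl fun p _ => Finset.sum_congr rfl fun q _ => ?_
    rw [mul_smul]
    rfl
  refine ⟨fun x => ∑ p, ∑ q, ContinuousLinearMap.smulRightL ℝ (Tot V)
      (Tot V →L[ℝ] Tot V) (homCoord p) (ContinuousLinearMap.smulRightL ℝ (Tot V) (Tot V)
        (homCoord q) ((2⁻¹ : ℝ) • (g p q x - g q p x))), ?_, fun x X => ?_,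
        fun x i j k X C hk => ?_, fun x hx X C => ?_, fun x i j X C hij => ?_⟩
  · refine contMDiff_finsetSum fun p _ => contMDiff_finsetSum fun q _ => ?_
    have hT : ContDiff ℝ ∞ fun A : Tot V →L[ℝ] Tot V =>
        ContinuousLinearMap.smulRightL ℝ (Tot V) (Tot V →L[ℝ] Tot V) (homCoord p) A := by
      fun_prop
    exact hT.contMDiff.comp ((ContinuousLinearMap.smulRightL ℝ (Tot V) (Tot V) (homCoord q)).contMDiff.comp
        (((contDiff_id (E := Tot V)).const_smul (2⁻¹ : ℝ)).contMDiff.comp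
          ((hgs p q).sub (hgs q p))))
  · rw [hAapp]
    refine sum_eq_zero_of_antisymm fun p q => ?_
    rw [mul_comm, ← smul_neg, ← smul_neg, neg_sub]
  · rw [hAapp, Finset.sum_apply]
    refine Finset.sum_eq_zero fun p _ => ?_
    rw [Finset.sum_apply]
    refine Finset.sum_eq_zero fun q _ => ?_
    by_cases hp : p.1 = i
    · by_cases hq : q.1 = j
      · rw [Pi.smul_apply, Pi.smul_apply, Pi.sub_apply, hgf p q x k (by rw [hp, hq]; exact hk),
          hgf q p x k (by rw [hp, hq, add_comm]; exact hk), sub_zero, smul_zero, smul_zero]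
      · rw [homCoord_homProj hq, mul_zero, zero_smul, Pi.zero_apply]
    · rw [homCoord_homProj hp, zero_mul, zero_smul, Pi.zero_apply]
  · rw [hAapp, ← sum_homCoord_map₂ (bracketAt b.nat x) X C]
    simp only [map_sum, map_smul, map_sub]
    refine Finset.sum_congr rfl fun p _ => Finset.sum_congr rfl fun q _ => ?_
    rw [hgn p q x hx, hgn q p x hx, bracketAt_swap b.nat x (homBasis V q), sub_neg_eq_add,
      ← two_smul ℝ, inv_smul_smul₀ two_ne_zero]
  · rw [hAapp, ← sum_homCoord_map₂ B]
    refine Finset.sum_congr rfl fun p _ => Finset.sum_congr rfl fun q _ => ?_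
    by_cases hp : p.1 = i
    · by_cases hq : q.1 = j
      · rw [hgm p q (by rw [hp, hq]; exact hij), hgm q p (by rw [hp, hq, add_comm]; exact hij),
          hBs (homBasis V q), sub_neg_eq_add, ← two_smul ℝ, inv_smul_smul₀ two_ne_zero]
      · rw [homCoord_homProj hq, mul_zero, zero_smul, zero_smul]
    · rw [homCoord_homProj hp, zero_mul, zero_smul, zero_smul]

end GradedBasis

end StructureFunctions

/-! ### Vector fields and flows in charts -/

section Charts

open Set Metric

variable {E : Type*} [NormedAddCommGroup E] [NormedSpace ℝ E]
  {M : Type*} [TopologicalSpace M] [ChartedSpace E M] [IsManifold 𝓘(ℝ, E) ∞ M]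

/-- The tangent map of the inverse of a chart. -/
def chartDeriv (x₀ : M) (y : E) : E →L[ℝ] E :=
  mfderiv 𝓘(ℝ, E) 𝓘(ℝ, E) (extChartAt 𝓘(ℝ, E) x₀).symm y

/-- The tangent map of a chart, at the point with coordinates `y`. -/
def chartTangent (x₀ : M) (y : E) : E →L[ℝ] E := (chartDeriv x₀ y).inverse

/-- A vector field in the coordinates of a chart. -/
def chartRep (x₀ : M) (X : VF E M) (y : E) : E :=
  chartTangent x₀ y (evalVF ((extChartAt 𝓘(ℝ, E) x₀).symm y) X)

lemma chartRep_eq_mpullback (x₀ : M) (X : VF E M) :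
    chartRep x₀ X = VectorField.mpullback 𝓘(ℝ, E) 𝓘(ℝ, E) (extChartAt 𝓘(ℝ, E) x₀).symm
      (fun y => X y) := rfl

lemma contMDiffAt_chart_symm {x₀ : M} {y : E} (hy : y ∈ (extChartAt 𝓘(ℝ, E) x₀).target) :
    ContMDiffAt 𝓘(ℝ, E) 𝓘(ℝ, E) ∞ (extChartAt 𝓘(ℝ, E) x₀).symm y :=
  (contMDiffOn_extChartAt_symm x₀).contMDiffAt ((isOpen_extChartAt_target x₀).mem_nhds hy)

lemma isInvertible_chartDeriv {x₀ : M} {y : E}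
    (hy : y ∈ (extChartAt 𝓘(ℝ, E) x₀).target) : (chartDeriv x₀ y).IsInvertible := by
  have : IsManifold 𝓘(ℝ, E) 1 M := IsManifold.of_le (n := ∞) (by norm_cast)
  have := isInvertible_mfderivWithin_extChartAt_symm (I := 𝓘(ℝ, E)) hy
  rwa [modelWithCornersSelf_coe, range_id, mfderivWithin_univ] at this

lemma chartDeriv_chartRep {x₀ : M} {y : E} (hy : y ∈ (extChartAt 𝓘(ℝ, E) x₀).target)
    (X : VF E M) :
    chartDeriv x₀ y (chartRep x₀ X y) = evalVF ((extChartAt 𝓘(ℝ, E) x₀).symm y) X :=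
  (isInvertible_chartDeriv hy).self_apply_inverse _

lemma contDiffOn_chartRep [CompleteSpace E] (x₀ : M) (X : VF E M) :
    ContDiffOn ℝ ∞ (chartRep x₀ X) (extChartAt 𝓘(ℝ, E) x₀).target := by
  have : IsManifold 𝓘(ℝ, E) (∞ + 1) M := by simpa using ‹IsManifold 𝓘(ℝ, E) ∞ M›
  intro y hy
  rw [chartRep_eq_mpullback]
  refine ContDiffAt.contDiffWithinAt (contMDiffAt_vectorSpace_iff_contDiffAt.1 ?_)
  have hi := isInvertible_chartDeriv hy
  exact ContMDiffAt.mpullback_vectorField_preimage X.contMDiff.contMDiffAt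
    (contMDiffAt_chart_symm hy) hi (by simp)

lemma mlieBracket_eq_lieBracket (V W : ∀ y : E, TangentSpace 𝓘(ℝ, E) y) (y : E) :
    VectorField.mlieBracket 𝓘(ℝ, E) V W y = VectorField.lieBracket ℝ V W y := by
  rw [← VectorField.mlieBracketWithin_univ, VectorField.mlieBracketWithin_eq_lieBracketWithin]
  exact congrFun (VectorField.lieBracketWithin_univ (𝕜 := ℝ) (V := V) (W := W)) y

/-- Naturality of the Lie bracket under pullback by the inverse chart. -/
lemma lieBracket_chartRep [CompleteSpace E] {x₀ : M} {y : E}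
    (hy : y ∈ (extChartAt 𝓘(ℝ, E) x₀).target) (X C : VF E M) :
    fderiv ℝ (chartRep x₀ C) y (chartRep x₀ X y) - fderiv ℝ (chartRep x₀ X) y (chartRep x₀ C y) =
      chartTangent x₀ y (VectorField.mlieBracket 𝓘(ℝ, E) (fun y => X y) (fun y => C y)
        ((extChartAt 𝓘(ℝ, E) x₀).symm y)) := by
  have : IsManifold 𝓘(ℝ, E) (minSmoothness ℝ 2) M :=
    IsManifold.of_le (n := ∞) (by rw [minSmoothness_of_isRCLikeNormedField]; norm_cast)
  have h := VectorField.mpullback_mlieBracket (n := ∞) (X.mdifferentiableAt _)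
    (C.mdifferentiableAt _) (contMDiffAt_chart_symm hy)
    (by rw [minSmoothness_of_isRCLikeNormedField]; norm_cast)
  exact (mlieBracket_eq_lieBracket _ _ y).symm.trans h.symm

lemma hasMFDerivAt_of_chartRep {x₀ : M} {X : VF E M} {γ : ℝ → E} {s : ℝ}
    (hs : γ s ∈ (extChartAt 𝓘(ℝ, E) x₀).target) (hγ : HasDerivAt γ (chartRep x₀ X (γ s)) s) :
    HasMFDerivAt 𝓘(ℝ, ℝ) 𝓘(ℝ, E) (fun s => (extChartAt 𝓘(ℝ, E) x₀).symm (γ s)) s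
      ((1 : ℝ →L[ℝ] ℝ).smulRight (X ((extChartAt 𝓘(ℝ, E) x₀).symm (γ s)))) := by
  have h1 := ((contMDiffAt_chart_symm hs).mdifferentiableAt (by simp)).hasMFDerivAt
  have h2 := HasMFDerivAt.comp s h1 hγ.hasFDerivAt.hasMFDerivAt
  have h3 : ∀ A : E →L[ℝ] E, A = chartDeriv x₀ (γ s) →
      A.comp (ContinuousLinearMap.toSpanSingleton ℝ (chartRep x₀ X (γ s))) =
        (1 : ℝ →L[ℝ] ℝ).smulRight (evalVF ((extChartAt 𝓘(ℝ, E) x₀).symm (γ s)) X) := by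
    rintro _ rfl
    ext
    simp [chartDeriv_chartRep hs]
  exact h2.congr_mfderiv (h3 _ rfl)

variable [FiniteDimensional ℝ E]

/-- The flow theorem in a chart, with a scalar parameter multiplying the fixed field. Its radius
serves as a time of existence for all starting points near `x₀`. -/
lemma exists_isMIntegralCurveOn_nhds (X : VF E M) (x₀ : M) : ∃ U ∈ 𝓝 x₀, ∃ ε > 0, ∀ x ∈ U,
    ∃ γ : ℝ → M, γ 0 = x ∧ IsMIntegralCurveOn (I := 𝓘(ℝ, E)) γ (fun y => X y) (Ioo (-ε) ε) := by
  have hE : CompleteSpace E := FiniteDimensional.complete ℝ E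
  obtain ⟨Ψ, r, hΨ⟩ := exists_isLocalFlow (q₀ := extChartAt 𝓘(ℝ, E) x₀ x₀)
    (F := fun y => ContinuousLinearMap.toSpanSingleton ℝ (chartRep x₀ X y))
    (isOpen_extChartAt_target (I := 𝓘(ℝ, E)) x₀) (mem_extChartAt_target x₀)
    (by
      have : ContDiff ℝ ∞ fun y : E => ContinuousLinearMap.toSpanSingleton ℝ y :=
        (ContinuousLinearMap.toSpanSingletonCLE (𝕜 := ℝ) (E := E)).contDiff
      exact this.comp_contDiffOn (contDiffOn_chartRep x₀ X))
  refine ⟨(extChartAt 𝓘(ℝ, E) x₀).source ∩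
    extChartAt 𝓘(ℝ, E) x₀ ⁻¹' ball (extChartAt 𝓘(ℝ, E) x₀ x₀) r,
    Filter.inter_mem (extChartAt_source_mem_nhds x₀)
      ((continuousAt_extChartAt x₀).preimage_mem_nhds (ball_mem_nhds _ hΨ.pos)), r, hΨ.pos,
    fun x hx => ?_⟩
  refine ⟨fun s => (extChartAt 𝓘(ℝ, E) x₀).symm (Ψ (s • 1, extChartAt 𝓘(ℝ, E) x₀ x)), ?_,
    fun s hs => ?_⟩
  · simp only [zero_smul]
    rw [hΨ.zero_left _ hx.2, PartialEquiv.left_inv _ hx.1]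
  · have hs' : s • (1 : ℝ) ∈ ball (0 : ℝ) r := by
      rw [smul_eq_mul, mul_one, mem_ball_zero_iff, Real.norm_eq_abs, abs_lt]
      exact hs
    refine HasMFDerivAt.hasMFDerivWithinAt (hasMFDerivAt_of_chartRep
      (γ := fun s => Ψ (s • 1, extChartAt 𝓘(ℝ, E) x₀ x)) (hΨ.mem _ hs' _ hx.2) ?_)
    simpa using hΨ.hasDerivAt _ hx.2 1 s hs'

variable [T2Space M]

/-- Finitely many local flows cover the support and points outside are stationary, so there is a
uniform time of existence, and curves can be prolonged indefinitely. -/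
lemma exists_isMIntegralCurve {X : VF E M} (hX : CompactlySupported X) (x : M) :
    ∃ γ : ℝ → M, γ 0 = x ∧ IsMIntegralCurve (I := 𝓘(ℝ, E)) γ (fun y => X y) := by
  obtain ⟨K, hK, hXK⟩ := hX
  choose U hU ε hε hγ using exists_isMIntegralCurveOn_nhds X
  obtain ⟨t, -, ht⟩ := hK.elim_nhds_subcover U fun x _ => hU x
  have hmin : ∃ δ > 0, ∀ y ∈ t, δ ≤ ε y := by
    refine ⟨(insert 1 (t.image ε)).min' (Finset.insert_nonempty _ _), ?_, fun y hy =>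
      Finset.min'_le _ _ (Finset.mem_insert_of_mem (Finset.mem_image_of_mem _ hy))⟩
    rw [gt_iff_lt, Finset.lt_min'_iff]
    intro y hy
    rcases Finset.mem_insert.1 hy with rfl | hy
    · exact one_pos
    · obtain ⟨z, -, rfl⟩ := Finset.mem_image.1 hy
      exact hε z
  obtain ⟨δ, hδ, hδt⟩ := hmin
  have : IsManifold 𝓘(ℝ, E) 1 M := IsManifold.of_le (n := ∞) (by norm_cast)
  refine exists_isMIntegralCurve_of_isMIntegralCurveOn (X.contMDiff.of_le (by norm_cast)) hδ
    (fun y => ?_) x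
  by_cases hy : y ∈ K
  · obtain ⟨z, hz, hyz⟩ := mem_iUnion₂.1 (ht hy)
    obtain ⟨γ, h0, h1⟩ := hγ z y hyz
    exact ⟨γ, h0, h1.mono (Ioo_subset_Ioo (neg_le_neg (hδt z hz)) (hδt z hz))⟩
  · exact ⟨fun _ => y, rfl, (isMIntegralCurve_const (hXK y hy)).isMIntegralCurveOn _⟩

/-- The time-one flow is the end point of any integral curve. -/
lemma flowOne_eq {X : VF E M} (hX : CompactlySupported X) {γ : ℝ → M} {a b : ℝ} (ha : a < 0)
    (hb : 1 < b) (hγ : IsMIntegralCurveOn (I := 𝓘(ℝ, E)) γ (fun y => X y) (Ioo a b)) :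
    flowOne X (γ 0) = γ 1 := by
  have h := exists_isMIntegralCurve hX (γ 0)
  have : IsManifold 𝓘(ℝ, E) 1 M := IsManifold.of_le (n := ∞) (by norm_cast)
  rw [flowOne, dif_pos h]
  exact isMIntegralCurveOn_Ioo_eqOn_of_contMDiff_boundaryless (t₀ := 0)
    ⟨ha, zero_lt_one.trans hb⟩ (X.contMDiff.of_le (by norm_cast))
    (h.choose_spec.2.isMIntegralCurveOn _) hγ h.choose_spec.1 ⟨ha.trans zero_lt_one, hb⟩

lemma flowOne_eq_of_chartRep {X : VF E M} (hX : CompactlySupported X) {x₀ : M} {γ : ℝ → E}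
    {a b : ℝ} (ha : a < 0) (hb : 1 < b)
    (hm : ∀ s ∈ Ioo a b, γ s ∈ (extChartAt 𝓘(ℝ, E) x₀).target)
    (hγ : ∀ s ∈ Ioo a b, HasDerivAt γ (chartRep x₀ X (γ s)) s) :
    flowOne X ((extChartAt 𝓘(ℝ, E) x₀).symm (γ 0)) = (extChartAt 𝓘(ℝ, E) x₀).symm (γ 1) :=
  flowOne_eq hX (γ := fun s => (extChartAt 𝓘(ℝ, E) x₀).symm (γ s)) ha hb fun s hs =>
    (hasMFDerivAt_of_chartRep (hm s hs) (hγ s hs)).hasMFDerivWithinAt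

lemma flowOne_zero (x : M) : flowOne (0 : VF E M) x = x := by
  refine flowOne_eq (γ := fun _ => x) (a := -1) (b := 2) ⟨∅, isCompact_empty, fun _ _ => rfl⟩
    (by norm_num) (by norm_num) ?_
  exact (isMIntegralCurve_const rfl).isMIntegralCurveOn _

end Charts

/-! ### The lifting problem in charts and in chart-free form -/

section LiftData

open Set Metric

variable {E : Type*} [NormedAddCommGroup E] [NormedSpace ℝ E]
  {M : Type*} [TopologicalSpace M] [ChartedSpace E M] [IsManifold 𝓘(ℝ, E) ∞ M]
  {N : ℕ} {V W : Fin N → Type*} [∀ i, NormedAddCommGroup (V i)] [∀ i, NormedSpace ℝ (V i)]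
  [∀ i, NormedAddCommGroup (W i)] [∀ i, NormedSpace ℝ (W i)]

/-- Vector fields `nat X` closed under brackets on `U`, with structure functions `A`, and vector
fields `natW Y` that are combinations of the former on `U`, with coefficients `S`. -/
structure IsLiftData [CompleteSpace E] (U : Set M) (nat : Tot V →ₗ[ℝ] VF E M)
    (natW : Tot W →ₗ[ℝ] VF E M)
    (A : M → Tot V →L[ℝ] Tot V →L[ℝ] Tot V) (S : M → Tot W →L[ℝ] Tot V) : Prop where
  isOpen : IsOpen U
  compact : ∀ X, CompactlySupported (nat X)
  compact_W : ∀ Y, CompactlySupported (natW Y)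
  smooth_A : ContMDiff 𝓘(ℝ, E) 𝓘(ℝ, Tot V →L[ℝ] Tot V →L[ℝ] Tot V) ∞ A
  alt : ∀ x X, A x X X = 0
  filtered_A : ∀ x, IsFilteredBilin (A x)
  bracket : ∀ x ∈ U, ∀ X C, evalVF x (nat (A x X C)) = bracketAt nat x X C
  smooth_S : ContMDiff 𝓘(ℝ, E) 𝓘(ℝ, Tot W →L[ℝ] Tot V) ∞ S
  filtered_S : ∀ x, IsFilteredMap (S x)
  comparison : ∀ x ∈ U, ∀ Y, evalVF x (nat (S x Y)) = evalVF x (natW Y)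

section Coordinates

/-- The structure functions in a chart, with the scale as an additional variable. -/
def chartA (x₀ : M) (A : M → Tot V →L[ℝ] Tot V →L[ℝ] Tot V) (e : E × ℝ) :
    Tot V →L[ℝ] Tot V →L[ℝ] Tot V :=
  rescale₂ e.2 (A ((extChartAt 𝓘(ℝ, E) x₀).symm e.1))

/-- The coefficients in a chart, with the scale as an additional variable. -/
def chartS (x₀ : M) (S : M → Tot W →L[ℝ] Tot V) (e : E × ℝ) : Tot W →L[ℝ] Tot V :=
  rescale e.2 (S ((extChartAt 𝓘(ℝ, E) x₀).symm e.1))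

/-- The part of the domain of a chart that is contained in `U`. -/
def chartDom (x₀ : M) (U : Set M) : Set (E × ℝ) :=
  ((extChartAt 𝓘(ℝ, E) x₀).target ∩ (extChartAt 𝓘(ℝ, E) x₀).symm ⁻¹' U) ×ˢ univ

lemma isOpen_chartDom (x₀ : M) {U : Set M} (hU : IsOpen U) :
    IsOpen (chartDom (E := E) x₀ U) :=
  ((continuousOn_extChartAt_symm (I := 𝓘(ℝ, E)) x₀).isOpen_inter_preimage
    (isOpen_extChartAt_target x₀) hU).prod isOpen_univ

lemma mem_chartDom {x₀ : M} {U : Set M} (hx₀ : x₀ ∈ U) (t : ℝ) :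
    (extChartAt 𝓘(ℝ, E) x₀ x₀, t) ∈ chartDom x₀ U :=
  ⟨⟨mem_extChartAt_target x₀, by simpa using hx₀⟩, mem_univ _⟩

lemma contDiffOn_comp_chart {x₀ : M} {G : Type*} [NormedAddCommGroup G] [NormedSpace ℝ G]
    {f : M → G} (hf : ContMDiff 𝓘(ℝ, E) 𝓘(ℝ, G) ∞ f) :
    ContDiffOn ℝ ∞ (fun y => f ((extChartAt 𝓘(ℝ, E) x₀).symm y))
      (extChartAt 𝓘(ℝ, E) x₀).target := by
  rw [← contMDiffOn_iff_contDiffOn]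
  exact hf.comp_contMDiffOn (contMDiffOn_extChartAt_symm x₀)

variable [∀ i, FiniteDimensional ℝ (V i)]

/-- The vector fields `nat X` in a chart. -/
def natRep (x₀ : M) (nat : Tot V →ₗ[ℝ] VF E M) (y : E) : Tot V →L[ℝ] E :=
  LinearMap.toContinuousLinearMap ((chartTangent x₀ y).toLinearMap ∘ₗ
    evalVF ((extChartAt 𝓘(ℝ, E) x₀).symm y) ∘ₗ nat)

/-- The vector fields `nat (α_t X)` in a chart, with the scale `t` as an additional variable. -/
def chartField (x₀ : M) (nat : Tot V →ₗ[ℝ] VF E M) (e : E × ℝ) : Tot V →L[ℝ] E × ℝ :=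
  ((natRep x₀ nat e.1).comp (dilL e.2)).prod 0

lemma chartField_apply (x₀ : M) (nat : Tot V →ₗ[ℝ] VF E M) (e : E × ℝ) (X : Tot V) :
    chartField x₀ nat e X = (chartRep x₀ (nat (dil e.2 X)) e.1, 0) := rfl

lemma contDiffOn_natRep [CompleteSpace E] (x₀ : M) (nat : Tot V →ₗ[ℝ] VF E M) :
    ContDiffOn ℝ ∞ (natRep x₀ nat) (extChartAt 𝓘(ℝ, E) x₀).target :=
  contDiffOn_clm_apply.2 fun X => contDiffOn_chartRep x₀ (nat X)

lemma contDiffOn_chartField [CompleteSpace E] (x₀ : M) (nat : Tot V →ₗ[ℝ] VF E M) :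
    ContDiffOn ℝ ∞ (chartField x₀ nat) ((extChartAt 𝓘(ℝ, E) x₀).target ×ˢ univ) := by
  have h1 : ContDiffOn ℝ ∞ (fun e : E × ℝ => natRep x₀ nat e.1)
      ((extChartAt 𝓘(ℝ, E) x₀).target ×ˢ univ) :=
    (contDiffOn_natRep x₀ nat).comp contDiffOn_fst fun e he => he.1
  have h2 : ContDiffOn ℝ ∞ (fun e : E × ℝ => (dilL e.2 : Tot V →L[ℝ] Tot V))
      ((extChartAt 𝓘(ℝ, E) x₀).target ×ˢ univ) :=
    ((contDiff_dilL (V := V)).comp contDiff_snd).contDiffOn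
  refine contDiffOn_clm_apply.2 fun X => ?_
  exact ((h1.clm_apply (h2.clm_apply contDiffOn_const))).prodMk contDiffOn_const

lemma contDiffOn_chartA {A : M → Tot V →L[ℝ] Tot V →L[ℝ] Tot V}
    (hA : ContMDiff 𝓘(ℝ, E) 𝓘(ℝ, Tot V →L[ℝ] Tot V →L[ℝ] Tot V) ∞ A) (x₀ : M) (U : Set M) :
    ContDiffOn ℝ ∞ (chartA (E := E) x₀ A) (chartDom x₀ U) := by
  have h1 : ContDiffOn ℝ ∞ (fun e : E × ℝ => A ((extChartAt 𝓘(ℝ, E) x₀).symm e.1))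
      (chartDom x₀ U) :=
    (contDiffOn_comp_chart hA).comp contDiffOn_fst fun e he => he.1.1
  have h2 : ContDiffOn ℝ ∞ (fun e : E × ℝ => (e.2, A ((extChartAt 𝓘(ℝ, E) x₀).symm e.1)))
      (chartDom x₀ U) := contDiffOn_snd.prodMk h1
  have h3 := (contDiff_rescale₂ (V := V)).comp_contDiffOn h2
  exact h3

lemma contDiffOn_chartS [∀ i, FiniteDimensional ℝ (W i)] {S : M → Tot W →L[ℝ] Tot V}
    (hS : ContMDiff 𝓘(ℝ, E) 𝓘(ℝ, Tot W →L[ℝ] Tot V) ∞ S) (x₀ : M) (U : Set M) :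
    ContDiffOn ℝ ∞ (chartS (E := E) x₀ S) (chartDom x₀ U) := by
  have h1 : ContDiffOn ℝ ∞ (fun e : E × ℝ => S ((extChartAt 𝓘(ℝ, E) x₀).symm e.1))
      (chartDom x₀ U) :=
    (contDiffOn_comp_chart hS).comp contDiffOn_fst fun e he => he.1.1
  have h2 : ContDiffOn ℝ ∞ (fun e : E × ℝ => (e.2, S ((extChartAt 𝓘(ℝ, E) x₀).symm e.1)))
      (chartDom x₀ U) := contDiffOn_snd.prodMk h1
  have h3 := (contDiff_rescale (V := V) (W := W)).comp_contDiffOn h2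
  exact h3

lemma fderiv_chartField [CompleteSpace E] {x₀ : M} (nat : Tot V →ₗ[ℝ] VF E M) {y : E}
    (hy : y ∈ (extChartAt 𝓘(ℝ, E) x₀).target) (t : ℝ) (C : Tot V) (w : E) :
    fderiv ℝ (chartField x₀ nat) (y, t) (w, 0) C =
      (fderiv ℝ (chartRep x₀ (nat (dil t C))) y w, 0) := by
  have hnhds : (extChartAt 𝓘(ℝ, E) x₀).target ×ˢ (univ : Set ℝ) ∈ 𝓝 (y, t) :=
    ((isOpen_extChartAt_target x₀).prod isOpen_univ).mem_nhds ⟨hy, mem_univ _⟩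
  have hdv : DifferentiableAt ℝ (chartField x₀ nat) (y, t) :=
    ((contDiffOn_chartField x₀ nat).contDiffAt hnhds).differentiableAt (by simp)
  have h1 : HasFDerivAt (fun y' : E => (y', t)) (ContinuousLinearMap.inl ℝ E ℝ) y :=
    hasFDerivAt_prodMk_left y t
  have h2 := (HasFDerivAt.comp y (f := fun y' : E => (y', t)) hdv.hasFDerivAt h1).clm_apply
    (hasFDerivAt_const C y)
  have h3 : DifferentiableAt ℝ (chartRep x₀ (nat (dil t C))) y :=
    ((contDiffOn_chartRep x₀ _).contDiffAt
      ((isOpen_extChartAt_target x₀).mem_nhds hy)).differentiableAt (by simp)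
  have h4 := h3.hasFDerivAt.prodMk (hasFDerivAt_const (0 : ℝ) y)
  have h5 := congrArg (fun A => A w) (h2.unique h4)
  simpa using h5

/-- The scale is constant along all the fields. For fixed `t` this is the bracket relation for `α_t
X` and `α_t C`, with `α_t` extracted from the structure functions by `dil_rescale₂`. In this form it
persists at `t = 0`. -/
lemma IsLiftData.bracket_chartField [CompleteSpace E] {U : Set M}
    {nat : Tot V →ₗ[ℝ] VF E M} {natW : Tot W →ₗ[ℝ] VF E M}
    {A : M → Tot V →L[ℝ] Tot V →L[ℝ] Tot V} {S : M → Tot W →L[ℝ] Tot V}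
    (h : IsLiftData U nat natW A S) (x₀ : M) {e : E × ℝ} (he : e ∈ chartDom x₀ U)
    (X C : Tot V) :
    fderiv ℝ (chartField x₀ nat) e (chartField x₀ nat e X) C -
      fderiv ℝ (chartField x₀ nat) e (chartField x₀ nat e C) X =
        chartField x₀ nat e (chartA x₀ A e X C) := by
  obtain ⟨y, t⟩ := e
  obtain ⟨⟨hy, hU⟩, -⟩ := he
  have hb := lieBracket_chartRep hy (nat (dil t X)) (nat (dil t C))
  rw [chartField_apply, chartField_apply, chartField_apply, fderiv_chartField nat hy,
    fderiv_chartField nat hy, Prod.mk_sub_mk, sub_zero]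
  refine Prod.ext ?_ rfl
  refine hb.trans ?_
  have h1 : dil t (chartA x₀ A (y, t) X C) =
      A ((extChartAt 𝓘(ℝ, E) x₀).symm y) (dil t X) (dil t C) :=
    dil_rescale₂ (h.filtered_A _) _ _ _
  rw [chartRep]
  simp only
  rw [h1, h.bracket _ hU]
  rfl

lemma IsLiftData.isFieldSystem [CompleteSpace E] [∀ i, FiniteDimensional ℝ (W i)] {U : Set M}
    {nat : Tot V →ₗ[ℝ] VF E M} {natW : Tot W →ₗ[ℝ] VF E M}
    {A : M → Tot V →L[ℝ] Tot V →L[ℝ] Tot V} {S : M → Tot W →L[ℝ] Tot V}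
    (h : IsLiftData U nat natW A S) (x₀ : M) :
    IsFieldSystem (chartField x₀ nat) (chartA x₀ A) (chartS x₀ S) (chartDom x₀ U) where
  isOpen := isOpen_chartDom x₀ h.isOpen
  smooth_v := (contDiffOn_chartField x₀ nat).mono (prod_mono inter_subset_left subset_rfl)
  smooth_a := contDiffOn_chartA h.smooth_A x₀ U
  smooth_S := contDiffOn_chartS h.smooth_S x₀ U
  alt _ _ X := rescale₂_self (h.alt _) _ X
  bracket _ he := h.bracket_chartField x₀ he

end Coordinates

section Canonical

variable (nat : Tot V →ₗ[ℝ] VF E M) (A : M → Tot V →L[ℝ] Tot V →L[ℝ] Tot V)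
  (S : M → Tot W →L[ℝ] Tot V)

/-- The point `exp(nat (α_t X)) · x`. -/
def flowPt (t : ℝ) (x : M) (X : Tot V) : M := flowOne (nat (dil t X)) x

/-- `τ` is the left trivialised derivative of `X ↦ exp(nat (α_t X)) · x`. -/
def IsTransportAt (t : ℝ) (x : M) (X : Tot V) (τ : Tot V →L[ℝ] Tot V) : Prop :=
  IsTransport (fun s => rescale₂ t (A (flowPt nat t x (s • X))) X) τ

open Classical in
/-- The left trivialised derivative of `X ↦ exp(nat (α_t X)) · x`. -/
def transportAt (t : ℝ) (x : M) (X : Tot V) : Tot V →L[ℝ] Tot V :=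
  if h : ∃ τ, IsTransportAt nat A t x X τ then h.choose else 0

/-- The lift of the vector field with coefficients `S Y` under `X ↦ exp(nat (α_t X)) · x`. -/
def liftField (t : ℝ) (x : M) (Y : Tot W) (X : Tot V) : Tot V :=
  Ring.inverse (transportAt nat A t x X) (rescale t (S (flowPt nat t x X)) Y)

/-- `ζ` is an integral curve of the lifted vector field. -/
structure IsLiftCurve (Y : Tot W) (X : Tot V) (x : M) (t : ℝ) (ζ : ℝ → Tot V) : Prop where
  zero : ζ 0 = X
  exists_transport : ∀ s ∈ Icc (0 : ℝ) 1, ∃ τ, IsTransportAt nat A t x (ζ s) τ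
  hasDerivWithinAt : ∀ s ∈ Icc (0 : ℝ) 1,
    HasDerivWithinAt ζ (liftField nat A S t x Y (ζ s)) (Icc 0 1) s
  contDiffAt : ∀ s ∈ Icc (0 : ℝ) 1, ContDiffAt ℝ 1 (liftField nat A S t x Y) (ζ s)

variable {nat A S}

lemma IsTransportAt.eq {t : ℝ} {x : M} {X : Tot V} {τ : Tot V →L[ℝ] Tot V}
    (h : IsTransportAt nat A t x X τ) : transportAt nat A t x X = τ := by
  have h' : ∃ τ, IsTransportAt nat A t x X τ := ⟨τ, h⟩
  rw [transportAt, dif_pos h']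
  exact IsTransport.unique h'.choose_spec h

/-- The regularity clause `contDiffAt` of `IsLiftCurve` is there for this. As no chart enters the
definition, lifts computed in different charts agree. -/
lemma IsLiftCurve.unique {Y : Tot W} {X : Tot V} {x : M} {t : ℝ} {ζ η : ℝ → Tot V}
    (hζ : IsLiftCurve nat A S Y X x t ζ) (hη : IsLiftCurve nat A S Y X x t η) : ζ 1 = η 1 :=
  eqOn_of_autonomous_ode hζ.hasDerivWithinAt hη.hasDerivWithinAt hζ.contDiffAt
    (hζ.zero.trans hη.zero.symm) (right_mem_Icc.2 zero_le_one)

lemma dil_smul (c s : ℝ) (X : Tot V) : dil c (s • X) = s • dil c X := map_smul (dilL c) s X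

lemma flowPt_dil {c : ℝ} (hc : c ≠ 0) (t : ℝ) (x : M) (X : Tot V) :
    flowPt nat (c⁻¹ * t) x (dil c X) = flowPt nat t x X := by
  rw [flowPt, dil_dil, mul_right_comm, inv_mul_cancel₀ hc, one_mul, flowPt]

lemma IsTransportAt.dilate (hA : ∀ x, IsFilteredBilin (A x)) {t : ℝ} {x : M} {X : Tot V}
    {τ : Tot V →L[ℝ] Tot V} (h : IsTransportAt nat A t x X τ) {c : ℝ} (hc : c ≠ 0) :
    IsTransportAt nat A (c⁻¹ * t) x (dil c X)
      ((dilL c).comp (τ.comp (dilL c⁻¹))) := by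
  refine (IsTransport.conj h (dilEquiv c hc)).congr fun s _ => ?_
  ext1 C
  rw [← dil_smul, flowPt_dil hc]
  simp only [ContinuousLinearMap.comp_apply, ContinuousLinearEquiv.coe_coe, dilEquiv_apply,
    dilEquiv_symm_apply]
  rw [← rescale₂_dil (hA _) t hc, dil_dil_inv hc]

/-- `Ring.inverse` is zero on non-units, so one also needs that conjugation reflects invertibility.
-/
lemma ringInverse_conj {G : Type*} [AddCommGroup G] [Module ℝ G] [TopologicalSpace G]
    [IsTopologicalAddGroup G] (δ : G ≃L[ℝ] G)
    (a : G →L[ℝ] G) : Ring.inverse ((δ : G →L[ℝ] G).comp (a.comp (δ.symm : G →L[ℝ] G))) =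
      (δ : G →L[ℝ] G).comp ((Ring.inverse a).comp (δ.symm : G →L[ℝ] G)) := by
  have key : ∀ (δ : G ≃L[ℝ] G) (a b : G →L[ℝ] G), a * b = 1 →
      ((δ : G →L[ℝ] G).comp (a.comp (δ.symm : G →L[ℝ] G))) *
        ((δ : G →L[ℝ] G).comp (b.comp (δ.symm : G →L[ℝ] G))) = 1 := by
    intro δ a b hab
    ext v
    have := congrArg (fun f => f (δ.symm v)) hab
    simp only [mul_apply_eq_comp, one_apply_eq_self] at this
    simp [this]
  have key' : ∀ (δ : G ≃L[ℝ] G) (a : G →L[ℝ] G), IsUnit a →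
      IsUnit ((δ : G →L[ℝ] G).comp (a.comp (δ.symm : G →L[ℝ] G))) ∧
      Ring.inverse ((δ : G →L[ℝ] G).comp (a.comp (δ.symm : G →L[ℝ] G))) =
        (δ : G →L[ℝ] G).comp ((Ring.inverse a).comp (δ.symm : G →L[ℝ] G)) := by
    intro δ a ha
    have h1 := key δ _ _ (Ring.mul_inverse_cancel a ha)
    have h2 := key δ _ _ (Ring.inverse_mul_cancel a ha)
    let u : (G →L[ℝ] G)ˣ := ⟨_, _, h1, h2⟩
    exact ⟨u.isUnit, Ring.inverse_unit u⟩
  by_cases ha : IsUnit a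
  · exact (key' δ a ha).2
  · have hb : ¬IsUnit ((δ : G →L[ℝ] G).comp (a.comp (δ.symm : G →L[ℝ] G))) := by
      intro hb
      apply ha
      have := (key' δ.symm _ hb).1
      convert! this
      ext v
      simp
    rw [Ring.inverse_non_unit _ ha, Ring.inverse_non_unit _ hb]
    simp

/-- The default value 0 is stable under conjugation, so existence of a transport need not be
assumed. -/
lemma transportAt_dil (hA : ∀ x, IsFilteredBilin (A x)) (t : ℝ) (x : M) (X : Tot V) {c : ℝ}
    (hc : c ≠ 0) : transportAt nat A (c⁻¹ * t) x (dil c X) =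
      (dilL c).comp ((transportAt nat A t x X).comp (dilL c⁻¹)) := by
  by_cases h : ∃ τ, IsTransportAt nat A t x X τ
  · obtain ⟨τ, hτ⟩ := h
    rw [hτ.eq, (hτ.dilate hA hc).eq]
  · have h' : ¬∃ τ, IsTransportAt nat A (c⁻¹ * t) x (dil c X) τ := by
      rintro ⟨τ, hτ⟩
      have := hτ.dilate hA (inv_ne_zero hc)
      rw [inv_inv, mul_inv_cancel_left₀ hc, dil_inv_dil hc] at this
      exact h ⟨_, this⟩
    rw [transportAt, dif_neg h', transportAt, dif_neg h]
    simp

lemma liftField_dil (hA : ∀ x, IsFilteredBilin (A x)) (hS : ∀ x, IsFilteredMap (S x)) (t : ℝ)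
    (x : M) (Y : Tot W) (X : Tot V) {c : ℝ} (hc : c ≠ 0) :
    liftField nat A S (c⁻¹ * t) x (dil c Y) (dil c X) = dil c (liftField nat A S t x Y X) := by
  rw [liftField, transportAt_dil hA t x X hc, flowPt_dil hc, rescale_dil (hS _) t hc]
  have h1 : Ring.inverse ((dilL c).comp ((transportAt nat A t x X).comp (dilL c⁻¹))) =
      (dilL c).comp ((Ring.inverse (transportAt nat A t x X)).comp (dilL c⁻¹)) :=
    ringInverse_conj (G := Tot V) (dilEquiv c hc) (transportAt nat A t x X)
  rw [h1]
  simp only [ContinuousLinearMap.comp_apply, dilL_apply, dil_inv_dil hc]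
  rfl

lemma IsLiftCurve.dilate (hA : ∀ x, IsFilteredBilin (A x)) (hS : ∀ x, IsFilteredMap (S x))
    {Y : Tot W} {X : Tot V} {x : M} {t : ℝ} {ζ : ℝ → Tot V}
    (h : IsLiftCurve nat A S Y X x t ζ) {c : ℝ} (hc : c ≠ 0) :
    IsLiftCurve nat A S (dil c Y) (dil c X) x (c⁻¹ * t) (fun s => dil c (ζ s)) where
  zero := by rw [h.zero]
  exists_transport s hs := by
    obtain ⟨τ, hτ⟩ := h.exists_transport s hs
    exact ⟨_, hτ.dilate hA hc⟩
  hasDerivWithinAt s hs := by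
    rw [liftField_dil hA hS t x Y _ hc]
    exact (dilL c).hasFDerivAt.comp_hasDerivWithinAt s (h.hasDerivWithinAt s hs)
  contDiffAt s hs := by
    have h1 : liftField nat A S (c⁻¹ * t) x (dil c Y) =
        dilL c ∘ liftField nat A S t x Y ∘ dilL c⁻¹ := by
      funext X
      simp only [Function.comp_apply, dilL_apply]
      rw [← liftField_dil hA hS t x Y _ hc, dil_dil_inv hc]
    have h2 : ∀ c : ℝ, ContDiff ℝ 1 (fun X : Tot V => dilL c X) := fun c => by fun_prop
    have h3 : dilL c⁻¹ (dil c (ζ s)) = ζ s := dil_inv_dil hc _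
    rw [h1]
    refine (h2 c).contDiffAt.comp _ (ContDiffAt.comp _ ?_ (h2 c⁻¹).contDiffAt)
    rw [h3]
    exact h.contDiffAt s hs

end Canonical

end LiftData

/-! ### Local solution of the lifting problem on the manifold -/

section LocalLift

open Set Metric

/-- Provides curves on an open interval around `[0, 1]`, the form in which `flowOne_eq_of_chartRep`
takes them. -/
lemma exists_Ioo_smul_mem_ball {V : Type*} [NormedAddCommGroup V] [NormedSpace ℝ V] {X : V}
    {r : ℝ} (hX : X ∈ ball (0 : V) r) :
    ∃ δ : ℝ, 0 < δ ∧ ∀ s ∈ Ioo (-δ) (1 + δ), s • X ∈ ball (0 : V) r := by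
  rw [mem_ball_zero_iff] at hX
  have h1 : 0 < ‖X‖ + 1 := by positivity
  have hδ : 0 < (r - ‖X‖) / (‖X‖ + 1) := div_pos (sub_pos.2 hX) h1
  refine ⟨_, hδ, fun s hs => ?_⟩
  rw [mem_ball_zero_iff, norm_smul, Real.norm_eq_abs]
  have h2 : |s| ≤ 1 + (r - ‖X‖) / (‖X‖ + 1) := abs_le.2 ⟨by linarith [hs.1], hs.2.le⟩
  have h3 : (r - ‖X‖) / (‖X‖ + 1) * (‖X‖ + 1) = r - ‖X‖ := div_mul_cancel₀ _ h1.ne'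
  nlinarith [norm_nonneg X]

/-- If `R` is a right inverse of `L`, then `L' R` is invertible for `L'` near `L`. -/
lemma eventually_surjective {V W : Type*} [NormedAddCommGroup V] [NormedSpace ℝ V]
    [NormedAddCommGroup W] [NormedSpace ℝ W] [FiniteDimensional ℝ V] {L : W →L[ℝ] V}
    (hL : Function.Surjective L) : ∀ᶠ L' : W →L[ℝ] V in 𝓝 L, Function.Surjective L' := by
  have : CompleteSpace V := FiniteDimensional.complete ℝ V
  obtain ⟨R, hR⟩ := L.toLinearMap.exists_rightInverse_of_surjective
    (LinearMap.range_eq_top.2 hL)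
  let R' : V →L[ℝ] W := LinearMap.toContinuousLinearMap R
  have hLR : L.comp R' = 1 := by
    ext v
    exact congrArg (fun f => f v) hR
  have hc : Continuous fun L' : W →L[ℝ] V => L'.comp R' := by fun_prop
  have h1 : ∀ᶠ L' in 𝓝 L, IsUnit (L'.comp R' : V →L[ℝ] V) := by
    refine hc.continuousAt.eventually (p := IsUnit) ?_
    rw [show (fun L' : W →L[ℝ] V => L'.comp R') L = 1 from hLR]
    exact (Units.isOpen (R := V →L[ℝ] V)).mem_nhds isUnit_one
  filter_upwards [h1] with L' hL' v
  refine ⟨R' (Ring.inverse (L'.comp R') v), ?_⟩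
  have := congrArg (fun f => f v) (Ring.mul_inverse_cancel _ hL')
  exact this

variable {E : Type*} [NormedAddCommGroup E] [NormedSpace ℝ E] [FiniteDimensional ℝ E]
  {M : Type*} [TopologicalSpace M] [T2Space M] [ChartedSpace E M] [IsManifold 𝓘(ℝ, E) ∞ M]
  {N : ℕ} {V W : Fin N → Type*} [∀ i, NormedAddCommGroup (V i)] [∀ i, NormedSpace ℝ (V i)]
  [∀ i, NormedAddCommGroup (W i)] [∀ i, NormedSpace ℝ (W i)]
  [∀ i, FiniteDimensional ℝ (V i)] [∀ i, FiniteDimensional ℝ (W i)] [CompleteSpace E]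
  {U : Set M} {nat : Tot V →ₗ[ℝ] VF E M} {natW : Tot W →ₗ[ℝ] VF E M}
  {A : M → Tot V →L[ℝ] Tot V →L[ℝ] Tot V} {S : M → Tot W →L[ℝ] Tot V} {x₀ : M}
  {Φ : Tot V × (E × ℝ) → E × ℝ} {T : Tot V × (E × ℝ) → Tot V →L[ℝ] Tot V}
  {Z : Tot W × Tot V × (E × ℝ) → Tot V} {r r' : ℝ}

section

variable (hl : IsLocalLift (chartField x₀ nat) (chartA x₀ A) (chartS x₀ S) (chartDom x₀ U)
    (extChartAt 𝓘(ℝ, E) x₀ x₀, 0) Φ T Z r r')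
include hl

lemma IsLocalLift.flow_snd {X : Tot V} (hX : X ∈ ball 0 r) {e : E × ℝ}
    (he : e ∈ ball (extChartAt 𝓘(ℝ, E) x₀ x₀, 0) r) : (Φ (X, e)).2 = e.2 := by
  have hd : ∀ s ∈ Icc (0 : ℝ) 1, HasDerivAt (fun s : ℝ => (Φ (s • X, e)).2) 0 s := fun s hs =>
    (hl.flow.hasDerivAt e he X s (smul_mem_ball_zero hX hs)).snd
  have := constant_of_has_deriv_right_zero
    (fun s hs => (hd s hs).continuousAt.continuousWithinAt)
    (fun s hs => (hd s (Ico_subset_Icc_self hs)).hasDerivWithinAt) 1 (right_mem_Icc.2 zero_le_one)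
  simpa [hl.flow.zero_left e he] using this

/-- Uniqueness of integral curves identifies the flow in the chart with the chart-free one. The
transport and the lifted field are then identified as well. -/
lemma IsLocalLift.flowPt_eq (hc : ∀ X, CompactlySupported (nat X)) {X : Tot V}
    (hX : X ∈ ball 0 r) {e : E × ℝ} (he : e ∈ ball (extChartAt 𝓘(ℝ, E) x₀ x₀, 0) r) :
    flowPt nat e.2 ((extChartAt 𝓘(ℝ, E) x₀).symm e.1) X =
      (extChartAt 𝓘(ℝ, E) x₀).symm (Φ (X, e)).1 := by
  obtain ⟨δ, hδ, hs⟩ := exists_Ioo_smul_mem_ball hX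
  have := flowOne_eq_of_chartRep (hc (dil e.2 X)) (x₀ := x₀) (γ := fun s => (Φ (s • X, e)).1)
    (neg_lt_zero.2 hδ) (lt_add_of_pos_right 1 hδ)
    (fun s h => (hl.flow.mem _ (hs s h) e he).1.1) (fun s h => ?_)
  · simpa [hl.flow.zero_left e he, flowPt] using this
  · have h1 := (hl.flow.hasDerivAt e he X s (hs s h)).fst
    rw [chartField_apply, hl.flow_snd (hs s h) he] at h1
    exact h1

lemma IsLocalLift.isTransportAt (hc : ∀ X, CompactlySupported (nat X)) {X : Tot V}
    (hX : X ∈ ball 0 r) {e : E × ℝ} (he : e ∈ ball (extChartAt 𝓘(ℝ, E) x₀ x₀, 0) r) :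
    IsTransportAt nat A e.2 ((extChartAt 𝓘(ℝ, E) x₀).symm e.1) X (T (X, e)) := by
  refine (hl.transport X hX e he).congr fun s hs => ?_
  have hs' := smul_mem_ball_zero hX hs
  simp only
  rw [hl.flowPt_eq hc hs' he, chartA, hl.flow_snd hs' he]

lemma IsLocalLift.liftField_eq (hc : ∀ X, CompactlySupported (nat X)) {X : Tot V}
    (hX : X ∈ ball 0 r) {e : E × ℝ} (he : e ∈ ball (extChartAt 𝓘(ℝ, E) x₀ x₀, 0) r) (Y : Tot W) :
    liftField nat A S e.2 ((extChartAt 𝓘(ℝ, E) x₀).symm e.1) Y X =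
      Ring.inverse (T (X, e)) (chartS x₀ S (Φ (X, e)) Y) := by
  rw [liftField, (hl.isTransportAt hc hX he).eq, hl.flowPt_eq hc hX he, chartS,
    hl.flow_snd hX he]

lemma IsLocalLift.isLiftCurve (h : IsLiftData U nat natW A S) {Y : Tot W} (hY : Y ∈ ball 0 r')
    {X : Tot V} (hX : X ∈ ball 0 r') {e : E × ℝ}
    (he : e ∈ ball (extChartAt 𝓘(ℝ, E) x₀ x₀, 0) r') :
    IsLiftCurve nat A S Y X ((extChartAt 𝓘(ℝ, E) x₀).symm e.1) e.2
      (fun s => Z (s • Y, X, e)) where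
  zero := by simp only [zero_smul, hl.zero_left X hX e he]
  exists_transport s hs := ⟨_, hl.isTransportAt h.compact
    (hl.mem _ (smul_mem_ball_zero hY hs) X hX e he) (ball_subset_ball hl.le he)⟩
  hasDerivWithinAt s hs := by
    have hs' := smul_mem_ball_zero hY hs
    rw [hl.liftField_eq h.compact (hl.mem _ hs' X hX e he) (ball_subset_ball hl.le he)]
    exact (hl.hasDerivAt X hX e he Y s hs').hasDerivWithinAt
  contDiffAt s hs := by
    have hm := hl.mem _ (smul_mem_ball_zero hY hs) X hX e he
    have he' := ball_subset_ball hl.le he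
    refine (hl.contDiffAt_inverse_apply (h.isFieldSystem x₀) hm he' Y).congr_of_eventuallyEq ?_
    filter_upwards [isOpen_ball.mem_nhds hm] with X' hX'
    exact hl.liftField_eq h.compact hX' he' Y

/-- By `hasDerivAt_flow` the end points along the lifted curve move with velocity `v (S Y)`. Undoing
the rescaling turns this into `nat (S (α_t Y))`, which is `natW (α_t Y)` on `U`. -/
lemma IsLocalLift.flowOne_flowPt (h : IsLiftData U nat natW A S) {Y : Tot W}
    (hY : Y ∈ ball 0 r') {X : Tot V} (hX : X ∈ ball 0 r') {e : E × ℝ}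
    (he : e ∈ ball (extChartAt 𝓘(ℝ, E) x₀ x₀, 0) r') :
    flowOne (natW (dil e.2 Y)) (flowPt nat e.2 ((extChartAt 𝓘(ℝ, E) x₀).symm e.1) X) =
      flowPt nat e.2 ((extChartAt 𝓘(ℝ, E) x₀).symm e.1) (Z (Y, X, e)) := by
  obtain ⟨δ, hδ, hs⟩ := exists_Ioo_smul_mem_ball hY
  have he' := ball_subset_ball hl.le he
  have := flowOne_eq_of_chartRep (h.compact_W (dil e.2 Y)) (x₀ := x₀)
    (γ := fun s => (Φ (Z (s • Y, X, e), e)).1) (neg_lt_zero.2 hδ) (lt_add_of_pos_right 1 hδ)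
    (fun s hs' => (hl.flow.mem _ (hl.mem _ (hs s hs') X hX e he) e he').1.1) (fun s hs' => ?_)
  · simp only [zero_smul, one_smul] at this
    rw [hl.zero_left X hX e he] at this
    rw [hl.flowPt_eq h.compact (ball_subset_ball hl.le hX) he',
      hl.flowPt_eq h.compact (hl.mem _ hY X hX e he) he', this]
  · have hm := hl.mem _ (hs s hs') X hX e he
    have h1 : HasDerivAt (fun s : ℝ => (Φ (Z (s • Y, X, e), e)).1) _ s :=
      (hl.hasDerivAt_flow hX he (hs s hs')).fst
    rw [chartField_apply, hl.flow_snd hm he'] at h1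
    refine h1.congr_deriv ?_
    have h2 : dil e.2 (chartS x₀ S (Φ (Z (s • Y, X, e), e)) Y) =
        S ((extChartAt 𝓘(ℝ, E) x₀).symm (Φ (Z (s • Y, X, e), e)).1) (dil e.2 Y) := by
      rw [chartS, hl.flow_snd hm he']
      exact dil_rescale (h.filtered_S _) _ _
    simp only [h2, chartRep]
    rw [h.comparison _ (hl.flow.mem _ hm e he').1.2]

lemma IsLocalLift.eq_rescale (h : IsLiftData U nat natW A S) {Y : Tot W}
    (hY : Y ∈ ball 0 r') {e : E × ℝ} (he : e ∈ ball (extChartAt 𝓘(ℝ, E) x₀ x₀, 0) r')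
    {B : Tot V} (hB : B ∈ ball 0 r) (hconst : ∀ s ∈ Icc (0 : ℝ) 1, rescale e.2
      (S (flowPt nat e.2 ((extChartAt 𝓘(ℝ, E) x₀).symm e.1) (s • B))) Y = B) :
    Z (Y, 0, e) = B := by
  refine hl.eq_of_const (h.isFieldSystem x₀) he hY hB fun s hs => ?_
  have hs' := smul_mem_ball_zero hB hs
  have he' := ball_subset_ball hl.le he
  rw [chartS, hl.flow_snd hs' he', ← hl.flowPt_eq h.compact hs' he', hconst s hs]

/-- At `X = 0` the transport is the identity, so the velocity of the lift at time 0 is the rescaled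
coefficient map itself, taken at scale 0. -/
lemma IsLocalLift.fderiv_zero (Y : Tot W) :
    fderiv ℝ Z (0, 0, (extChartAt 𝓘(ℝ, E) x₀ x₀, 0)) (Y, 0) = rescale 0 (S x₀) Y := by
  have h0 : (0 : Tot V) ∈ ball (0 : Tot V) r' := mem_ball_self hl.pos
  have hW0 : (0 : Tot W) ∈ ball (0 : Tot W) r' := mem_ball_self hl.pos
  have he : (extChartAt 𝓘(ℝ, E) x₀ x₀, (0 : ℝ)) ∈ ball (extChartAt 𝓘(ℝ, E) x₀ x₀, (0 : ℝ)) r' :=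
    mem_ball_self hl.pos
  have h0' := ball_subset_ball hl.le h0
  have he' := ball_subset_ball hl.le he
  have hdiff : DifferentiableAt ℝ Z (0, 0, (extChartAt 𝓘(ℝ, E) x₀ x₀, 0)) :=
    (hl.smooth_Z.contDiffAt ((isOpen_ball.prod (isOpen_ball.prod isOpen_ball)).mem_nhds
      ⟨hW0, h0, he⟩)).differentiableAt (by simp)
  have hline : HasDerivAt (fun s : ℝ => ((s • Y, 0, (extChartAt 𝓘(ℝ, E) x₀ x₀, 0)) :
      Tot W × Tot V × (E × ℝ))) (Y, 0) 0 := by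
    have h1 : HasDerivAt (fun s : ℝ => s • Y) Y 0 := by
      simpa using (hasDerivAt_id (0 : ℝ)).smul_const Y
    exact h1.prodMk (hasDerivAt_const _ _)
  have h1 := hl.hasDerivAt 0 h0 _ he Y 0 (by rwa [zero_smul])
  have h2 := HasFDerivAt.comp_hasDerivAt_of_eq (0 : ℝ) hdiff.hasFDerivAt hline (by simp)
  have h3 := h2.unique h1
  rw [h3, zero_smul, hl.zero_left 0 h0 _ he, hl.flow.zero_left _ he']
  have hT : T (0, (extChartAt 𝓘(ℝ, E) x₀ x₀, 0)) = 1 := by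
    ext1 B
    exact (hl.transport 0 h0' _ he').apply_self fun s _ => by simp
  rw [hT, Ring.inverse_one, chartS]
  simp

end

/-- The lift in a chart around `x₀`, at scale 0. By `fderiv_zero` the derivative in `Y` at the
origin is the graded part of `S x₀`; its surjectivity is an open condition. The bound `ε` allows the
whole curve to be kept where the identification with the Baker–Campbell–Hausdorff product holds. -/
theorem IsLiftData.exists_local (h : IsLiftData U nat natW A S) (hx₀ : x₀ ∈ U) {ε : ℝ}
    (hε : 0 < ε) (hsurj : Function.Surjective (rescale 0 (S x₀))) :
    ∃ (O : Set (Tot W × Tot V × M × ℝ)) (Z : Tot W × Tot V × M × ℝ → Tot V),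
      IsOpen O ∧ (0, 0, x₀, 0) ∈ O ∧
      ContMDiffOn (𝓘(ℝ, Tot W).prod (modelBU E V)) 𝓘(ℝ, Tot V) ∞ Z O ∧
      Z (0, 0, x₀, 0) = 0 ∧ ∀ Y X x t, (Y, X, x, t) ∈ O → x ∈ U ∧
        (∃ ζ, IsLiftCurve nat A S Y X x t ζ ∧ ζ 1 = Z (Y, X, x, t) ∧
          ∀ s ∈ Icc (0 : ℝ) 1, ζ s ∈ ball 0 ε) ∧
        (Y = 0 → Z (Y, X, x, t) = X) ∧
        (X = 0 → (∀ s ∈ Icc (0 : ℝ) 1, rescale t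
          (S (flowPt nat t x (s • rescale t (S x) Y))) Y = rescale t (S x) Y) →
            Z (Y, X, x, t) = rescale t (S x) Y) ∧
        flowOne (natW (dil t Y)) (flowPt nat t x X) = flowPt nat t x (Z (Y, X, x, t)) ∧
        DifferentiableAt ℝ (fun Y => Z (Y, X, x, t)) Y ∧
        Function.Surjective (fderiv ℝ (fun Y => Z (Y, X, x, t)) Y) := by
  obtain ⟨Φ, T, Z, r, r', hl⟩ := (h.isFieldSystem x₀).exists_isLocalLift (mem_chartDom hx₀ 0)
  set e₀ : E × ℝ := (extChartAt 𝓘(ℝ, E) x₀ x₀, 0) with he₀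
  have hmem : ((0, 0, e₀) : Tot W × Tot V × (E × ℝ)) ∈ ball 0 r' ×ˢ ball 0 r' ×ˢ ball e₀ r' :=
    ⟨mem_ball_self hl.pos, mem_ball_self hl.pos, mem_ball_self hl.pos⟩
  have hopen : IsOpen ((ball 0 r' ×ˢ ball 0 r' ×ˢ ball e₀ r') : Set (Tot W × Tot V × (E × ℝ))) :=
    isOpen_ball.prod (isOpen_ball.prod isOpen_ball)
  have hdom := (isOpen_chartDom (E := E) x₀ h.isOpen).mem_nhds (mem_chartDom (E := E) hx₀ 0)
  have hZ0 : Z (0, 0, e₀) = 0 := hl.zero_left 0 hmem.2.1 e₀ hmem.2.2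
  have hZc : ContinuousAt Z (0, 0, e₀) := hl.smooth_Z.continuousOn.continuousAt
    (hopen.mem_nhds hmem)
  have e1 : ∀ᶠ w in 𝓝 ((0, 0, e₀) : Tot W × Tot V × (E × ℝ)), Z w ∈ ball 0 ε := by
    refine hZc.eventually_mem ?_
    rw [hZ0]
    exact ball_mem_nhds _ hε
  have e2 : ∀ᶠ w in 𝓝 ((0, 0, e₀) : Tot W × Tot V × (E × ℝ)),
      chartS x₀ S w.2.2 w.1 ∈ ball 0 r := by
    have hSc : ContinuousAt (chartS (E := E) x₀ S) e₀ :=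
      (contDiffOn_chartS (E := E) h.smooth_S x₀ U).continuousOn.continuousAt hdom
    have h1 : ContinuousAt (fun w : Tot W × Tot V × (E × ℝ) => chartS (E := E) x₀ S w.2.2)
        (0, 0, e₀) := ContinuousAt.comp (f := fun w : Tot W × Tot V × (E × ℝ) => w.2.2)
          (x := (0, 0, e₀)) hSc (by fun_prop)
    have h2 : ContinuousAt (fun w : Tot W × Tot V × (E × ℝ) => chartS (E := E) x₀ S w.2.2 w.1)
        (0, 0, e₀) := h1.clm_apply (by fun_prop)
    refine h2.eventually_mem ?_
    simpa using ball_mem_nhds (0 : Tot V) (hl.pos.trans_le hl.le)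
  have e3 : ∀ᶠ w in 𝓝 ((0, 0, e₀) : Tot W × Tot V × (E × ℝ)),
      Function.Surjective ((fderiv ℝ Z w).comp (ContinuousLinearMap.inl ℝ _ _)) := by
    have hc : ContinuousAt (fun w => (fderiv ℝ Z w).comp
        (ContinuousLinearMap.inl ℝ (Tot W) (Tot V × (E × ℝ)))) (0, 0, e₀) := by
      have := (hl.smooth_Z.contDiffAt (hopen.mem_nhds hmem)).fderiv_right (m := 0) (by simp)
      exact this.continuousAt.clm_comp continuousAt_const
    refine hc.eventually (p := fun L' : Tot W →L[ℝ] Tot V => Function.Surjective L')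
      (eventually_surjective fun v => ?_)
    obtain ⟨Y, hY⟩ := hsurj v
    exact ⟨Y, (hl.fderiv_zero Y).trans hY⟩
  obtain ⟨ρ, hρ, hball⟩ := Metric.eventually_nhds_iff_ball.1
    (e1.and (e2.and (e3.and (hopen.mem_nhds hmem))))
  let c : Tot W × Tot V × M × ℝ → Tot W × Tot V × (E × ℝ) := fun q =>
    (q.1, q.2.1, (extChartAt 𝓘(ℝ, E) x₀ q.2.2.1, q.2.2.2))
  let Src : Set (Tot W × Tot V × M × ℝ) := {q | q.2.2.1 ∈ (extChartAt 𝓘(ℝ, E) x₀).source}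
  have hSrc : IsOpen Src := (isOpen_extChartAt_source x₀).preimage
    (continuous_fst.comp (continuous_snd.comp continuous_snd))
  have hc : ContMDiffOn (𝓘(ℝ, Tot W).prod (modelBU E V)) 𝓘(ℝ, Tot W × Tot V × (E × ℝ)) ∞ c
      Src := by
    have p1 : ContMDiffOn (𝓘(ℝ, Tot W).prod (modelBU E V)) 𝓘(ℝ, Tot W) ∞
      (fun q : Tot W × Tot V × M × ℝ => q.1) Src := contMDiff_fst.contMDiffOn
    have p2 : ContMDiffOn (𝓘(ℝ, Tot W).prod (modelBU E V)) 𝓘(ℝ, Tot V) ∞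
      (fun q : Tot W × Tot V × M × ℝ => q.2.1) Src :=
      (contMDiff_fst.comp contMDiff_snd).contMDiffOn
    have p3 : ContMDiffOn (𝓘(ℝ, Tot W).prod (modelBU E V)) 𝓘(ℝ, E) ∞
      (fun q : Tot W × Tot V × M × ℝ => q.2.2.1) Src :=
      (contMDiff_fst.comp (contMDiff_snd.comp contMDiff_snd)).contMDiffOn
    have p4 : ContMDiffOn (𝓘(ℝ, Tot W).prod (modelBU E V)) 𝓘(ℝ, ℝ) ∞
      (fun q : Tot W × Tot V × M × ℝ => q.2.2.2) Src :=
      (contMDiff_snd.comp (contMDiff_snd.comp contMDiff_snd)).contMDiffOn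
    have p5 : ContMDiffOn 𝓘(ℝ, E) 𝓘(ℝ, E) ∞ (extChartAt 𝓘(ℝ, E) x₀)
        (extChartAt 𝓘(ℝ, E) x₀).source := by
      rw [extChartAt_source]
      exact contMDiffOn_extChartAt
    exact p1.prodMk_space (p2.prodMk_space ((p5.comp p3 fun q hq => hq).prodMk_space p4))
  refine ⟨Src ∩ c ⁻¹' ball (0, 0, e₀) ρ, Z ∘ c, hc.continuousOn.isOpen_inter_preimage hSrc
    isOpen_ball, ⟨mem_extChartAt_source x₀, mem_ball_self hρ⟩, ?_, hZ0, ?_⟩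
  · have hZs : ContMDiffOn 𝓘(ℝ, Tot W × Tot V × (E × ℝ)) 𝓘(ℝ, Tot V) ∞ Z (ball (0, 0, e₀) ρ) :=
      (hl.smooth_Z.mono fun w hw => (hball w hw).2.2.2).contMDiffOn
    exact hZs.comp (hc.mono inter_subset_left) fun q hq => hq.2
  · rintro Y X x t ⟨hx, hq⟩
    have hx' : (extChartAt 𝓘(ℝ, E) x₀).symm (extChartAt 𝓘(ℝ, E) x₀ x) = x :=
      (extChartAt 𝓘(ℝ, E) x₀).left_inv hx
    obtain ⟨-, hS, hF, hY, hX, he⟩ := hball _ hq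
    have hbr : ∀ s ∈ Icc (0 : ℝ) 1, c (s • Y, X, x, t) ∈ ball (0, 0, e₀) ρ := by
      intro s hs
      have hq' : c (Y, X, x, t) ∈ ball (0, 0, e₀) ρ := hq
      rw [← ball_prod_same] at hq' ⊢
      exact ⟨smul_mem_ball_zero hq'.1 hs, hq'.2⟩
    have hcd : ContDiffAt ℝ ∞ Z (c (Y, X, x, t)) :=
      hl.smooth_Z.contDiffAt (hopen.mem_nhds ⟨hY, hX, he⟩)
    have hι : HasFDerivAt (fun Y => c (Y, X, x, t)) (ContinuousLinearMap.inl ℝ _ _) Y :=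
      hasFDerivAt_prodMk_left Y (X, (extChartAt 𝓘(ℝ, E) x₀ x, t))
    have hfd : HasFDerivAt (fun Y => (Z ∘ c) (Y, X, x, t))
        ((fderiv ℝ Z (c (Y, X, x, t))).comp (ContinuousLinearMap.inl ℝ _ _)) Y :=
      HasFDerivAt.comp Y (f := fun Y => c (Y, X, x, t))
        (hcd.differentiableAt (by simp)).hasFDerivAt hι
    refine ⟨?_, ⟨fun s => Z (s • Y, X, (extChartAt 𝓘(ℝ, E) x₀ x, t)), ?_, ?_, ?_⟩, ?_, ?_, ?_,
      hfd.differentiableAt, ?_⟩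
    · have := (hl.flow.mem 0 (mem_ball_self (hl.pos.trans_le hl.le)) _
        (ball_subset_ball hl.le he))
      rw [hl.flow.zero_left _ (ball_subset_ball hl.le he)] at this
      exact hx' ▸ this.1.2
    · have := hl.isLiftCurve h hY hX he
      simp only [c, hx'] at this
      exact this
    · simp only [one_smul]
      rfl
    · exact fun s hs => (hball _ (hbr s hs)).1
    · rintro rfl
      exact hl.zero_left X hX _ he
    · rintro rfl hconst
      refine hl.eq_rescale h hY he ?_ ?_
      · have := hS
        simp only [c, chartS, hx'] at this
        exact this
      · simp only [c, hx']
        exact hconst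
    · have := hl.flowOne_flowPt h hY hX he
      simp only [c, hx'] at this
      exact this
    · rw [hfd.fderiv]
      exact hF

end LocalLift

/-! ### Gluing local submersions along a single-valued relation -/

section Gluing

open Set

section Abstract

variable {E₁ H₁ P E₂ H₂ Q : Type*}
  [NormedAddCommGroup E₁] [NormedSpace ℝ E₁] [TopologicalSpace H₁]
  [TopologicalSpace P] [ChartedSpace H₁ P]
  [NormedAddCommGroup E₂] [NormedSpace ℝ E₂] [TopologicalSpace H₂]
  [TopologicalSpace Q] [ChartedSpace H₂ Q]
  (I : ModelWithCorners ℝ E₁ H₁) (J : ModelWithCorners ℝ E₂ H₂)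

/-- Near `q`, the relation `R` contains the graph of a submersion. -/
def HasLocalSubmersion (R : P → Q → Prop) (q : P) : Prop :=
  ∃ (O : Set P) (ψ : P → Q), IsOpen O ∧ q ∈ O ∧ ContMDiffOn I J ∞ ψ O ∧
    ∀ q' ∈ O, R q' (ψ q') ∧ Function.Surjective (mfderiv I J ψ q')

variable {I J}

lemma isOpen_setOf_hasLocalSubmersion (R : P → Q → Prop) :
    IsOpen {q | HasLocalSubmersion I J R q} :=
  isOpen_iff_forall_mem_open.2 fun _ ⟨O, ψ, hO, hq, h⟩ =>
    ⟨O, fun _ hq' => ⟨O, ψ, hO, hq', h⟩, hO, hq⟩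

lemma surjective_mfderiv_of_leftInverse {f g : P → P} (hf : MDifferentiable I I f)
    (hg : MDifferentiable I I g) (hfg : ∀ q, f (g q) = q) (hgf : ∀ q, g (f q) = q) (q : P) :
    Function.Surjective (mfderiv I I f q) := by
  have h1 : HasMFDerivAt I I (f ∘ g) (f q)
      ((mfderiv I I f (g (f q))).comp (mfderiv I I g (f q))) :=
    (hf _).hasMFDerivAt.comp _ (hg _).hasMFDerivAt
  have h2 : f ∘ g = id := funext hfg
  rw [h2, hgf] at h1
  intro v
  refine ⟨mfderiv I I g (f q) v, ?_⟩
  have := hasMFDerivAt_unique h1 (hasMFDerivAt_id (f q))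
  exact congrArg (fun L => L v) this

/-- If `ψ` is a local solution near `q`, then `k ∘ ψ ∘ g` is one near `f q`. -/
lemma HasLocalSubmersion.act {R : P → Q → Prop} {q : P} (h : HasLocalSubmersion I J R q)
    {f g : P → P} {k l : Q → Q} (hf : ContMDiff I I ∞ f) (hg : ContMDiff I I ∞ g)
    (hk : ContMDiff J J ∞ k) (hl : ContMDiff J J ∞ l)
    (hfg : ∀ q, f (g q) = q) (hgf : ∀ q, g (f q) = q)
    (hkl : ∀ q, k (l q) = q) (hlk : ∀ q, l (k q) = q)
    (hR : ∀ q u, R q u → R (f q) (k u)) : HasLocalSubmersion I J R (f q) := by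
  obtain ⟨O, ψ, hO, hq, hψ, h⟩ := h
  refine ⟨g ⁻¹' O, fun q => k (ψ (g q)), hO.preimage hg.continuous, by rwa [mem_preimage, hgf],
    hk.comp_contMDiffOn (hψ.comp hg.contMDiffOn fun q hq => hq), fun q' hq' => ⟨?_, ?_⟩⟩
  · have := hR _ _ (h _ hq').1
    rwa [hfg] at this
  · have h1 : MDifferentiableAt I J ψ (g q') :=
      ((hψ _ hq').contMDiffAt (hO.mem_nhds hq')).mdifferentiableAt (by simp)
    have h2 : HasMFDerivAt I J (fun q => k (ψ (g q))) q'
        ((mfderiv J J k (ψ (g q'))).comp ((mfderiv I J ψ (g q')).comp (mfderiv I I g q'))) :=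
      HasMFDerivAt.comp q' (f := fun q => ψ (g q))
        ((hk.mdifferentiable (by simp)) _).hasMFDerivAt
        (HasMFDerivAt.comp q' (f := g) h1.hasMFDerivAt
          ((hg.mdifferentiable (by simp)) _).hasMFDerivAt)
    rw [h2.mfderiv]
    exact (surjective_mfderiv_of_leftInverse (hk.mdifferentiable (by simp))
      (hl.mdifferentiable (by simp)) hkl hlk _).comp ((h _ hq').2.comp
      (surjective_mfderiv_of_leftInverse (hg.mdifferentiable (by simp))
        (hf.mdifferentiable (by simp)) hgf hfg _))

/-- Local submersions with graph in a single valued relation are the restrictions of a global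
one. -/
theorem exists_isSubmersionOn {R : P → Q → Prop} (hR : ∀ q u u', R q u → R q u' → u = u')
    {H : Set P} (hH : ∀ q ∈ H, UniqueMDiffWithinAt I H q) (u₀ : Q) :
    ∃ φ : P → Q, (∀ q, HasLocalSubmersion I J R q → R q (φ q)) ∧
      IsSubmersionOn I J φ ({q | HasLocalSubmersion I J R q} ∩ H) := by
  classical
  -- `u₀` is a junk value. Where `R` has a solution, single-valuedness forces `φ` to agree with
  -- every local one.
  let φ : P → Q := fun q => if h : ∃ u, R q u then h.choose else u₀
  have hφ : ∀ q u, R q u → φ q = u := fun q u hu => by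
    have h : ∃ u, R q u := ⟨u, hu⟩
    simp only [φ, dif_pos h]
    exact hR _ _ _ h.choose_spec hu
  have hopen := isOpen_setOf_hasLocalSubmersion (I := I) (J := J) R
  have key : ∀ q, HasLocalSubmersion I J R q → R q (φ q) ∧ ContMDiffAt I J ∞ φ q ∧
      Function.Surjective (mfderiv I J φ q) := by
    rintro q ⟨O, ψ, hO, hq, hψ, h⟩
    have heq : φ =ᶠ[𝓝 q] ψ := by
      filter_upwards [hO.mem_nhds hq] with q' hq' using hφ _ _ (h q' hq').1
    refine ⟨heq.self_of_nhds ▸ (h q hq).1, (hψ.contMDiffAt (hO.mem_nhds hq)).congr_of_eventuallyEq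
      heq, ?_⟩
    intro v
    have h1 : HasMFDerivAt I J φ q (mfderiv I J ψ q) :=
      ((hψ.contMDiffAt (hO.mem_nhds hq)).mdifferentiableAt
        (by simp)).hasMFDerivAt.congr_of_eventuallyEq heq
    obtain ⟨w, hw⟩ := (h q hq).2 v
    exact ⟨w, by rw [h1.mfderiv]; exact hw⟩
  refine ⟨φ, fun q hq => (key q hq).1, fun q hq => (key q hq.1).2.1.contMDiffWithinAt,
    fun q hq => ?_⟩
  -- Local solutions are smooth across the boundary `t = 0`, so the differential within `H` is the
  -- full differential.
  have hu : UniqueMDiffWithinAt I ({q | HasLocalSubmersion I J R q} ∩ H) q := by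
    rw [inter_comm]
    exact (hH q hq.2).inter (hopen.mem_nhds hq.1)
  rw [mfderivWithin_eq_mfderiv hu ((key q hq.1).2.1.mdifferentiableAt (by simp))]
  exact (key q hq.1).2.2

/-- The differential is block triangular: solve for the second component through `π`, then correct
the first one by varying `Y` alone. -/
lemma surjective_mfderiv_prodMk {G G' : Type*} [NormedAddCommGroup G] [NormedSpace ℝ G]
    [NormedAddCommGroup G'] [NormedSpace ℝ G'] {h : G × P → G'} {π : P → Q} {q : G × P}
    (hh : MDifferentiableAt (𝓘(ℝ, G).prod I) 𝓘(ℝ, G') h q)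
    (hπ : MDifferentiableAt I J π q.2) (hπs : Function.Surjective (mfderiv I J π q.2))
    (hs : Function.Surjective (fderiv ℝ (fun Y => h (Y, q.2)) q.1)) :
    Function.Surjective
      (mfderiv (𝓘(ℝ, G).prod I) (𝓘(ℝ, G').prod J) (fun q => (h q, π q.2)) q) := by
  have h1 : HasMFDerivAt (𝓘(ℝ, G).prod I) J (fun q : G × P => π q.2) q
      ((mfderiv I J π q.2).comp (ContinuousLinearMap.snd ℝ (TangentSpace 𝓘(ℝ, G) q.1)
        (TangentSpace I q.2))) :=
    HasMFDerivAt.comp q (f := Prod.snd) hπ.hasMFDerivAt (hasMFDerivAt_snd q)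
  have h2 := hh.hasMFDerivAt.prodMk h1
  rw [h2.mfderiv]
  rintro ⟨w, v⟩
  obtain ⟨β, hβ⟩ : ∃ β : E₁, mfderiv I J π q.2 β = v := hπs v
  let L : E₁ →L[ℝ] G' := mfderiv I 𝓘(ℝ, G') (fun z => h (q.1, z)) q.2
  obtain ⟨γ, hγ⟩ := hs (w - L β)
  refine ⟨(γ, β), Prod.ext ?_ hβ⟩
  have h3 := mfderiv_prod_eq_add_apply (v := (γ, β)) hh
  rw [mfderiv_eq_fderiv] at h3
  refine h3.trans ?_
  change fderiv ℝ (fun Y => h (Y, q.2)) q.1 γ + L β = w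
  rw [hγ, sub_add_cancel]

end Abstract

section Concrete

variable {E : Type*} [NormedAddCommGroup E] [NormedSpace ℝ E]
  {M : Type*} [TopologicalSpace M] [ChartedSpace E M]
  {N : ℕ} {V : Fin N → Type*} [∀ i, NormedAddCommGroup (V i)] [∀ i, NormedSpace ℝ (V i)]

lemma contMDiff_act (c : ℝ) :
    ContMDiff (modelBU E V) (modelBU E V) ∞ (act c : Tot V × M × ℝ → Tot V × M × ℝ) := by
  have h1 : ContDiff ℝ ∞ (fun X : Tot V => dilL c X) := by fun_prop
  have h2 : ContDiff ℝ ∞ (fun t : ℝ => c⁻¹ * t) := by fun_prop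
  exact (h1.contMDiff.comp contMDiff_fst).prodMk ((contMDiff_fst.comp contMDiff_snd).prodMk
    (h2.contMDiff.comp (contMDiff_snd.comp contMDiff_snd)))

lemma contMDiff_act₂ (c : ℝ) :
    ContMDiff (𝓘(ℝ, Tot V).prod (modelBU E V)) (𝓘(ℝ, Tot V).prod (modelBU E V)) ∞
      (act₂ c : Tot V × Tot V × M × ℝ → Tot V × Tot V × M × ℝ) := by
  have h1 : ContDiff ℝ ∞ (fun X : Tot V => dilL c X) := by fun_prop
  exact (h1.contMDiff.comp contMDiff_fst).prodMk ((contMDiff_act c).comp contMDiff_snd)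

lemma act_inv_act {c : ℝ} (hc : c ≠ 0) (q : Tot V × M × ℝ) : act c⁻¹ (act c q) = q := by
  simp only [act, dil_inv_dil hc, inv_inv, mul_inv_cancel_left₀ hc]

lemma act_act_inv {c : ℝ} (hc : c ≠ 0) (q : Tot V × M × ℝ) : act c (act c⁻¹ q) = q := by
  simpa using act_inv_act (inv_ne_zero hc) q

lemma act₂_inv_act₂ {c : ℝ} (hc : c ≠ 0) (q : Tot V × Tot V × M × ℝ) :
    act₂ c⁻¹ (act₂ c q) = q := by
  simp only [act₂, dil_inv_dil hc, inv_inv, mul_inv_cancel_left₀ hc]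

lemma act₂_act₂_inv {c : ℝ} (hc : c ≠ 0) (q : Tot V × Tot V × M × ℝ) :
    act₂ c (act₂ c⁻¹ q) = q := by
  simpa using act₂_inv_act₂ (inv_ne_zero hc) q

lemma halfSpace_eq (U : Set M) : halfSpace V U = univ ×ˢ U ×ˢ Ici 0 := by
  ext ⟨X, x, t⟩
  simp [halfSpace]

lemma halfSpace₂_eq (U : Set M) : halfSpace₂ V U = univ ×ˢ univ ×ˢ U ×ˢ Ici 0 := by
  ext ⟨Y, X, x, t⟩
  simp [halfSpace₂]

lemma uniqueMDiffOn_halfSpace {U : Set M} (hU : IsOpen U) :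
    UniqueMDiffOn (modelBU E V) (halfSpace V U) := by
  rw [halfSpace_eq]
  exact uniqueMDiffOn_univ.prod (hU.uniqueMDiffOn.prod (uniqueDiffOn_Ici 0).uniqueMDiffOn)

lemma uniqueMDiffOn_halfSpace₂ {U : Set M} (hU : IsOpen U) :
    UniqueMDiffOn (𝓘(ℝ, Tot V).prod (modelBU E V)) (halfSpace₂ V U) := by
  have h : halfSpace₂ V U = univ ×ˢ halfSpace V U := by rw [halfSpace_eq, halfSpace₂_eq]
  rw [h]
  exact uniqueMDiffOn_univ.prod (uniqueMDiffOn_halfSpace hU)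

/-- Dilations with `c → 0` keep `t = 0` and contract the fibre over `(x, 0)` to its origin. An
invariant open set containing the origin therefore contains the fibre. -/
lemma exists_act_mem {O : Set (Tot V × M × ℝ)} (hO : IsOpen O) {x : M} (hx : (0, x, 0) ∈ O)
    (X : Tot V) : ∃ c : ℝ, 0 < c ∧ act c (X, x, 0) ∈ O := by
  have hc : Continuous fun c : ℝ => ((dilL c X, x, 0) : Tot V × M × ℝ) := by
    have : Continuous fun c : ℝ => (dilL c : Tot V →L[ℝ] Tot V) := contDiff_dilL.continuous
    fun_prop
  have h0 : ∀ᶠ c in 𝓝[>] (0 : ℝ), ((dilL c X, x, 0) : Tot V × M × ℝ) ∈ O := by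
    refine nhdsWithin_le_nhds (hc.continuousAt.eventually_mem (hO.mem_nhds ?_))
    simpa using hx
  obtain ⟨c, h1, h2⟩ := (h0.and self_mem_nhdsWithin).exists
  exact ⟨c, h2, by simpa [act] using h1⟩

lemma exists_act₂_mem {O : Set (Tot V × Tot V × M × ℝ)} (hO : IsOpen O) {x : M}
    (hx : (0, 0, x, 0) ∈ O) (Y X : Tot V) : ∃ c : ℝ, 0 < c ∧ act₂ c (Y, X, x, 0) ∈ O := by
  have hc : Continuous fun c : ℝ => ((dilL c Y, dilL c X, x, 0) : Tot V × Tot V × M × ℝ) := by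
    have : Continuous fun c : ℝ => (dilL c : Tot V →L[ℝ] Tot V) := contDiff_dilL.continuous
    fun_prop
  have h0 : ∀ᶠ c in 𝓝[>] (0 : ℝ), ((dilL c Y, dilL c X, x, 0) : Tot V × Tot V × M × ℝ) ∈ O := by
    refine nhdsWithin_le_nhds (hc.continuousAt.eventually_mem (hO.mem_nhds ?_))
    simpa using hx
  obtain ⟨c, h1, h2⟩ := (h0.and self_mem_nhdsWithin).exists
  exact ⟨c, h2, by simpa [act₂] using h1⟩

end Concrete

end Gluing

/-! ### The lifting relation -/

section Relation

open Set Metric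

variable {E : Type*} [NormedAddCommGroup E] [NormedSpace ℝ E]
  {M : Type*} [TopologicalSpace M] [ChartedSpace E M] [IsManifold 𝓘(ℝ, E) ∞ M]
  {N : ℕ} {V W : Fin N → Type*} [∀ i, NormedAddCommGroup (V i)] [∀ i, NormedSpace ℝ (V i)]
  [∀ i, NormedAddCommGroup (W i)] [∀ i, NormedSpace ℝ (W i)]

/-- `exp(natW (α_t Y)) exp(nat (α_t X)) x = exp(nat (α_t Z)) x`, and `Z` is obtained from `X` by
lifting the flow of `natW (α_t Y)`. -/
structure IsLift (U : Set M) (nat : Tot V →ₗ[ℝ] VF E M) (natW : Tot W →ₗ[ℝ] VF E M)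
    (A : M → Tot V →L[ℝ] Tot V →L[ℝ] Tot V) (S : M → Tot W →L[ℝ] Tot V)
    (Y : Tot W) (X : Tot V) (x : M) (t : ℝ) (Z : Tot V) : Prop where
  mem : x ∈ U
  exists_curve : ∃ ζ, IsLiftCurve nat A S Y X x t ζ ∧ ζ 1 = Z
  flow : flowOne (natW (dil t Y)) (flowPt nat t x X) = flowPt nat t x Z

variable {U : Set M} {nat : Tot V →ₗ[ℝ] VF E M} {natW : Tot W →ₗ[ℝ] VF E M}
  {A : M → Tot V →L[ℝ] Tot V →L[ℝ] Tot V} {S : M → Tot W →L[ℝ] Tot V}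
  {Y : Tot W} {X Z Z' : Tot V} {x : M} {t : ℝ}

lemma IsLift.unique (h : IsLift U nat natW A S Y X x t Z)
    (h' : IsLift U nat natW A S Y X x t Z') : Z = Z' := by
  obtain ⟨ζ, hζ, rfl⟩ := h.exists_curve
  obtain ⟨ζ', hζ', rfl⟩ := h'.exists_curve
  exact hζ.unique hζ'

lemma IsLift.dilate (h : IsLift U nat natW A S Y X x t Z) (hA : ∀ x, IsFilteredBilin (A x))
    (hS : ∀ x, IsFilteredMap (S x)) {c : ℝ} (hc : c ≠ 0) :
    IsLift U nat natW A S (dil c Y) (dil c X) x (c⁻¹ * t) (dil c Z) where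
  mem := h.mem
  exists_curve := by
    obtain ⟨ζ, hζ, rfl⟩ := h.exists_curve
    exact ⟨_, hζ.dilate hA hS hc, rfl⟩
  flow := by
    rw [flowPt_dil hc, flowPt_dil hc, ← h.flow, dil_dil, mul_right_comm, inv_mul_cancel₀ hc,
      one_mul]

lemma GradedBasis.compactlySupported {F : FilteredFoliation E M N} (b : GradedBasis F V)
    (X : Tot V) : CompactlySupported (b.nat X) := by
  refine (F.distribution N).compactlySupported _ ?_
  rw [← sum_homProj X, map_sum]
  exact Submodule.sum_mem _ fun i _ => F.mono i.2 (b.nat_mem i (X i))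

end Relation

/-! ### The pseudo group law of a graded Lie basis -/

section PseudoGroup

open Set Metric

variable {E : Type*} [NormedAddCommGroup E] [NormedSpace ℝ E] [FiniteDimensional ℝ E]
  {M : Type*} [TopologicalSpace M] [T2Space M] [ChartedSpace E M] [IsManifold 𝓘(ℝ, E) ∞ M]
  {N : ℕ} {V : Fin N → Type*} [∀ i, NormedAddCommGroup (V i)] [∀ i, NormedSpace ℝ (V i)]
  [∀ i, FiniteDimensional ℝ (V i)] {F : FilteredFoliation E M N}

namespace GradedLieBasis

variable (g : GradedLieBasis F V)

/-- The relation whose graph is the product of the pseudo group. -/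
def IsProduct (A : M → Tot V →L[ℝ] Tot V →L[ℝ] Tot V) (q : Tot V × Tot V × M × ℝ)
    (u : Tot V × M × ℝ) : Prop :=
  -- The first two clauses already determine `u`. The others are listed so that the glued map
  -- inherits them. Membership in `g.dom` is asked for `t ≥ 0` only, since local solutions extend to
  -- negative `t`.
  u.2 = q.2.2 ∧ IsLift g.base g.nat g.nat A (fun _ => ContinuousLinearMap.id ℝ (Tot V))
    q.1 q.2.1 q.2.2.1 q.2.2.2 u.1 ∧ (0 ≤ q.2.2.2 → u ∈ g.dom) ∧
    (q.2.2.2 = 0 → u.1 = bch N g.bracket q.1 q.2.1) ∧ (q.1 = 0 → u.1 = q.2.1) ∧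
    (q.2.1 = 0 → u.1 = q.1)

variable {g} {A : M → Tot V →L[ℝ] Tot V →L[ℝ] Tot V}

lemma IsProduct.unique {q : Tot V × Tot V × M × ℝ} {u u' : Tot V × M × ℝ}
    (h : g.IsProduct A q u) (h' : g.IsProduct A q u') : u = u' :=
  Prod.ext (h.2.1.unique h'.2.1) (h.1.trans h'.1.symm)

lemma isFilteredMap_id : IsFilteredMap (ContinuousLinearMap.id ℝ (Tot V)) := by
  intro i k Y hik
  simp [homProj_apply, Pi.single_eq_of_ne (show k ≠ i by rintro rfl; omega)]

lemma IsProduct.act {q : Tot V × Tot V × M × ℝ} {u : Tot V × M × ℝ} (h : g.IsProduct A q u)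
    (hA : ∀ x, IsFilteredBilin (A x)) {c : ℝ} (hc : 0 < c) :
    g.IsProduct A (act₂ c q) (FilteredFol.act c u) := by
  obtain ⟨h1, h2, h3, h4, h5, h6⟩ := h
  have h0 : ∀ X : Tot V, dil c X = 0 → X = 0 := fun X hX => by
    rw [← dil_inv_dil hc.ne' X, hX, dil_zero_right]
  refine ⟨?_, h2.dilate hA (fun _ => isFilteredMap_id) hc.ne', fun ht => g.act_mem c hc _
    (h3 ?_), fun ht => ?_, fun hY => ?_, fun hX => ?_⟩
  · simp only [FilteredFol.act, act₂, h1]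
  · exact nonneg_of_mul_nonneg_right ht (inv_pos.2 hc)
  · have ht' : q.2.2.2 = 0 := (mul_eq_zero.1 ht).resolve_left (inv_ne_zero hc.ne')
    simp only [FilteredFol.act, act₂]
    rw [h4 ht', g.isGradedLieBracket.bch_dil]
  · exact congrArg (dil c) (h5 (h0 _ hY))
  · exact congrArg (dil c) (h6 (h0 _ hX))

lemma isFilteredBilin_bracket (i j k : Fin N) (X C : Tot V) (h : wt i + wt j < wt k) :
    g.bracket (homProj i X) (homProj j C) k = 0 := by
  rw [homProj_apply, homProj_apply]
  exact g.isGradedLieBracket.graded i j k _ _ h.ne'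

-- Up to weight sum `N`, where `nat` respects brackets exactly, the structure functions are
-- prescribed to be the Lie bracket. The remaining ones are arbitrary but vanish in the limit `t =
-- 0`.
variable (g) in
lemma exists_isLiftData [CompleteSpace E] : ∃ A : M → Tot V →L[ℝ] Tot V →L[ℝ] Tot V,
    IsLiftData g.base g.nat g.nat A (fun _ => ContinuousLinearMap.id ℝ (Tot V)) ∧
    ∀ x X C, rescale₂ 0 (A x) X C = g.bracket X C := by
  obtain ⟨A, h1, h2, h3, h4, h5⟩ := g.toGradedBasis.exists_structure g.bracket N
    g.isGradedLieBracket.alt isFilteredBilin_bracket fun i j X C hij x => by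
      rw [bracketAt_apply]
      simp only [homProj_apply]
      exact g.nat_bracket i j _ _ hij x
  exact ⟨A, ⟨g.isOpen_base, g.compactlySupported, g.compactlySupported, h1, h2, h3, h4,
    contMDiff_const, fun _ => isFilteredMap_id, fun _ _ _ => rfl⟩,
    fun x => g.isGradedLieBracket.rescale₂_zero (h5 x)⟩

/-- At scale 0 the structure functions are the constant bracket and the coefficients the identity,
so the lifting equation is the one in `IsNilpotentBracket.exists_eq_bch`. -/
lemma IsProduct.of_isLiftCurve_zero {ρ : ℝ} {x : M}
    (hA : ∀ x X C, rescale₂ 0 (A x) X C = g.bracket X C)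
    (hρ : ∀ (z : ℝ → Tot V) X Y, X ∈ ball 0 ρ → Y ∈ ball 0 ρ → z 0 = X →
      (∀ s ∈ Icc (0 : ℝ) 1, z s ∈ ball 0 ρ ∧ ∃ τ, IsTransport (fun _ => toCLM₂ g.bracket (z s)) τ ∧
        HasDerivWithinAt z (Ring.inverse τ Y) (Icc 0 1) s) → z 1 = bch N g.bracket Y X)
    {X Y : Tot V} (hX : X ∈ ball 0 ρ) (hY : Y ∈ ball 0 ρ) {ζ : ℝ → Tot V}
    (hζ : IsLiftCurve g.nat A (fun _ => ContinuousLinearMap.id ℝ (Tot V)) Y X x 0 ζ)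
    (hm : ∀ s ∈ Icc (0 : ℝ) 1, ζ s ∈ ball 0 ρ) : ζ 1 = bch N g.bracket Y X := by
  refine hρ ζ X Y hX hY hζ.zero fun s hs => ⟨hm s hs, ?_⟩
  obtain ⟨τ, hτ⟩ := hζ.exists_transport s hs
  refine ⟨τ, hτ.congr fun s' _ => ?_, ?_⟩
  · ext1 C
    exact hA _ _ _
  · have h1 := hζ.hasDerivWithinAt s hs
    rw [liftField, hτ.eq, rescale_id] at h1
    exact h1

/-- The local lift with `S = id`, restricted so that its values stay in `g.dom` and its arguments in
the ball of the Baker–Campbell–Hausdorff comparison. Surjectivity of its `Y`-derivative makes `(Z,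
x, t)` a submersion. -/
lemma hasLocalSubmersion_isProduct [CompleteSpace E]
    (h : IsLiftData g.base g.nat g.nat A (fun _ => ContinuousLinearMap.id ℝ (Tot V)))
    (hA : ∀ x X C, rescale₂ 0 (A x) X C = g.bracket X C) {x₀ : M} (hx₀ : x₀ ∈ g.base) :
    HasLocalSubmersion (𝓘(ℝ, Tot V).prod (modelBU E V)) (modelBU E V) (g.IsProduct A)
      (0, 0, x₀, 0) := by
  obtain ⟨ρ, hρ0, hρ⟩ := g.isGradedLieBracket.isNilpotentBracket.exists_eq_bch
  obtain ⟨O, Z, hO, h0, hZ, hZ0, hprop⟩ := h.exists_local hx₀ hρ0 (by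
    rw [rescale_id]
    exact Function.surjective_id)
  obtain ⟨G, hGo, hG0, hG⟩ := mem_nhdsWithin.1 (g.dom_mem_nhds x₀ hx₀)
  let ψ : Tot V × Tot V × M × ℝ → Tot V × M × ℝ := fun q => (Z q, q.2.2)
  have hψ : ContMDiffOn (𝓘(ℝ, Tot V).prod (modelBU E V)) (modelBU E V) ∞ ψ O :=
    hZ.prodMk (contMDiff_snd.comp contMDiff_snd).contMDiffOn
  have hO₁ : IsOpen (O ∩ ψ ⁻¹' G) := hψ.continuousOn.isOpen_inter_preimage hO hGo
  refine ⟨O ∩ ψ ⁻¹' G ∩ (ball 0 ρ ×ˢ ball 0 ρ ×ˢ univ), ψ,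
    hO₁.inter (isOpen_ball.prod (isOpen_ball.prod isOpen_univ)),
    ⟨⟨h0, ?_⟩, mem_ball_self hρ0, mem_ball_self hρ0, mem_univ _⟩,
    hψ.mono fun q hq => hq.1.1, ?_⟩
  · simp only [ψ, mem_preimage, hZ0]
    exact hG0
  · rintro ⟨Y, X, x, t⟩ ⟨⟨hq, hqG⟩, hY, hX, -⟩
    obtain ⟨hx, ⟨ζ, hζ, hζ1, hζρ⟩, hY0, hX0, hflow, -, hsurj⟩ := hprop Y X x t hq
    refine ⟨⟨rfl, ⟨hx, ⟨ζ, hζ, hζ1⟩, hflow⟩, fun ht => hG ⟨hqG, hx, ht⟩, fun ht => ?_, hY0,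
      fun hX' => ?_⟩, ?_⟩
    · obtain rfl : t = 0 := ht
      exact hζ1.symm.trans (IsProduct.of_isLiftCurve_zero hA hρ hX hY hζ hζρ)
    · have h1 := hX0 hX'
      simp only [rescale_id] at h1
      exact h1 fun _ _ => trivial
    · refine surjective_mfderiv_prodMk (I := modelBU E V) (J := 𝓘(ℝ, E).prod 𝓘(ℝ, ℝ))
        (π := Prod.snd) (((hZ _ hq).contMDiffAt (hO.mem_nhds hq)).mdifferentiableAt (by simp))
        mdifferentiableAt_snd ?_ hsurj
      rw [mfderiv_snd]
      exact fun v => ⟨(0, v), rfl⟩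

variable (g) in
/-- The pseudo group law of a graded Lie basis. -/
theorem exists_pseudoGroupLaw :
    ∃ (D : Set (Tot V × Tot V × M × ℝ)) (φ : Tot V × Tot V × M × ℝ → Tot V × M × ℝ),
      (∃ O, IsOpen O ∧ D = O ∩ halfSpace₂ V g.base) ∧
      (∀ x ∈ g.base, (0, 0, x, 0) ∈ D) ∧
      (∀ c : ℝ, 0 < c → ∀ q ∈ D, act₂ c q ∈ D) ∧
      Set.MapsTo φ D g.dom ∧
      IsSubmersionOn (𝓘(ℝ, Tot V).prod (modelBU E V)) (modelBU E V) φ D ∧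
      (∀ c : ℝ, 0 < c → ∀ q ∈ D, φ (act₂ c q) = FilteredFol.act c (φ q)) ∧
      (∀ Y X x t, (Y, X, x, t) ∈ D → ev g.nat (φ (Y, X, x, t)) =
        (flowOne (g.nat (dil t Y)) (flowOne (g.nat (dil t X)) x), x, t)) ∧
      (∀ Y X, ∀ x ∈ g.base, (Y, X, x, 0) ∈ D ∧
        φ (Y, X, x, 0) = (bch N g.bracket Y X, x, 0)) ∧
      (∀ X x t, (0, X, x, t) ∈ D → φ (0, X, x, t) = (X, x, t)) ∧
      (∀ Y x t, (Y, 0, x, t) ∈ D → φ (Y, 0, x, t) = (Y, x, t)) := by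
  have : CompleteSpace E := FiniteDimensional.complete ℝ E
  obtain ⟨A, h, hA⟩ := g.exists_isLiftData
  -- A point of `M` is needed only for the junk value of the glued map.
  rcases isEmpty_or_nonempty M with hM | ⟨⟨m⟩⟩
  · refine ⟨∅, fun q => q.2, ⟨∅, isOpen_empty, by simp⟩, fun x => hM.elim x, ?_, ?_, ?_, ?_, ?_,
      fun _ _ x => hM.elim x, ?_, ?_⟩
    all_goals simp [IsSubmersionOn, ContMDiffOn, MapsTo]
  set O : Set (Tot V × Tot V × M × ℝ) := {q | HasLocalSubmersion
    (𝓘(ℝ, Tot V).prod (modelBU E V)) (modelBU E V) (g.IsProduct A) q} with hOdef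
  have hO : IsOpen O := isOpen_setOf_hasLocalSubmersion _
  have hOact : ∀ c : ℝ, 0 < c → ∀ q ∈ O, act₂ c q ∈ O := fun c hc q hq =>
    HasLocalSubmersion.act hq (contMDiff_act₂ c) (contMDiff_act₂ c⁻¹) (contMDiff_act c)
      (contMDiff_act c⁻¹) (act₂_act₂_inv hc.ne') (act₂_inv_act₂ hc.ne') (act_act_inv hc.ne')
      (act_inv_act hc.ne') fun q u hu => hu.act h.filtered_A hc
  obtain ⟨φ, hφ, hsub⟩ := exists_isSubmersionOn (I := 𝓘(ℝ, Tot V).prod (modelBU E V))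
    (J := modelBU E V) (R := g.IsProduct A) (fun _ _ _ => IsProduct.unique)
    (uniqueMDiffOn_halfSpace₂ (E := E) (V := V) g.isOpen_base) (0, m, 0)
  have h00 : ∀ x ∈ g.base, ((0, 0, x, 0) : Tot V × Tot V × M × ℝ) ∈ O := fun x hx =>
    hasLocalSubmersion_isProduct h hA hx
  have h0 : ∀ Y X, ∀ x ∈ g.base, ((Y, X, x, 0) : Tot V × Tot V × M × ℝ) ∈ O := by
    intro Y X x hx
    obtain ⟨c, hc, hcO⟩ := exists_act₂_mem hO (h00 x hx) Y X
    rw [← act₂_inv_act₂ hc.ne' (Y, X, x, 0)]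
    exact hOact _ (inv_pos.2 hc) _ hcO
  have hval : ∀ Y X x t, (Y, X, x, t) ∈ O → ∀ Z, (φ (Y, X, x, t)).1 = Z →
      φ (Y, X, x, t) = (Z, x, t) := fun Y X x t hq Z hZ => Prod.ext hZ (hφ _ hq).1
  refine ⟨O ∩ halfSpace₂ V g.base, φ, ⟨O, hO, rfl⟩, fun x hx => ⟨h00 x hx, hx, le_rfl⟩,
    fun c hc q hq => ⟨hOact c hc q hq.1, hq.2.1, mul_nonneg (inv_pos.2 hc).le hq.2.2⟩,
    fun q hq => (hφ q hq.1).2.2.1 hq.2.2, hsub, fun c hc q hq => ?_, fun Y X x t hq => ?_,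
    fun Y X x hx => ⟨⟨h0 Y X x hx, hx, le_rfl⟩, hval _ _ _ _ (h0 Y X x hx) _
      ((hφ _ (h0 Y X x hx)).2.2.2.1 rfl)⟩,
    fun X x t hq => hval _ _ _ _ hq.1 _ ((hφ _ hq.1).2.2.2.2.1 rfl),
    fun Y x t hq => hval _ _ _ _ hq.1 _ ((hφ _ hq.1).2.2.2.2.2 rfl)⟩
  · exact (hφ _ (hOact c hc q hq.1)).unique ((hφ q hq.1).act h.filtered_A hc)
  · rw [hval Y X x t hq.1 _ rfl]
    exact Prod.ext (hφ _ hq.1).2.1.flow.symm rfl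

end GradedLieBasis

end PseudoGroup

/-! ### The osculating space and minimality -/

section Comparison

open Set Metric

variable {E : Type*} [NormedAddCommGroup E] [NormedSpace ℝ E]
  {M : Type*} [TopologicalSpace M] [ChartedSpace E M] [IsManifold 𝓘(ℝ, E) ∞ M]
  {N : ℕ} {V W : Fin N → Type*} [∀ i, NormedAddCommGroup (V i)] [∀ i, NormedSpace ℝ (V i)]
  [∀ i, FiniteDimensional ℝ (V i)]
  [∀ i, NormedAddCommGroup (W i)] [∀ i, NormedSpace ℝ (W i)]
  {F : FilteredFoliation E M N}

lemma fsmul_mem_lowerOrder {k : Fin N} {x : M} {f : SmoothFun E M} (hf : f x = 0) {X : VF E M}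
    (hX : X ∈ F.mod (k + 1)) : fsmul f X ∈ lowerOrder F k x :=
  Submodule.mem_sup_right (Submodule.subset_span ⟨f, hf, X, hX, rfl⟩)

/-- If `f` is a bump function at `x` supported where `X` vanishes, then `X = (1 - f) X` and `1 - f`
lies in `I_x`. -/
lemma mem_lowerOrder_of_eqOn_zero [FiniteDimensional ℝ E] [T2Space M] {k : Fin N} {x : M}
    {U : Set M} (hU : U ∈ 𝓝 x) {X : VF E M} (hX : X ∈ F.mod (k + 1)) (h : ∀ y ∈ U, X y = 0) :
    X ∈ lowerOrder F k x := by
  obtain ⟨f, -, hf⟩ := (SmoothBumpFunction.nhds_basis_support (I := 𝓘(ℝ, E)) hU).mem_iff.1 hU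
  let χ : SmoothFun E M := ⟨fun y => 1 - f y, contMDiff_const.sub f.contMDiff⟩
  have hχ : fsmul χ X = X := by
    ext y
    change (1 - f y) • X y = X y
    by_cases hy : y ∈ U
    · rw [h y hy, smul_zero]
    · rw [Function.notMem_support.1 fun hy' => hy (hf hy'), sub_zero, one_smul]
  rw [← hχ]
  refine fsmul_mem_lowerOrder ?_ hX
  change 1 - f x = 0
  rw [f.eq_one, sub_self]

namespace GradedBasis

lemma natAt_apply (b : GradedBasis F V) (x : M) (X : Tot V) (k : Fin N) :
    b.natAt x X k = Submodule.Quotient.mk ⟨b.nat (Pi.single k (X k)), b.nat_mem k (X k)⟩ := rfl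

variable [FiniteDimensional ℝ E] [T2Space M]

/-- On the base, `Z` is a combination of homogeneous fields with coefficients from `g`. Terms of
weight below that of `k` lie in the previous step of the filtration, and terms above it vanish. In
weight exactly that of `k`, freezing the coefficients at `x` costs an element of `I_x` times the
module. Off the base nothing is known, which `mem_lowerOrder_of_eqOn_zero` repairs. -/
lemma sub_nat_mem_lowerOrder (b : GradedBasis F V) {k : Fin N} {Z : VF E M}
    (hZ : Z ∈ F.mod (k + 1)) {g : M → Tot V} (hg : ContMDiff 𝓘(ℝ, E) 𝓘(ℝ, Tot V) ∞ g)
    (hgk : ∀ y i, wt k < wt i → g y i = 0) (hgZ : ∀ y ∈ b.base, evalVF y (b.nat (g y)) = Z y)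
    {x : M} (hx : x ∈ b.base) : Z - b.nat (Pi.single k (g x k)) ∈ lowerOrder F k x := by
  let f : (Σ i, Fin (Module.finrank ℝ (V i))) → SmoothFun E M := fun p =>
    ⟨fun y => homCoord p (g y), (homCoord p).contMDiff.comp hg⟩
  let X : (Σ i, Fin (Module.finrank ℝ (V i))) → VF E M := fun p => b.nat (homBasis V p)
  have hX : ∀ p, X p ∈ F.mod (p.1 + 1) := fun p => by
    simp only [X, homBasis_apply]
    exact b.nat_mem _ _
  have hcoord : ∀ p (C : Tot V), homCoord p (homProj p.1 C) = homCoord p C := by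
    intro p C
    conv_rhs => rw [← sum_homProj C, map_sum]
    rw [Finset.sum_eq_single p.1 (fun i _ hi => homCoord_homProj hi.symm C) (by simp)]
  have hf0 : ∀ p, wt k < wt p.1 → fsmul (f p) (X p) = 0 := by
    intro p hp
    ext y
    change homCoord p (g y) • (X p) y = _
    rw [← hcoord, homProj_apply, hgk y _ hp, Pi.single_zero, map_zero, zero_smul]
    rfl
  have hmem : ∀ p, fsmul (f p) (X p) ∈ F.mod (k + 1) := by
    intro p
    rcases lt_or_ge (wt k) (wt p.1) with hp | hp
    · rw [hf0 p hp]
      exact Submodule.zero_mem _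
    · exact F.mono hp ((F.distribution _).fsmul_mem _ _ (hX p))
  have h1 : Z - ∑ p, fsmul (f p) (X p) ∈ lowerOrder F k x := by
    refine mem_lowerOrder_of_eqOn_zero (b.isOpen_base.mem_nhds hx)
      (Submodule.sub_mem _ hZ (Submodule.sum_mem _ fun p _ => hmem p)) fun y hy => ?_
    have h3 : evalVF y (Z - ∑ p, fsmul (f p) (X p)) = 0 := by
      rw [map_sub, map_sum, sub_eq_zero]
      exact (hgZ y hy).symm.trans (sum_homCoord_map (evalVF y ∘ₗ b.nat) (g y)).symm
    exact h3
  have h2 : ∑ p, fsmul (f p) (X p) - b.nat (Pi.single k (g x k)) ∈ lowerOrder F k x := by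
    rw [← homProj_apply, ← sum_homCoord_map b.nat (homProj k (g x)), ← Finset.sum_sub_distrib]
    refine Submodule.sum_mem _ fun p _ => ?_
    by_cases hp : p.1 = k
    · obtain ⟨i, j⟩ := p
      obtain rfl : i = k := hp
      have h3 : fsmul (f ⟨i, j⟩) (X ⟨i, j⟩) -
          homCoord ⟨i, j⟩ (homProj i (g x)) • b.nat (homBasis V ⟨i, j⟩) =
          fsmul (f ⟨i, j⟩ - ContMDiffMap.const (f ⟨i, j⟩ x)) (X ⟨i, j⟩) := by
        ext y
        rw [hcoord ⟨i, j⟩]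
        exact (sub_smul _ _ _).symm
      rw [h3]
      exact fsmul_mem_lowerOrder (sub_self _) (hX ⟨i, j⟩)
    · rw [homCoord_homProj hp, zero_smul, sub_zero]
      rcases lt_or_gt_of_ne fun h => hp (wt_injective h) with h | h
      · exact Submodule.mem_sup_left
          (F.mono (Nat.lt_succ_iff.1 h) ((F.distribution _).fsmul_mem _ _ (hX p)))
      · rw [hf0 p h]
        exact Submodule.zero_mem _
  simpa using Submodule.add_mem _ h1 h2

lemma natAt_surjective (b : GradedBasis F V) {x : M} (hx : x ∈ b.base) :
    Function.Surjective (b.natAt x) := by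
  intro v
  have h : ∀ k : Fin N, ∃ a : V k, Submodule.Quotient.mk
      ⟨b.nat (Pi.single k a), b.nat_mem k a⟩ = v k := by
    intro k
    obtain ⟨⟨Z, hZ⟩, hZv⟩ := Submodule.Quotient.mk_surjective _ (v k)
    obtain ⟨g, hg, hgk, hgZ⟩ := b.exists_coeff (wt_pos k) k.pos hZ
    refine ⟨g x k, ?_⟩
    rw [← hZv, eq_comm, Submodule.Quotient.eq]
    exact b.sub_nat_mem_lowerOrder hZ hg hgk hgZ hx
  choose a ha using h
  exact ⟨a, funext ha⟩

/-- In each weight the map is onto between spaces of equal dimension. Surjectivity also shows that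
`grPiece` is finite-dimensional, so that its `finrank` carries information. -/
lemma IsMinimalAt.natAt_injective {b : GradedBasis F V} {p : M} (h : b.IsMinimalAt p) :
    Function.Injective (b.natAt p) := by
  have hs := b.natAt_surjective h.1
  have key : ∀ k : Fin N, Function.Injective fun a : V k => b.natAt p (Pi.single k a) k := by
    intro k
    let n : V k →ₗ[ℝ] grPiece F k p :=
      LinearMap.proj k ∘ₗ b.natAt p ∘ₗ LinearMap.single ℝ V k
    have hn : Function.Surjective n := by
      intro v
      obtain ⟨X, hX⟩ := hs (Pi.single k v)
      refine ⟨X k, ?_⟩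
      have := congrFun hX k
      rw [Pi.single_eq_same, natAt_apply] at this
      change b.natAt p (Pi.single k (X k)) k = v
      rw [natAt_apply, Pi.single_eq_same, this]
    have : FiniteDimensional ℝ (grPiece F k p) := Module.Finite.of_surjective n hn
    exact (LinearMap.injective_iff_surjective_of_finrank_eq_finrank (h.2 k)).2 hn
  intro X Y hXY
  funext k
  apply key k
  have := congrFun hXY k
  rw [natAt_apply, natAt_apply] at this
  simp only [natAt_apply, Pi.single_eq_same]
  exact this

/-- In the second basis the field of a homogeneous `Y` of weight `k` has coefficients `S y Y`.
Modulo lower order only their weight `k` part at `x` counts, and that is the graded part of `S x`.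
-/
lemma natAt_rescale_zero [∀ i, FiniteDimensional ℝ (W i)] (b : GradedBasis F W)
    (b' : GradedBasis F V) {S : M → Tot W →L[ℝ] Tot V}
    (hS : ContMDiff 𝓘(ℝ, E) 𝓘(ℝ, Tot W →L[ℝ] Tot V) ∞ S)
    (hf : ∀ x, IsFilteredMap (S x))
    (hc : ∀ x ∈ b'.base, ∀ Y, evalVF x (b'.nat (S x Y)) = b.nat Y x) {x : M} (hx : x ∈ b'.base)
    (Y : Tot W) : b'.natAt x (rescale 0 (S x) Y) = b.natAt x Y := by
  funext k
  rw [natAt_apply, natAt_apply, eq_comm, Submodule.Quotient.eq, rescale_zero (hf x)]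
  refine b'.sub_nat_mem_lowerOrder (g := fun y => S y (homProj k Y)) (b.nat_mem k (Y k)) ?_
    (fun y i hi => hf y k i Y hi) (fun y hy => hc y hy _) hx
  exact hS.clm_apply contMDiff_const

/-- The graded part of `S p` followed by the injective `b'.natAt p` is the surjective `b.natAt p`.
This is where the dimension condition enters. -/
lemma IsMinimalAt.surjective_rescale_zero [∀ i, FiniteDimensional ℝ (W i)]
    {b : GradedBasis F W} {b' : GradedBasis F V} {p : M} (hp : p ∈ b.base) (hm : b'.IsMinimalAt p)
    {S : M → Tot W →L[ℝ] Tot V} (hS : ContMDiff 𝓘(ℝ, E) 𝓘(ℝ, Tot W →L[ℝ] Tot V) ∞ S)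
    (hf : ∀ x, IsFilteredMap (S x))
    (hc : ∀ x ∈ b'.base, ∀ Y, evalVF x (b'.nat (S x Y)) = b.nat Y x) :
    Function.Surjective (rescale 0 (S p)) := by
  intro v
  obtain ⟨Y, hY⟩ := b.natAt_surjective hp (b'.natAt p v)
  exact ⟨Y, hm.natAt_injective ((b.natAt_rescale_zero b' hS hf hc hm.1 Y).trans hY)⟩

end GradedBasis

end Comparison

/-! ### The comparison map to a minimal graded basis -/

section ComparisonMap

open Set Metric

variable {E : Type*} [NormedAddCommGroup E] [NormedSpace ℝ E] [FiniteDimensional ℝ E]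
  {M : Type*} [TopologicalSpace M] [T2Space M] [ChartedSpace E M] [IsManifold 𝓘(ℝ, E) ∞ M]
  {N : ℕ} {V W : Fin N → Type*} [∀ i, NormedAddCommGroup (V i)] [∀ i, NormedSpace ℝ (V i)]
  [∀ i, FiniteDimensional ℝ (V i)]
  [∀ i, NormedAddCommGroup (W i)] [∀ i, NormedSpace ℝ (W i)] [∀ i, FiniteDimensional ℝ (W i)]
  {F : FilteredFoliation E M N}

namespace GradedBasis

/-- The relation whose graph is the comparison map from the first graded basis to the second. -/
def IsComparison (b : GradedBasis F W) (b' : GradedBasis F V)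
    (A : M → Tot V →L[ℝ] Tot V →L[ℝ] Tot V) (S : M → Tot W →L[ℝ] Tot V) (q : Tot W × M × ℝ)
    (u : Tot V × M × ℝ) : Prop :=
  -- The lift starts at `X = 0`, so its flow identity says that both evaluation maps have the same
  -- end point.
  u.2 = q.2 ∧ IsLift b'.base b'.nat b.nat A S q.1 0 q.2.1 q.2.2 u.1 ∧
    (0 ≤ q.2.2 → q ∈ b.dom ∧ u ∈ b'.dom) ∧ (q.2.2 = 0 → u.1 = rescale 0 (S q.2.1) q.1)

variable {b : GradedBasis F W} {b' : GradedBasis F V} {A : M → Tot V →L[ℝ] Tot V →L[ℝ] Tot V}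
  {S : M → Tot W →L[ℝ] Tot V}

lemma IsComparison.unique {q : Tot W × M × ℝ} {u u' : Tot V × M × ℝ}
    (h : b.IsComparison b' A S q u) (h' : b.IsComparison b' A S q u') : u = u' :=
  Prod.ext (h.2.1.unique h'.2.1) (h.1.trans h'.1.symm)

lemma IsComparison.act {q : Tot W × M × ℝ} {u : Tot V × M × ℝ} (h : b.IsComparison b' A S q u)
    (hA : ∀ x, IsFilteredBilin (A x)) (hS : ∀ x, IsFilteredMap (S x)) {c : ℝ} (hc : 0 < c) :
    b.IsComparison b' A S (FilteredFol.act c q) (FilteredFol.act c u) := by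
  obtain ⟨h1, h2, h3, h4⟩ := h
  refine ⟨?_, ?_, fun ht => ?_, fun ht => ?_⟩
  · simp only [FilteredFol.act, h1]
  · have := h2.dilate hA hS hc.ne'
    rwa [dil_zero_right] at this
  · have h5 := h3 (nonneg_of_mul_nonneg_right ht (inv_pos.2 hc))
    exact ⟨b.act_mem c hc _ h5.1, b'.act_mem c hc _ h5.2⟩
  · have ht' : q.2.2 = 0 := (mul_eq_zero.1 ht).resolve_left (inv_ne_zero hc.ne')
    have h5 := rescale_dil (hS q.2.1) 0 hc.ne' q.1
    rw [mul_zero] at h5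
    simp only [FilteredFol.act]
    rw [h4 ht', h5]

lemma hasLocalSubmersion_isComparison [CompleteSpace E]
    (h : IsLiftData b'.base b'.nat b.nat A S) {p : M} (hp : p ∈ b.base) (hp' : p ∈ b'.base)
    (hS : Function.Surjective (rescale 0 (S p))) (hb : b.base = b'.base) :
    HasLocalSubmersion (modelBU E W) (modelBU E V) (b.IsComparison b' A S) (0, p, 0) := by
  obtain ⟨O, Z, hO, h0, hZ, hZ0, hprop⟩ := h.exists_local hp' one_pos hS
  obtain ⟨G, hGo, hG0, hG⟩ := mem_nhdsWithin.1 (b.dom_mem_nhds p hp)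
  obtain ⟨G', hGo', hG0', hG'⟩ := mem_nhdsWithin.1 (b'.dom_mem_nhds p hp')
  let ι : Tot W × M × ℝ → Tot W × Tot V × M × ℝ := fun q => (q.1, 0, q.2)
  have hι : ContMDiff (modelBU E W) (𝓘(ℝ, Tot W).prod (modelBU E V)) ∞ ι :=
    contMDiff_fst.prodMk (contMDiff_const.prodMk contMDiff_snd)
  have hZι : ContMDiffOn (modelBU E W) 𝓘(ℝ, Tot V) ∞ (fun q => Z (ι q)) (ι ⁻¹' O) :=
    hZ.comp hι.contMDiffOn fun q hq => hq
  let ψ : Tot W × M × ℝ → Tot V × M × ℝ := fun q => (Z (ι q), q.2)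
  have hψ : ContMDiffOn (modelBU E W) (modelBU E V) ∞ ψ (ι ⁻¹' O) :=
    hZι.prodMk contMDiff_snd.contMDiffOn
  have hOι : IsOpen (ι ⁻¹' O) := hO.preimage hι.continuous
  refine ⟨ι ⁻¹' O ∩ ψ ⁻¹' G' ∩ G, ψ, (hψ.continuousOn.isOpen_inter_preimage hOι hGo').inter hGo,
    ⟨⟨h0, ?_⟩, hG0⟩, hψ.mono fun q hq => hq.1.1, ?_⟩
  · simp only [ψ, ι, mem_preimage, hZ0]
    exact hG0'
  · rintro ⟨Y, x, t⟩ ⟨⟨hq, hqG'⟩, hqG⟩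
    obtain ⟨hx, ⟨ζ, hζ, hζ1, -⟩, -, hX0, hflow, -, hsurj⟩ := hprop Y 0 x t hq
    refine ⟨⟨rfl, ⟨hx, ⟨ζ, hζ, hζ1⟩, hflow⟩,
      fun ht => ⟨hG ⟨hqG, hb ▸ hx, ht⟩, hG' ⟨hqG', hx, ht⟩⟩, fun ht => ?_⟩, ?_⟩
    · obtain rfl : t = 0 := ht
      -- At `t = 0` all fields vanish and the orbit stays at `x`. The lifted coefficient is then
      -- constant, and the lift equals the graded map exactly, not only to first order.
      refine hX0 rfl fun s _ => ?_
      rw [flowPt, dil_zero_left, map_zero, flowOne_zero]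
    · refine surjective_mfderiv_prodMk (I := 𝓘(ℝ, E).prod 𝓘(ℝ, ℝ)) (J := 𝓘(ℝ, E).prod 𝓘(ℝ, ℝ))
        (h := fun q => Z (ι q)) (π := fun z => z)
        (((hZι _ hq).contMDiffAt (hOι.mem_nhds hq)).mdifferentiableAt (by simp))
        mdifferentiableAt_id ?_ hsurj
      have h1 : mfderiv (𝓘(ℝ, E).prod 𝓘(ℝ, ℝ)) (𝓘(ℝ, E).prod 𝓘(ℝ, ℝ)) (fun z : M × ℝ => z)
          (x, t) = ContinuousLinearMap.id ℝ _ := mfderiv_id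
      rw [h1]
      exact Function.surjective_id

lemma exists_isLiftData_comparison [CompleteSpace E] (b : GradedBasis F W)
    (b' : GradedBasis F V) :
    ∃ A S, IsLiftData b'.base b'.nat b.nat A S := by
  obtain ⟨S, hS1, hS2, hS3⟩ := b'.exists_comparison b.nat b.nat_mem
  -- No bracket is prescribed: the threshold 0 is vacuous, as weights are positive.
  obtain ⟨A, h1, h2, h3, h4, -⟩ := b'.exists_structure 0 0 (fun _ => rfl)
    (fun _ _ _ _ _ _ => rfl)
    (fun i j _ _ h => absurd h (by have := wt_pos i; omega))
  exact ⟨A, S, b'.isOpen_base, b'.compactlySupported, b.compactlySupported, h1, h2, h3, h4, hS1,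
    hS2, hS3⟩

/-- The comparison map from a graded basis to a minimal one. -/
theorem exists_comparisonMap (b : GradedBasis F W) (b' : GradedBasis F V) (p : M)
    (hb : b.base = b'.base) (hp : p ∈ b.base) (hm : b'.IsMinimalAt p) :
    ∃ (D : Set (Tot W × M × ℝ)) (φ : Tot W × M × ℝ → Tot V × M × ℝ),
      (∃ O, IsOpen O ∧ D = O ∩ halfSpace W b.base) ∧
      (0, p, 0) ∈ D ∧
      (∀ c : ℝ, 0 < c → ∀ q ∈ D, FilteredFol.act c q ∈ D) ∧
      D ⊆ b.dom ∧
      Set.MapsTo φ D b'.dom ∧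
      IsSubmersionOn (modelBU E W) (modelBU E V) φ D ∧
      (∀ c : ℝ, 0 < c → ∀ q ∈ D, φ (FilteredFol.act c q) = FilteredFol.act c (φ q)) ∧
      (∀ q ∈ D, ev b'.nat (φ q) = ev b.nat q) ∧
      (∀ x ∈ b.base, (0, x, 0) ∈ D → ∀ X, (X, x, 0) ∈ D ∧
        (φ (X, x, 0)).2 = (x, 0) ∧
        b'.natAt x (φ (X, x, 0)).1 = b.natAt x X) := by
  have : CompleteSpace E := FiniteDimensional.complete ℝ E
  obtain ⟨A, S, h⟩ := b.exists_isLiftData_comparison b'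
  set O : Set (Tot W × M × ℝ) := {q | HasLocalSubmersion
    (modelBU E W) (modelBU E V) (b.IsComparison b' A S) q} with hOdef
  have hO : IsOpen O := isOpen_setOf_hasLocalSubmersion _
  have hOact : ∀ c : ℝ, 0 < c → ∀ q ∈ O, FilteredFol.act c q ∈ O := fun c hc q hq =>
    HasLocalSubmersion.act hq (contMDiff_act c) (contMDiff_act c⁻¹) (contMDiff_act c)
      (contMDiff_act c⁻¹) (act_act_inv hc.ne') (act_inv_act hc.ne') (act_act_inv hc.ne')
      (act_inv_act hc.ne') fun q u hu => hu.act h.filtered_A h.filtered_S hc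
  obtain ⟨φ, hφ, hsub⟩ := exists_isSubmersionOn (I := modelBU E W)
    (J := modelBU E V) (R := b.IsComparison b' A S) (fun _ _ _ => IsComparison.unique)
    (uniqueMDiffOn_halfSpace (E := E) (V := W) b.isOpen_base) (0, p, 0)
  have hpO : ((0, p, 0) : Tot W × M × ℝ) ∈ O := hasLocalSubmersion_isComparison h hp hm.1
    (hm.surjective_rescale_zero hp h.smooth_S h.filtered_S h.comparison) hb
  refine ⟨O ∩ halfSpace W b.base, φ, ⟨O, hO, rfl⟩, ⟨hpO, hp, le_rfl⟩,
    fun c hc q hq => ⟨hOact c hc q hq.1, hq.2.1, mul_nonneg (inv_pos.2 hc).le hq.2.2⟩,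
    fun q hq => ((hφ q hq.1).2.2.1 hq.2.2).1, fun q hq => ((hφ q hq.1).2.2.1 hq.2.2).2, hsub,
    fun c hc q hq => (hφ _ (hOact c hc q hq.1)).unique
      ((hφ q hq.1).act h.filtered_A h.filtered_S hc),
    fun q hq => ?_, fun x hx hx0 X => ?_⟩
  · obtain ⟨h1, h2, -⟩ := hφ q hq.1
    have h3 := h2.flow
    rw [show flowPt b'.nat q.2.2 q.2.1 0 = q.2.1 by
      rw [flowPt, dil_zero_right, map_zero, flowOne_zero]] at h3
    simp only [ev, h1]
    rw [h3]
    rfl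
  · have hX : ((X, x, 0) : Tot W × M × ℝ) ∈ O := by
      obtain ⟨c, hc, hcO⟩ := exists_act_mem hO hx0.1 X
      rw [← act_inv_act hc.ne' (X, x, 0)]
      exact hOact _ (inv_pos.2 hc) _ hcO
    refine ⟨⟨hX, hx, le_rfl⟩, (hφ _ hX).1, ?_⟩
    rw [(hφ _ hX).2.2.2 rfl]
    exact b.natAt_rescale_zero b' h.smooth_S h.filtered_S h.comparison (hb ▸ hx) X

end GradedBasis

end ComparisonMap

end FilteredFol

end



theorem mainTheorem10
    {E : Type*} [NormedAddCommGroup E] [NormedSpace ℝ E] [FiniteDimensional ℝ E]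
    {M : Type*} [TopologicalSpace M] [T2Space M] [SecondCountableTopology M]
    [ChartedSpace E M] [IsManifold 𝓘(ℝ, E) ∞ M]
    {N : ℕ} (F : FilteredFol.FilteredFoliation E M N)
    {L V V' : Fin N → Type*}
    [∀ i, NormedAddCommGroup (L i)] [∀ i, NormedSpace ℝ (L i)] [∀ i, FiniteDimensional ℝ (L i)]
    [∀ i, NormedAddCommGroup (V i)] [∀ i, NormedSpace ℝ (V i)] [∀ i, FiniteDimensional ℝ (V i)]
    [∀ i, NormedAddCommGroup (V' i)] [∀ i, NormedSpace ℝ (V' i)]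
    [∀ i, FiniteDimensional ℝ (V' i)] :
    -- the pseudo group law of a graded Lie basis
    (∀ g : FilteredFol.GradedLieBasis F L,
      ∃ (D : Set (FilteredFol.Tot L × FilteredFol.Tot L × M × ℝ))
        (φ : FilteredFol.Tot L × FilteredFol.Tot L × M × ℝ → FilteredFol.Tot L × M × ℝ),
        (∃ O, IsOpen O ∧ D = O ∩ FilteredFol.halfSpace₂ L g.base) ∧
        (∀ x ∈ g.base, (0, 0, x, 0) ∈ D) ∧
        (∀ c : ℝ, 0 < c → ∀ q ∈ D, FilteredFol.act₂ c q ∈ D) ∧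
        Set.MapsTo φ D g.dom ∧
        FilteredFol.IsSubmersionOn (𝓘(ℝ, FilteredFol.Tot L).prod (FilteredFol.modelBU E L))
          (FilteredFol.modelBU E L) φ D ∧
        (∀ c : ℝ, 0 < c → ∀ q ∈ D, φ (FilteredFol.act₂ c q) = FilteredFol.act c (φ q)) ∧
        (∀ Y X x t, (Y, X, x, t) ∈ D →
          FilteredFol.ev g.nat (φ (Y, X, x, t)) =
            (FilteredFol.flowOne (g.nat (FilteredFol.dil t Y))
              (FilteredFol.flowOne (g.nat (FilteredFol.dil t X)) x), x, t)) ∧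
        (∀ Y X, ∀ x ∈ g.base, (Y, X, x, 0) ∈ D ∧
          φ (Y, X, x, 0) = (FilteredFol.bch N g.bracket Y X, x, 0)) ∧
        (∀ X x t, (0, X, x, t) ∈ D → φ (0, X, x, t) = (X, x, t)) ∧
        (∀ Y x t, (Y, 0, x, t) ∈ D → φ (Y, 0, x, t) = (Y, x, t))) ∧
    -- comparison of a graded basis with a minimal one
    (∀ (b : FilteredFol.GradedBasis F V) (b' : FilteredFol.GradedBasis F V') (p : M),
      b.base = b'.base → p ∈ b.base → b'.IsMinimalAt p →
      ∃ (D : Set (FilteredFol.Tot V × M × ℝ))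
        (φ : FilteredFol.Tot V × M × ℝ → FilteredFol.Tot V' × M × ℝ),
        (∃ O, IsOpen O ∧ D = O ∩ FilteredFol.halfSpace V b.base) ∧
        (0, p, 0) ∈ D ∧
        (∀ c : ℝ, 0 < c → ∀ q ∈ D, FilteredFol.act c q ∈ D) ∧
        D ⊆ b.dom ∧
        Set.MapsTo φ D b'.dom ∧
        FilteredFol.IsSubmersionOn (FilteredFol.modelBU E V) (FilteredFol.modelBU E V') φ D ∧
        (∀ c : ℝ, 0 < c → ∀ q ∈ D, φ (FilteredFol.act c q) = FilteredFol.act c (φ q)) ∧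
        (∀ q ∈ D, FilteredFol.ev b'.nat (φ q) = FilteredFol.ev b.nat q) ∧
        (∀ x ∈ b.base, (0, x, 0) ∈ D → ∀ X, (X, x, 0) ∈ D ∧
          (φ (X, x, 0)).2 = (x, 0) ∧
          b'.natAt x (φ (X, x, 0)).1 = b.natAt x X)) :=
  ⟨fun g => g.exists_pseudoGroupLaw, fun b b' p hb hp hm => b.exists_comparisonMap b' p hb hp hm⟩
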